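/- Let $d\ge 2$. There is a constant $K_d>0$, depending only on $d$, such that the following holds for $M=\mathbb{R}^d$ and for $M=\mathbb{T}^d=\mathbb{R}^d/\mathbb{Z}^d$. All functions are real-valued, $H^1=H^1(M)$ is the $L^2$-based Sobolev space, $H^{-1}$ is its dual, and $L^2\subset H^{-1}$ in the usual way. Let $A\in L^p(M;\mathbb{R}^{d\times d})$ with $p\in[2,\infty]$ be antisymmetric almost everywhere, let $b_1$ be the distributional vector field $b_1^j=\sum_i\partial_iA_{ij}$, and let $b_2\in L^r(M;\mathbb{R}^d)$, where either $r\in(d,\infty]$, or $d\ge 3$, $r=d$ and $\|b_2\|_{L^d(M)}\le K_d$. Put $b=b_1+b_2$. Let $\rho\in C_c^\infty(\mathbb{R}^d)$ with $\rho\ge 0$ and $\int\rho=1$, let $\rho^n=n^d\rho(n\,\cdot)$ and $b^n=\rho^n*b$ for $n\ge 1$. Then $\mathcal{L}^n=\Delta+b^n\cdot\nabla$ is a bounded operator $H^1\to H^{-1}$ for every $n$, and there is $\lambda_0>0$ such that for all $\lambda>\lambda_0$ and all $n\ge 1$ the resolvent $(\lambda-\mathcal{L}^n)^{-1}\in L(H^{-1},H^1)$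 exists, with $$\sup_n\|(\lambda-\mathcal{L}^n)^{-1}\|_{L(H^{-1},H^1)}<\infty .$$ Moreover, for every $\lambda>\lambda_0$ and every subsequence $(n_k)$ of the positive integers there exist a further subsequence $(n_{k_l})$ and a strongly continuous semigroup $P$ on $L^2(M)$ such that: (i) the generator $(\mathcal{D},\mathcal{L})$ of $P$ has domain $\mathcal{D}\subset H^1$ and satisfies $\mathcal{L}u=\Delta u+\nabla\cdot(A\cdot\nabla u)+b_2\cdot\nabla u$ in the sense of distributions for all $u\in\mathcal{D}$, where $\nabla\cdot(A\cdot\nabla u)=\sum_i\partial_i\big(\sum_jA_{ij}\partial_ju\big)$; (ii) $(\lambda-\mathcal{L})^{-1}\in L(L^2(M))$ exists and extends to an element of $L(H^{-1},H^1)$, and for this extension $(\lambda-\mathcal{L}^{n_{k_l}})^{-1}u^\sharp\to(\lambda-\mathcal{L})^{-1}u^\sharp$ weakly in $H^1$ as $l\to\infty$, for every $u^\sharp\in H^{-1}$. -/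

import Mathlib

open MeasureTheory Filter Topology
open scoped ENNReal NNReal ContDiff Matrix

noncomputable section

/-- The two underlying spaces `M`: Euclidean space `ℝᵈ` and the flat torus `𝕋ᵈ = ℝᵈ / ℤᵈ`. -/
inductive BaseSpace : Type
  | euclidean
  | torus

/-- The points of `M`. -/
def BaseSpace.Pt (d : ℕ) : BaseSpace → Type
  | .euclidean => EuclideanSpace ℝ (Fin d)
  | .torus => UnitAddTorus (Fin d)

namespace BaseSpace

variable {d : ℕ}

instance instAddCommGroupPt : (S : BaseSpace) → AddCommGroup (S.Pt d)
  | .euclidean => inferInstanceAs (AddCommGroup (EuclideanSpace ℝ (Fin d)))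
  | .torus => inferInstanceAs (AddCommGroup (UnitAddTorus (Fin d)))

instance instTopologicalSpacePt : (S : BaseSpace) → TopologicalSpace (S.Pt d)
  | .euclidean => inferInstanceAs (TopologicalSpace (EuclideanSpace ℝ (Fin d)))
  | .torus => inferInstanceAs (TopologicalSpace (UnitAddTorus (Fin d)))

/-- Lebesgue measure on `ℝᵈ`, and Lebesgue (normalized Haar) measure on `𝕋ᵈ`. -/
instance instMeasureSpacePt : (S : BaseSpace) → MeasureSpace (S.Pt d)
  | .euclidean => inferInstanceAs (MeasureSpace (EuclideanSpace ℝ (Fin d)))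
  | .torus => inferInstanceAs (MeasureSpace (UnitAddTorus (Fin d)))

instance instBorelSpacePt : (S : BaseSpace) → BorelSpace (S.Pt d)
  | .euclidean => inferInstanceAs (BorelSpace (EuclideanSpace ℝ (Fin d)))
  | .torus => inferInstanceAs (BorelSpace (UnitAddTorus (Fin d)))

instance instIsTopologicalAddGroupPt : (S : BaseSpace) → IsTopologicalAddGroup (S.Pt d)
  | .euclidean => inferInstanceAs (IsTopologicalAddGroup (EuclideanSpace ℝ (Fin d)))
  | .torus => inferInstanceAs (IsTopologicalAddGroup (UnitAddTorus (Fin d)))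

instance instIsAddHaarMeasurePt :
    (S : BaseSpace) → (volume : Measure (S.Pt d)).IsAddHaarMeasure
  | .euclidean =>
      inferInstanceAs (volume : Measure (EuclideanSpace ℝ (Fin d))).IsAddHaarMeasure
  | .torus => inferInstanceAs (volume : Measure (UnitAddTorus (Fin d))).IsAddHaarMeasure

/-- The projection `ℝᵈ → M`: the identity on `ℝᵈ`, reduction modulo `ℤᵈ` on `𝕋ᵈ`.
Functions on `𝕋ᵈ` correspond to periodic functions on `ℝᵈ` by composition with it. -/
def proj : (S : BaseSpace) → EuclideanSpace ℝ (Fin d) → S.Pt d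
  | .euclidean => fun x => x
  | .torus => fun x i => (x i : UnitAddCircle)

lemma proj_add (S : BaseSpace) (x y : EuclideanSpace ℝ (Fin d)) :
    S.proj (x + y) = S.proj x + S.proj y := by
  cases S
  · rfl
  · funext i
    exact AddCircle.coe_add 1 (x i) (y i)

lemma isOpenQuotientMap_proj (S : BaseSpace) :
    IsOpenQuotientMap (S.proj : EuclideanSpace ℝ (Fin d) → S.Pt d) := by
  cases S
  · exact IsOpenQuotientMap.id
  · have h1 : IsOpenQuotientMap
        (Pi.map (fun _ : Fin d => ((↑) : ℝ → UnitAddCircle))) :=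
      IsOpenQuotientMap.piMap fun _ => QuotientAddGroup.isOpenQuotientMap_mk
    exact h1.comp (EuclideanSpace.equiv (Fin d) ℝ).toHomeomorph.isOpenQuotientMap

end BaseSpace

variable {d : ℕ} {S : BaseSpace}

/-- The `i`-th (classical) partial derivative of a function on `M`. -/
def partialDeriv (i : Fin d) (φ : S.Pt d → ℝ) (x : S.Pt d) : ℝ :=
  deriv (fun t : ℝ => φ (x + S.proj (EuclideanSpace.single i t))) 0

/-- Test functions on `M`: the class `C_c^∞(M)` (which is `C^∞(M)` for the torus). -/
structure IsTestFunction (φ : S.Pt d → ℝ) : Prop where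
  smooth : ContDiff ℝ ∞ (φ ∘ S.proj)
  compactSupport : HasCompactSupport φ

lemma IsTestFunction.memLp {φ : S.Pt d → ℝ} (h : IsTestFunction φ) : MemLp φ 2 volume :=
  (S.isOpenQuotientMap_proj.isQuotientMap.continuous_iff.2
    h.smooth.continuous).memLp_of_hasCompactSupport h.compactSupport

lemma partialDeriv_proj {φ : S.Pt d → ℝ} (h : IsTestFunction φ) (i : Fin d)
    (y : EuclideanSpace ℝ (Fin d)) :
    partialDeriv i φ (S.proj y)
      = fderiv ℝ (φ ∘ S.proj) y (EuclideanSpace.single i 1) := by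
  have hd : DifferentiableAt ℝ (φ ∘ S.proj) y :=
    (h.smooth.differentiable (by simp)).differentiableAt
  rw [← hd.lineDeriv_eq_fderiv]
  unfold partialDeriv lineDeriv
  congr 1
  funext t
  have h1 : EuclideanSpace.single i t = t • EuclideanSpace.single i (1 : ℝ) := by
    ext j
    simp
  simp [← BaseSpace.proj_add, h1]

lemma IsTestFunction.memLp_partialDeriv {φ : S.Pt d → ℝ} (h : IsTestFunction φ) (i : Fin d) :
    MemLp (partialDeriv i φ) 2 volume := by
  have hc : Continuous (partialDeriv i φ) := by
    refine S.isOpenQuotientMap_proj.isQuotientMap.continuous_iff.2 ?_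
    have h1 : partialDeriv i φ ∘ S.proj
        = fun y => fderiv ℝ (φ ∘ S.proj) y (EuclideanSpace.single i 1) :=
      funext fun y => partialDeriv_proj h i y
    rw [h1]
    exact (h.smooth.continuous_fderiv (by simp)).clm_apply continuous_const
  refine hc.memLp_of_hasCompactSupport (h.compactSupport.mono' fun x hx => ?_)
  by_contra hx'
  refine hx ?_
  have hcont : Continuous fun t : ℝ => x + S.proj (EuclideanSpace.single i t) := by
    refine continuous_const.add (S.isOpenQuotientMap_proj.continuous.comp ?_)
    have h1 : (fun t : ℝ => EuclideanSpace.single i t)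
        = fun t : ℝ => t • EuclideanSpace.single i (1 : ℝ) := by
      funext t
      ext j
      simp
    change Continuous (fun t : ℝ => EuclideanSpace.single i t)
    exact h1 ▸ continuous_id.smul continuous_const
  have h0 : S.proj (EuclideanSpace.single i (0 : ℝ)) = 0 := by
    have h2 := BaseSpace.proj_add S (0 : EuclideanSpace ℝ (Fin d)) 0
    have h3 : EuclideanSpace.single i (0 : ℝ) = 0 := by
      ext j
      simp
    rw [h3]
    simpa using h2
  have hev : (fun t : ℝ => φ (x + S.proj (EuclideanSpace.single i t))) =ᶠ[𝓝 0] fun _ => 0 := by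
    have hmem : (tsupport φ)ᶜ ∈ 𝓝 (x + S.proj (EuclideanSpace.single i (0 : ℝ))) := by
      rw [h0, add_zero]
      exact (isClosed_tsupport φ).isOpen_compl.mem_nhds hx'
    filter_upwards [hcont.continuousAt.preimage_mem_nhds hmem] with t ht
    exact image_eq_zero_of_notMem_tsupport ht
  unfold partialDeriv
  rw [hev.deriv_eq]
  simp

/-- The real Hilbert space `L²(M)`. -/
abbrev LTwo (S : BaseSpace) (d : ℕ) : Type := Lp ℝ 2 (volume : Measure (S.Pt d))

/-- `g` is the weak `i`-th partial derivative of `u`. -/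
def HasWeakPartial (i : Fin d) (u g : LTwo S d) : Prop :=
  ∀ φ : S.Pt d → ℝ, IsTestFunction φ →
    ∫ x, u x * partialDeriv i φ x = -∫ x, g x * φ x

/-- The Sobolev space `H¹(M)`: pairs `(u, ∇u)` of a function `u ∈ L²(M)` and its weak gradient in
`L²(M)ᵈ`, with the norm `(‖u‖² + ∑ᵢ ‖∂ᵢu‖²)^(1/2)`. -/
def sobolevH1 (S : BaseSpace) (d : ℕ) :
    Submodule ℝ (WithLp 2 (LTwo S d × PiLp 2 (fun _ : Fin d => LTwo S d))) where
  carrier := {U | ∀ i, HasWeakPartial i U.fst (U.snd i)}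
  zero_mem' := by
    intro i φ hφ
    have h0 : ⇑(0 : LTwo S d) =ᵐ[volume] 0 := Lp.coeFn_zero _ _ _
    have h1 : ∫ x, (0 : LTwo S d) x * partialDeriv i φ x = 0 :=
      integral_eq_zero_of_ae (by filter_upwards [h0] with x hx; simp)
    have h2 : ∫ x, (0 : LTwo S d) x * φ x = 0 :=
      integral_eq_zero_of_ae (by filter_upwards [h0] with x hx; simp)
    change ∫ x, (0 : LTwo S d) x * partialDeriv i φ x = -∫ x, (0 : LTwo S d) x * φ x
    rw [h1, h2, neg_zero]
  add_mem' := by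
    intro U V hU hV i φ hφ
    have key : ∀ (f g : LTwo S d) (ψ : S.Pt d → ℝ), MemLp ψ 2 volume →
        ∫ x, (f + g) x * ψ x = (∫ x, f x * ψ x) + ∫ x, g x * ψ x := by
      intro f g ψ hψ
      have hf : Integrable (fun x => f x * ψ x) := (Lp.memLp f).integrable_mul hψ
      have hg : Integrable (fun x => g x * ψ x) := (Lp.memLp g).integrable_mul hψ
      rw [← integral_add hf hg]
      refine integral_congr_ae ?_
      filter_upwards [Lp.coeFn_add f g] with x hx
      rw [hx, Pi.add_apply, add_mul]
    change ∫ x, (U.fst + V.fst) x * partialDeriv i φ x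
      = -∫ x, (U.snd i + V.snd i) x * φ x
    rw [key _ _ _ (hφ.memLp_partialDeriv i), key _ _ _ hφ.memLp, hU i φ hφ, hV i φ hφ]
    ring
  smul_mem' := by
    intro c U hU i φ hφ
    have key : ∀ (f : LTwo S d) (ψ : S.Pt d → ℝ),
        ∫ x, (c • f) x * ψ x = c * ∫ x, f x * ψ x := by
      intro f ψ
      rw [← integral_const_mul]
      refine integral_congr_ae ?_
      filter_upwards [Lp.coeFn_smul c f] with x hx
      rw [hx, Pi.smul_apply, smul_eq_mul, mul_assoc]
    change ∫ x, (c • U.fst) x * partialDeriv i φ x = -∫ x, (c • U.snd i) x * φ x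
    rw [key, key, hU i φ hφ]
    ring

/-- `H¹(M)` as a real inner product space. -/
def SobolevH1 (S : BaseSpace) (d : ℕ) : Type := sobolevH1 S d

instance : NormedAddCommGroup (SobolevH1 S d) :=
  inferInstanceAs (NormedAddCommGroup (sobolevH1 S d))

instance : InnerProductSpace ℝ (SobolevH1 S d) :=
  inferInstanceAs (InnerProductSpace ℝ (sobolevH1 S d))

/-- `H⁻¹(M)`, the dual space of `H¹(M)` with its operator norm. -/
abbrev SobolevHm1 (S : BaseSpace) (d : ℕ) : Type := SobolevH1 S d →L[ℝ] ℝ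

/-- The weak partial derivative `∂ᵢu ∈ L²(M)` of `u ∈ H¹(M)`. -/
def SobolevH1.partial (u : SobolevH1 S d) (i : Fin d) : LTwo S d := u.1.snd i

/-- The inclusion `H¹(M) ⊂ L²(M)`. -/
def H1ToLTwo (S : BaseSpace) (d : ℕ) : SobolevH1 S d →L[ℝ] LTwo S d :=
  LinearMap.mkContinuous
    { toFun := fun u => u.1.fst
      map_add' := fun _ _ => rfl
      map_smul' := fun _ _ => rfl } 1 fun u => by
    have h1 : ‖u‖ ^ 2 = ‖u.1.fst‖ ^ 2 + ‖u.1.snd‖ ^ 2 := WithLp.prod_norm_sq_eq_of_L2 u.1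
    have h2 : ‖u.1.fst‖ ≤ ‖u‖ :=
      le_of_sq_le_sq (by rw [h1]; nlinarith [sq_nonneg ‖u.1.snd‖]) (norm_nonneg u)
    rw [one_mul]
    exact h2

/-- The inclusion `L²(M) ⊂ H⁻¹(M)`: `f ↦ (v ↦ ⟨f, v⟩_{L²})`. -/
def LTwoToHm1 (S : BaseSpace) (d : ℕ) : LTwo S d →L[ℝ] SobolevHm1 S d :=
  ((ContinuousLinearMap.compL ℝ (SobolevH1 S d) (LTwo S d) ℝ).flip (H1ToLTwo S d)).comp
    (innerSL ℝ : LTwo S d →L[ℝ] LTwo S d →L[ℝ] ℝ)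

/-- The inclusion `H¹(M) ⊂ H⁻¹(M)`. -/
def H1ToHm1 (S : BaseSpace) (d : ℕ) : SobolevH1 S d →L[ℝ] SobolevHm1 S d :=
  (LTwoToHm1 S d).comp (H1ToLTwo S d)

/-- A positive mollifier on `ℝᵈ`. -/
structure IsMollifier (ρ : EuclideanSpace ℝ (Fin d) → ℝ) : Prop where
  smooth : ContDiff ℝ ∞ ρ
  compactSupport : HasCompactSupport ρ
  nonneg : ∀ x, 0 ≤ ρ x
  integral_eq_one : ∫ x, ρ x = 1

/-- The rescaled mollifier `ρⁿ = nᵈ ρ(n ·)`. -/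
def scaledMollifier (ρ : EuclideanSpace ℝ (Fin d) → ℝ) (n : ℕ+) :
    EuclideanSpace ℝ (Fin d) → ℝ :=
  fun z => (n : ℝ) ^ d * ρ ((n : ℝ) • z)

/-- The smooth drift `bⁿ = ρⁿ ∗ b`, `b = b₁ + b₂`, where `b₁` is the distribution with components
`b₁ʲ = ∑ᵢ ∂ᵢ Aᵢⱼ`. Testing `b₁ʲ` against `ρⁿ(x - ·)` moves the derivative onto the mollifier:
`(ρⁿ ∗ b₁)ʲ = ∑ᵢ (∂ᵢ ρⁿ) ∗ Aᵢⱼ`. On the torus the convolution is that of the periodic function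
with `ρⁿ` over `ℝᵈ`. -/
def mollifiedDrift (ρ : EuclideanSpace ℝ (Fin d) → ℝ) (n : ℕ+)
    (A : S.Pt d → Matrix (Fin d) (Fin d) ℝ) (b₂ : S.Pt d → EuclideanSpace ℝ (Fin d))
    (x : S.Pt d) (j : Fin d) : ℝ :=
  (∑ i, ∫ z : EuclideanSpace ℝ (Fin d),
      fderiv ℝ (scaledMollifier ρ n) z (EuclideanSpace.single i 1) * A (x - S.proj z) i j)
    + ∫ z : EuclideanSpace ℝ (Fin d), scaledMollifier ρ n z * b₂ (x - S.proj z) j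

/-- `L : H¹(M) → H⁻¹(M)` is the operator `Δ + β · ∇`: for `u, v ∈ H¹(M)` the product
`(β · ∇u) v` is integrable and `⟨L u, v⟩ = -∑ⱼ ⟨∂ⱼu, ∂ⱼv⟩_{L²} + ∫ (β · ∇u) v`. -/
def IsLaplacianPlusDrift (β : S.Pt d → Fin d → ℝ)
    (L : SobolevH1 S d →L[ℝ] SobolevHm1 S d) : Prop :=
  ∀ u v : SobolevH1 S d,
    Integrable (fun x => (∑ j, β x j * u.partial j x) * H1ToLTwo S d v x) ∧
    L u v = -(∑ j, ∫ x, u.partial j x * v.partial j x)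
      + ∫ x, (∑ j, β x j * u.partial j x) * H1ToLTwo S d v x

/-- The distribution `Δu + ∇·(A·∇u) + b₂·∇u`, for `u ∈ H¹(M)`, evaluated at the test function
`φ`; here `∇·(A·∇u) = ∑ᵢ ∂ᵢ (∑ⱼ Aᵢⱼ ∂ⱼu)`. -/
def limitOperator (A : S.Pt d → Matrix (Fin d) (Fin d) ℝ)
    (b₂ : S.Pt d → EuclideanSpace ℝ (Fin d)) (u : SobolevH1 S d) (φ : S.Pt d → ℝ) : ℝ :=
  -(∫ x, ∑ i, u.partial i x * partialDeriv i φ x)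
    - (∫ x, ∑ i, (∑ j, A x i j * u.partial j x) * partialDeriv i φ x)
    + ∫ x, (∑ j, b₂ x j * u.partial j x) * φ x

/-- Strongly continuous semigroups of bounded operators on a real normed space. -/
structure C0Semigroup (X : Type*) [NormedAddCommGroup X] [NormedSpace ℝ X] where
  op : ℝ≥0 → X →L[ℝ] X
  op_zero : op 0 = ContinuousLinearMap.id ℝ X
  op_add : ∀ s t, op (s + t) = (op s).comp (op t)
  continuous_orbit : ∀ x, Continuous fun t => op t x

/-- `u` lies in the domain of the (infinitesimal) generator of `P`, and the generator maps `u`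
to `w`: `(P_t u - u) / t → w` as `t ↓ 0`. -/
def C0Semigroup.GeneratorMaps {X : Type*} [NormedAddCommGroup X] [NormedSpace ℝ X]
    (P : C0Semigroup X) (u w : X) : Prop :=
  Tendsto (fun t : ℝ≥0 => (t : ℝ)⁻¹ • (P.op t u - u)) (𝓝[>] 0) (𝓝 w)

/-- `R` is the bounded inverse `(lam - 𝓛)⁻¹` of `lam - 𝓛 : 𝓓 → X`, where `(𝓓, 𝓛)` is the
generator of `P`. -/
def C0Semigroup.IsResolvent {X : Type*} [NormedAddCommGroup X] [NormedSpace ℝ X]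
    (P : C0Semigroup X) (lam : ℝ) (R : X →L[ℝ] X) : Prop :=
  (∀ f, ∃ w, P.GeneratorMaps (R f) w ∧ lam • R f - w = f) ∧
  ∀ u w, P.GeneratorMaps u w → R (lam • u - w) = u

end

/-! ### Contraction semigroups on a Hilbert space -/

section HilbertSemigroup

open scoped InnerProductSpace

variable {H : Type*} [NormedAddCommGroup H] [InnerProductSpace ℝ H]

/-! Everything rests on one coercivity estimate that is uniform in `n`, followed by weak
compactness. Write `Aⁿ = ρⁿ ∗ A` and `b₂ⁿ = ρⁿ ∗ b₂`. Because `Aⁿ` is smooth and antisymmetric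
everywhere, the drift `∑ᵢ ∂ᵢAⁿᵢⱼ` acts on `H¹` as the divergence form operator `∇·(Aⁿ∇u)`
(`sum_inner_mulL_partialDeriv`, `driftOp_eq`). Hence the form of `λ - Lⁿ` is `λ⟨u,v⟩ + ⟨∇u,∇v⟩ +
⟨Aⁿ∇u,∇v⟩ - ⟨b₂ⁿ·∇u,v⟩`. On the diagonal the `Aⁿ` term vanishes, so the size of `A` does not enter.
For the last term, `b₂` is split into a bounded part and a part small in `Lˢ`
(`exists_bdd_add_small`). By Hölder and the Sobolev embedding `H¹ ⊂ L^q`, `1/s + 1/q = 1/2`,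
multiplication by the small part is a small operator `H¹ → L²`; the bounded part is absorbed by a
large `λ`. Mollification increases neither the sup norm nor the `Lˢ` norm, so the constants do not
depend on `n` (`exists_norm_mulL_kernelConv_le`, `driftOp_coercive`). Lax–Milgram then gives the
resolvents with a uniform bound.

Since `H⁻¹` and `H¹` are separable, a subsequence of the resolvents converges in the weak operator
topology to some `G : H⁻¹ → H¹` (`exists_subseq_tendsto_weak_operator`). Against a test function `φ`
the coefficients can be moved onto `φ`: the products `Aⁿᵢⱼ ∂ᵢφ` and `b₂ⁿ φ` converge strongly in
`L²`, while the gradients of the solutions converge weakly. So `u = G F` satisfies `λu - Δu -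
∇·(A∇u) - b₂·∇u = F` as distributions. For unbounded `A` the product `(A∇u)·∇v` need not be
integrable for all `u, v ∈ H¹`; thus Lax–Milgram cannot be applied to the limit directly, and the
limit may depend on the subsequence.

Let `J` be `G` restricted to `L²`. It is monotone, because the nonnegative values of the forms pass
to the weak limit, and injective, because `G F = 0` makes `F` vanish on test functions by the limit
equation. In a Hilbert space these two properties suffice: `-J⁻¹` is maximal dissipative and
generates a contraction semigroup `Q` (`exists_contraction_semigroup`), and `e^{λt} Q_t` has
generator `λ - J⁻¹`, whose resolvent at `λ` is `J` (`exists_semigroup_generatorMaps_iff`). -/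

lemma apply_exp_comm (B C : H →L[ℝ] H) (h : Commute B C) (t : ℝ) (x : H) :
    C (NormedSpace.exp (t • B) x) = NormedSpace.exp (t • B) (C x) := by
  have h1 : Commute C (NormedSpace.exp (t • B)) := (h.symm.smul_right t).exp_right
  exact congrArg (fun T : H →L[ℝ] H => T x) h1.eq

variable [CompleteSpace H]

lemma hasDerivAt_exp_smul_apply (B : H →L[ℝ] H) (x : H) (t : ℝ) :
    HasDerivAt (fun s : ℝ => NormedSpace.exp (s • B) x) (NormedSpace.exp (t • B) (B x)) t :=
  (ContinuousLinearMap.apply ℝ H x).hasFDerivAt.comp_hasDerivAt t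
    (hasDerivAt_exp_smul_const (𝕂 := ℝ) B t)

/-- The derivative of the squared norm along an orbit is `2⟪B y, y⟫ ≤ 0` at `y = exp(sB) x`, since
`B` commutes with its exponential. -/
lemma norm_exp_smul_apply_le {B : H →L[ℝ] H} (hB : ∀ x, ⟪B x, x⟫_ℝ ≤ 0) {t : ℝ} (ht : 0 ≤ t)
    (x : H) : ‖NormedSpace.exp (t • B) x‖ ≤ ‖x‖ := by
  have hd : ∀ s : ℝ, HasDerivAt (fun s : ℝ => ‖NormedSpace.exp (s • B) x‖ ^ 2)
      (2 * ⟪NormedSpace.exp (s • B) x, NormedSpace.exp (s • B) (B x)⟫_ℝ) s :=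
    fun s => (hasDerivAt_exp_smul_apply B x s).norm_sq
  have hanti : Antitone (fun s : ℝ => ‖NormedSpace.exp (s • B) x‖ ^ 2) := by
    refine antitone_of_hasDerivAt_nonpos hd fun s => ?_
    rw [← apply_exp_comm B B (Commute.refl B), real_inner_comm]
    have := hB (NormedSpace.exp (s • B) x)
    simp only [Pi.zero_apply]
    linarith
  have h1 := hanti ht
  simp only [zero_smul, NormedSpace.exp_zero, one_apply_eq_self] at h1
  exact le_of_sq_le_sq h1 (norm_nonneg _)

lemma norm_exp_smul_apply_sub_le {B : H →L[ℝ] H} (hB : ∀ x, ⟪B x, x⟫_ℝ ≤ 0) {s t : ℝ}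
    (hs : 0 ≤ s) (hst : s ≤ t) (x : H) :
    ‖NormedSpace.exp (t • B) x - NormedSpace.exp (s • B) x‖ ≤ ‖B x‖ * (t - s) := by
  refine norm_image_sub_le_of_norm_deriv_le_segment' (f := fun s : ℝ => NormedSpace.exp (s • B) x)
    (fun r _ => (hasDerivAt_exp_smul_apply B x r).hasDerivWithinAt) (fun r hr => ?_) t
    (Set.right_mem_Icc.2 hst)
  exact norm_exp_smul_apply_le hB (hs.trans hr.1) _

/-- Duhamel's argument: the path `s ↦ exp(sB) exp((t - s)C) x` joins the two vectors, and by
commutativity its velocity is `exp(sB) exp((t - s)C)(B x - C x)`, where both exponentials are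
contractions. -/
lemma norm_exp_smul_sub_exp_smul_le {B C : H →L[ℝ] H} (hB : ∀ x, ⟪B x, x⟫_ℝ ≤ 0)
    (hC : ∀ x, ⟪C x, x⟫_ℝ ≤ 0) (hBC : Commute B C) {t : ℝ} (ht : 0 ≤ t) (x : H) :
    ‖NormedSpace.exp (t • B) x - NormedSpace.exp (t • C) x‖ ≤ ‖B x - C x‖ * t := by
  have hd : ∀ s : ℝ, HasDerivAt
      (fun s : ℝ => NormedSpace.exp (s • B) (NormedSpace.exp ((t - s) • C) x))
      (NormedSpace.exp (s • B) (NormedSpace.exp ((t - s) • C) (B x - C x))) s := by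
    intro s
    have h1 := hasDerivAt_exp_smul_const (𝕂 := ℝ) B s
    have h2 : HasDerivAt (fun s : ℝ => NormedSpace.exp ((t - s) • C) x)
        (-(NormedSpace.exp ((t - s) • C) (C x))) s := by
      have h3 := (hasDerivAt_exp_smul_apply C x (t - s)).scomp s
        ((hasDerivAt_id s).const_sub t)
      rw [neg_one_smul] at h3
      exact h3
    have h4 := h1.clm_apply h2
    convert h4 using 1
    rw [map_neg, map_sub, map_sub, ← apply_exp_comm C B hBC.symm]
    simp [sub_eq_add_neg]
  have h1 := norm_image_sub_le_of_norm_deriv_le_segment'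
    (f := fun s : ℝ => NormedSpace.exp (s • B) (NormedSpace.exp ((t - s) • C) x))
    (C := ‖B x - C x‖)
    (fun r _ => (hd r).hasDerivWithinAt) (fun r hr => ?_) t (Set.right_mem_Icc.2 ht)
  · simpa using h1
  · exact (norm_exp_smul_apply_le hB hr.1 _).trans
      (norm_exp_smul_apply_le hC (sub_nonneg.2 hr.2.le) _)

/-- A monotone bounded operator plus a positive multiple of the identity is invertible. -/
lemma exists_inverse_add_smul {J : H →L[ℝ] H} (hJ : ∀ x, 0 ≤ ⟪J x, x⟫_ℝ) {ε : ℝ} (hε : 0 < ε) :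
    ∃ Y : H →L[ℝ] H, (∀ x, J (Y x) + ε • Y x = x) ∧ (∀ x, Y (J x) + ε • Y x = x) := by
  set T : H →L[ℝ] H := J + ε • ContinuousLinearMap.id ℝ H with hT
  set B : H →L[ℝ] H →L[ℝ] ℝ := (innerSL ℝ).comp T with hB
  have hco : IsCoercive B := by
    refine ⟨ε, hε, fun u => ?_⟩
    have h1 : B u u = ⟪J u, u⟫_ℝ + ε * (‖u‖ * ‖u‖) := by
      change ⟪J u + ε • u, u⟫_ℝ = _
      rw [inner_add_left, real_inner_smul_left, real_inner_self_eq_norm_mul_norm]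
    rw [h1]
    nlinarith [hJ u]
  have hE : ∀ x, hco.continuousLinearEquivOfBilin x = J x + ε • x := by
    intro x
    refine ext_inner_right ℝ fun w => ?_
    rw [hco.continuousLinearEquivOfBilin_apply]
    rfl
  refine ⟨hco.continuousLinearEquivOfBilin.symm, fun x => ?_, fun x => ?_⟩
  · have h2 := hE (hco.continuousLinearEquivOfBilin.symm x)
    rw [ContinuousLinearEquiv.apply_symm_apply] at h2
    exact h2.symm
  · have h2 := hco.continuousLinearEquivOfBilin.symm_apply_apply x
    rw [hE, map_add, map_smul] at h2
    exact h2

/-- A vector `g` orthogonal to the range lies in the kernel: monotonicity at `g + t h` reads `t⟪J g,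
h⟫ + t²⟪J h, h⟫ ≥ 0` for every real `t`, which forces the linear coefficient to vanish. -/
lemma denseRange_of_injective_monotone {J : H →L[ℝ] H} (hJ : ∀ x, 0 ≤ ⟪J x, x⟫_ℝ)
    (hinj : Function.Injective J) : DenseRange J := by
  have h1 : J.range.topologicalClosure = ⊤ := by
    rw [Submodule.topologicalClosure_eq_top_iff, Submodule.eq_bot_iff]
    intro g hg
    rw [Submodule.mem_orthogonal] at hg
    have hg' : ∀ y, ⟪J y, g⟫_ℝ = 0 := fun y => hg _ ⟨y, rfl⟩
    have h2 : ∀ h, ⟪J g, h⟫_ℝ = 0 := by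
      intro h
      by_contra hne
      set a := ⟪J g, h⟫_ℝ
      set c := ⟪J h, h⟫_ℝ
      have hc : 0 ≤ c := hJ h
      have h3 : ∀ t : ℝ, 0 ≤ t * a + t * t * c := by
        intro t
        have := hJ (g + t • h)
        simp only [map_add, map_smul, inner_add_left, inner_add_right, inner_smul_left,
          inner_smul_right, hg', RCLike.conj_to_real] at this
        simp only [a, c]
        linarith
      -- Near-minimizer of the quadratic; `c + 1` instead of `c` keeps the denominator positive when
      -- `c = 0`.
      have h4 := h3 (-(a / (c + 1)))
      have h5 : -(a / (c + 1)) * a + -(a / (c + 1)) * -(a / (c + 1)) * c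
          = -(a ^ 2 / (c + 1) ^ 2) := by
        field_simp
        ring
      rw [h5] at h4
      have : 0 < a ^ 2 / (c + 1) ^ 2 := by positivity
      linarith
    have h6 : J g = 0 := inner_self_eq_zero.1 (h2 (J g))
    exact hinj (by rw [h6, map_zero])
  have h2 : Dense (J.range : Set H) := Submodule.dense_iff_topologicalClosure_eq_top.2 h1
  exact h2

/-- The Hille–Yosida theorem for a maximal dissipative operator `-J⁻¹` on a Hilbert space. -/
lemma exists_contraction_semigroup {J : H →L[ℝ] H} (hJ : ∀ x, 0 ≤ ⟪J x, x⟫_ℝ)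
    (hinj : Function.Injective J) :
    ∃ P : C0Semigroup H, (∀ t x, ‖P.op t x‖ ≤ ‖x‖) ∧ ∀ y, P.GeneratorMaps (J y) (-y) := by
  have hdense := denseRange_of_injective_monotone hJ hinj
  -- With `L = J⁻¹`, the bounded operators `Y n = (J + ε n)⁻¹ = L(1 + ε n L)⁻¹` below are the Yosida
  -- approximations of `L`.
  set ε : ℕ → ℝ := fun n => 1 / ((n : ℝ) + 1) with hεdef
  have hε : ∀ n, 0 < ε n := fun n => by positivity
  have hεlim : Tendsto ε atTop (𝓝 0) := tendsto_one_div_add_atTop_nhds_zero_nat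
  choose Y hY1 hY2 using fun n => exists_inverse_add_smul hJ (hε n)
  have hYmono : ∀ n x, 0 ≤ ⟪Y n x, x⟫_ℝ := by
    intro n x
    have h1 : ⟪Y n x, x⟫_ℝ = ⟪J (Y n x), Y n x⟫_ℝ + ε n * ‖Y n x‖ ^ 2 := by
      have h2 : ⟪Y n x, x⟫_ℝ = ⟪Y n x, J (Y n x) + ε n • Y n x⟫_ℝ := by rw [hY1 n x]
      rw [h2, inner_add_right, real_inner_smul_right, real_inner_comm, real_inner_self_eq_norm_sq]
    rw [h1]
    have := hJ (Y n x)
    have := hε n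
    positivity
  have hYbound : ∀ n x, ε n * ‖Y n x‖ ≤ ‖x‖ := by
    intro n x
    rcases eq_or_ne (Y n x) 0 with h0 | h0
    · simp [h0]
    have h1 : ⟪x, Y n x⟫_ℝ = ⟪J (Y n x), Y n x⟫_ℝ + ε n * ‖Y n x‖ ^ 2 := by
      have h2 : ⟪x, Y n x⟫_ℝ = ⟪J (Y n x) + ε n • Y n x, Y n x⟫_ℝ := by rw [hY1 n x]
      rw [h2, inner_add_left, real_inner_smul_left, real_inner_self_eq_norm_sq]
    have h2 := real_inner_le_norm x (Y n x)
    have h3 := hJ (Y n x)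
    have h4 : 0 < ‖Y n x‖ := norm_pos_iff.2 h0
    nlinarith
  have hYcomm : ∀ n m, Commute (Y n) (Y m) := by
    intro n m
    have hYJ : ∀ k x, Y k (J x) = J (Y k x) := fun k x =>
      add_right_cancel ((hY2 k x).trans (hY1 k x).symm)
    ext x
    change Y n (Y m x) = Y m (Y n x)
    have h1 : ∀ z, Y n (Y m z) = Y m (Y n z) := by
      intro z
      have h2 : J (Y m (Y n z)) + ε n • Y m (Y n z) = Y m z := by
        rw [← hYJ, ← map_smul, ← map_add, hY1]
      rw [← h2, map_add, map_smul, hY2]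
    exact h1 x
  set T : ℕ → ℝ≥0 → H →L[ℝ] H := fun n t => NormedSpace.exp ((t : ℝ) • (-Y n)) with hT
  have hdiss : ∀ n x, ⟪(-Y n) x, x⟫_ℝ ≤ 0 := fun n x => by
    have := hYmono n x
    simpa [inner_neg_left] using this
  have hTle : ∀ n t x, ‖T n t x‖ ≤ ‖x‖ := fun n t x =>
    norm_exp_smul_apply_le (hdiss n) t.2 x
  -- On the range of `J`, `Y n (J z) = z - ε n • Y n z` has norm at most `2‖z‖`, so the factor `ε n`
  -- wins; density and `‖ε n • Y n‖ ≤ 1` extend this to every `y`.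
  have hεY : ∀ y, Tendsto (fun n => ε n • Y n y) atTop (𝓝 0) := by
    have hJz : ∀ z, Tendsto (fun n => ε n • Y n (J z)) atTop (𝓝 0) := by
      intro z
      have h1 : ∀ n, ‖ε n • Y n (J z)‖ ≤ ε n * (2 * ‖z‖) := by
        intro n
        have h2 : Y n (J z) = z - ε n • Y n z := eq_sub_of_add_eq (hY2 n z)
        rw [h2, norm_smul, Real.norm_of_nonneg (hε n).le]
        have h3 : ‖ε n • Y n z‖ ≤ ‖z‖ := by
          rw [norm_smul, Real.norm_of_nonneg (hε n).le]; exact hYbound n z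
        have h4 := norm_sub_le z (ε n • Y n z)
        have := hε n
        nlinarith
      refine squeeze_zero_norm h1 ?_
      simpa using hεlim.mul_const (2 * ‖z‖)
    intro y
    rw [Metric.tendsto_atTop]
    intro δ hδ
    obtain ⟨z, hz⟩ := hdense.exists_dist_lt y (half_pos hδ)
    obtain ⟨N, hN⟩ := Metric.tendsto_atTop.1 (hJz z) (δ / 2) (half_pos hδ)
    refine ⟨N, fun n hn => ?_⟩
    have h1 := hN n hn
    rw [dist_zero_right] at h1 ⊢
    have h2 : ε n • Y n y = ε n • Y n (J z) + ε n • Y n (y - J z) := by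
      rw [map_sub, smul_sub]; abel
    have h3 : ‖ε n • Y n (y - J z)‖ < δ / 2 := by
      rw [norm_smul, Real.norm_of_nonneg (hε n).le]
      exact (hYbound n _).trans_lt (by rwa [dist_eq_norm] at hz)
    rw [h2]
    exact (norm_add_le _ _).trans_lt (by linarith)
  have hBJ : ∀ y, Tendsto (fun n => (-Y n) (J y)) atTop (𝓝 (-y)) := by
    intro y
    have h1 : ∀ n, (-Y n) (J y) = ε n • Y n y - y := by
      intro n
      have h2 : Y n (J y) = y - ε n • Y n y := eq_sub_of_add_eq (hY2 n y)
      simp [h2]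
    simp_rw [h1]
    simpa using (hεY y).sub_const y
  -- On vectors `J y` the commuting Duhamel estimate compares two approximations through the
  -- convergent sequence `Y n (J y)`; contractivity transfers the Cauchy property to all `x`.
  have hlim : ∀ t x, ∃ z, Tendsto (fun n => T n t x) atTop (𝓝 z) := by
    intro t x
    refine cauchySeq_tendsto_of_complete (Metric.cauchySeq_iff.2 fun δ hδ => ?_)
    obtain ⟨y, hy⟩ := hdense.exists_dist_lt x (show 0 < δ / 3 by positivity)
    have h1 := (hBJ y).cauchySeq
    obtain ⟨N, hN⟩ := Metric.cauchySeq_iff.1 h1 (δ / 3 / (t + 1)) (by positivity)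
    refine ⟨N, fun m hm n hn => ?_⟩
    have h2 := hN m hm n hn
    have h3 : ‖T m t (J y) - T n t (J y)‖ ≤ _ :=
      norm_exp_smul_sub_exp_smul_le (hdiss m) (hdiss n) ((hYcomm m n).neg_left.neg_right) t.2 (J y)
    rw [dist_eq_norm] at h2 ⊢ hy
    have h4 : T m t x - T n t x
        = T m t (x - J y) + (T m t (J y) - T n t (J y)) - T n t (x - J y) := by
      rw [map_sub, map_sub]; abel
    have h5 : ‖(-Y m) (J y) - (-Y n) (J y)‖ * t ≤ δ / 3 := by
      have ht : (0 : ℝ) ≤ t := t.2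
      rw [lt_div_iff₀ (by positivity)] at h2
      nlinarith [norm_nonneg ((-Y m) (J y) - (-Y n) (J y))]
    rw [h4]
    have h6 := norm_sub_le (T m t (x - J y) + (T m t (J y) - T n t (J y))) (T n t (x - J y))
    have h7 := norm_add_le (T m t (x - J y)) (T m t (J y) - T n t (J y))
    have h8 := hTle m t (x - J y)
    have h9 := hTle n t (x - J y)
    change ‖T m t (J y) - T n t (J y)‖ ≤ ‖(-Y m) (J y) - (-Y n) (J y)‖ * t at h3
    linarith
  choose p hp using hlim
  set Q : ℝ≥0 → H →L[ℝ] H := fun t =>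
    continuousLinearMapOfTendsto (fun n => T n t) (f := p t) (tendsto_pi_nhds.2 (hp t)) with hQ
  have hQlim : ∀ t x, Tendsto (fun n => T n t x) atTop (𝓝 (Q t x)) := hp
  have hQle : ∀ t x, ‖Q t x‖ ≤ ‖x‖ := fun t x =>
    le_of_tendsto' (hQlim t x).norm fun n => hTle n t x
  have hQlip : ∀ y s t, s ≤ t → ‖Q t (J y) - Q s (J y)‖ ≤ ‖y‖ * ((t : ℝ) - s) := by
    intro y s t hst
    have h1 : Tendsto (fun n => ‖(-Y n) (J y)‖ * ((t : ℝ) - s)) atTop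
        (𝓝 (‖y‖ * ((t : ℝ) - s))) := by
      simpa using (hBJ y).norm.mul_const ((t : ℝ) - s)
    exact le_of_tendsto_of_tendsto' ((hQlim t (J y)).sub (hQlim s (J y))).norm h1 fun n =>
      norm_exp_smul_apply_sub_le (hdiss n) s.2 hst (J y)
  have hQ0 : ∀ x, Q 0 x = x := by
    intro x
    refine tendsto_nhds_unique (hQlim 0 x) ?_
    simp [hT, NormedSpace.exp_zero]
  have hQadd : ∀ s t x, Q (s + t) x = Q s (Q t x) := by
    intro s t x
    have h1 : ∀ n, T n (s + t) x = T n s (T n t x) := by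
      intro n
      have h2 : ((s + t : ℝ≥0) : ℝ) • (-Y n) = (s : ℝ) • (-Y n) + (t : ℝ) • (-Y n) := by
        rw [NNReal.coe_add, add_smul]
      have h3 : Commute ((s : ℝ) • (-Y n)) ((t : ℝ) • (-Y n)) :=
        ((Commute.refl (-Y n)).smul_left _).smul_right _
      let _ : NormedAlgebra ℚ (H →L[ℝ] H) := NormedAlgebra.restrictScalars ℚ ℝ _
      simp only [hT]
      rw [h2, NormedSpace.exp_add_of_commute h3]
      rfl
    refine tendsto_nhds_unique (hQlim (s + t) x) ?_
    simp_rw [h1]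
    have h4 : Tendsto (fun n => T n s (T n t x - Q t x)) atTop (𝓝 0) := by
      have h5 : Tendsto (fun n => ‖T n t x - Q t x‖) atTop (𝓝 0) := by
        simpa using ((hQlim t x).sub_const (Q t x)).norm
      exact squeeze_zero_norm (fun n => hTle n s _) h5
    have h6 := h4.add (hQlim s (Q t x))
    simpa using h6
  have hQcont : ∀ x, Continuous fun t => Q t x := by
    intro x
    rw [Metric.continuous_iff]
    intro t δ hδ
    obtain ⟨y, hy⟩ := hdense.exists_dist_lt x (show 0 < δ / 3 by positivity)
    rw [dist_eq_norm] at hy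
    refine ⟨δ / 3 / (‖y‖ + 1), by positivity, fun s hs => ?_⟩
    have h1 : ‖Q s (J y) - Q t (J y)‖ ≤ ‖y‖ * dist s t := by
      rcases le_total s t with h | h
      · rw [norm_sub_rev, NNReal.dist_eq, abs_sub_comm, abs_of_nonneg (sub_nonneg.2 (by exact_mod_cast h))]
        exact hQlip y s t h
      · rw [NNReal.dist_eq, abs_of_nonneg (sub_nonneg.2 (by exact_mod_cast h))]
        exact hQlip y t s h
    have h2 : ‖y‖ * dist s t ≤ δ / 3 := by
      rw [lt_div_iff₀ (by positivity)] at hs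
      nlinarith [dist_nonneg (x := s) (y := t)]
    have h4 : Q s x - Q t x
        = Q s (x - J y) + (Q s (J y) - Q t (J y)) - Q t (x - J y) := by
      rw [map_sub, map_sub]; abel
    rw [dist_eq_norm, h4]
    have h6 := norm_sub_le (Q s (x - J y) + (Q s (J y) - Q t (J y))) (Q t (x - J y))
    have h7 := norm_add_le (Q s (x - J y)) (Q s (J y) - Q t (J y))
    have h8 := hQle s (x - J y)
    have h9 := hQle t (x - J y)
    linarith
  -- The orbit of `J y` has initial velocity `-y`, but `y` itself need not be in the range of `J`,
  -- where orbits are Lipschitz. Hence `y` is compared with an auxiliary `J z`, and the error `2‖y -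
  -- J z‖` is made small at the end by density.
  have hgen : ∀ y z t, ‖Q t (J y) - J y + (t : ℝ) • y‖ ≤ (2 * ‖y - J z‖ + ‖z‖ * t) * t := by
    intro y z t
    have hn : ∀ n, ‖T n t (J y) - J y + (t : ℝ) • y‖
        ≤ (‖(-Y n) (J y) + y‖ + (2 * ‖y - J z‖ + ‖(-Y n) (J z)‖ * t)) * t := by
      intro n
      have hd : ∀ s : ℝ, HasDerivAt (fun s : ℝ => NormedSpace.exp (s • (-Y n)) (J y) + s • y)
          (NormedSpace.exp (s • (-Y n)) ((-Y n) (J y)) + y) s := by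
        intro s
        have h1 := (hasDerivAt_exp_smul_apply (-Y n) (J y) s).add
          ((hasDerivAt_id s).smul_const y)
        rw [one_smul] at h1
        exact h1
      have h1 := norm_image_sub_le_of_norm_deriv_le_segment'
        (f := fun s : ℝ => NormedSpace.exp (s • (-Y n)) (J y) + s • y)
        (C := ‖(-Y n) (J y) + y‖ + (2 * ‖y - J z‖ + ‖(-Y n) (J z)‖ * t))
        (fun r _ => (hd r).hasDerivWithinAt) (fun r hr => ?_) t (Set.right_mem_Icc.2 t.2)
      · have h2 : T n t (J y) - J y + (t : ℝ) • y = T n t (J y) + (t : ℝ) • y - J y := by abel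
        rw [h2]
        simpa [hT, NormedSpace.exp_zero] using h1
      · set E := NormedSpace.exp (r • (-Y n)) with hE
        have hEle : ∀ x, ‖E x‖ ≤ ‖x‖ := norm_exp_smul_apply_le (hdiss n) hr.1
        have h2 : E ((-Y n) (J y)) + y
            = E ((-Y n) (J y) + y) + ((y - J z) - E (y - J z) - (E (J z) - J z)) := by
          rw [map_add, map_sub]; abel
        have h3 : ‖E (J z) - J z‖ ≤ ‖(-Y n) (J z)‖ * t := by
          have h4 := norm_exp_smul_apply_sub_le (hdiss n) le_rfl hr.1 (J z)
          simp only [zero_smul, NormedSpace.exp_zero, one_apply_eq_self,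
            sub_zero] at h4
          exact h4.trans (mul_le_mul_of_nonneg_left hr.2.le (norm_nonneg _))
        rw [h2]
        have h5 := norm_add_le (E ((-Y n) (J y) + y))
          ((y - J z) - E (y - J z) - (E (J z) - J z))
        have h6 := norm_sub_le ((y - J z) - E (y - J z)) (E (J z) - J z)
        have h7 := norm_sub_le (y - J z) (E (y - J z))
        have h8 := hEle (y - J z)
        have h9 := hEle ((-Y n) (J y) + y)
        linarith
    have hl : Tendsto (fun n => (‖(-Y n) (J y) + y‖ + (2 * ‖y - J z‖ + ‖(-Y n) (J z)‖ * t)) * t)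
        atTop (𝓝 ((0 + (2 * ‖y - J z‖ + ‖z‖ * t)) * t)) := by
      have h1 : Tendsto (fun n => ‖(-Y n) (J y) + y‖) atTop (𝓝 0) := by
        simpa using ((hBJ y).add_const y).norm
      have h2 : Tendsto (fun n => ‖(-Y n) (J z)‖) atTop (𝓝 ‖z‖) := by
        simpa using (hBJ z).norm
      exact (h1.add ((h2.mul_const _).const_add _)).mul_const _
    rw [zero_add] at hl
    exact le_of_tendsto_of_tendsto' (((hQlim t (J y)).sub_const (J y)).add_const _).norm hl hn
  refine ⟨⟨Q, ContinuousLinearMap.ext hQ0, fun s t => ContinuousLinearMap.ext (hQadd s t),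
    hQcont⟩, hQle, fun y => ?_⟩
  unfold C0Semigroup.GeneratorMaps
  rw [Metric.tendsto_nhdsWithin_nhds]
  intro δ hδ
  obtain ⟨z, hz⟩ := hdense.exists_dist_lt y (show 0 < δ / 4 by positivity)
  rw [dist_eq_norm] at hz
  refine ⟨δ / 4 / (‖z‖ + 1), by positivity, fun {t} ht htd => ?_⟩
  have ht0 : (0 : ℝ) < t := by exact_mod_cast ht
  have h1 := hgen y z t
  have h2 : (t : ℝ)⁻¹ • (Q t (J y) - J y) - -y = (t : ℝ)⁻¹ • (Q t (J y) - J y + (t : ℝ) • y) := by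
    rw [smul_add, smul_smul, inv_mul_cancel₀ ht0.ne', one_smul, sub_neg_eq_add]
  rw [dist_eq_norm]
  change ‖(t : ℝ)⁻¹ • (Q t (J y) - J y) - -y‖ < δ
  rw [h2, norm_smul, norm_inv, Real.norm_of_nonneg ht0.le, inv_mul_lt_iff₀ ht0]
  have h3 : dist t 0 = (t : ℝ) := by simp [NNReal.dist_eq]
  rw [h3, lt_div_iff₀ (by positivity)] at htd
  refine h1.trans_lt ?_
  rw [mul_comm]
  refine mul_lt_mul_of_pos_left ?_ ht0
  nlinarith

lemma C0Semigroup.GeneratorMaps.sub {X : Type*} [NormedAddCommGroup X] [NormedSpace ℝ X]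
    {P : C0Semigroup X} {u w u' w' : X} (h : P.GeneratorMaps u w) (h' : P.GeneratorMaps u' w') :
    P.GeneratorMaps (u - u') (w - w') := by
  refine (Tendsto.sub h h').congr fun t => ?_
  rw [← smul_sub, map_sub]
  congr 1
  abel

/-- `-J⁻¹` generates a contraction semigroup, and shifting by `lam` gives the generator whose
resolvent at `lam` is `J`. -/
lemma exists_semigroup_generatorMaps_iff {J : H →L[ℝ] H} (hJ : ∀ x, 0 ≤ ⟪J x, x⟫_ℝ)
    (hinj : Function.Injective J) (lam : ℝ) :
    ∃ P : C0Semigroup H, ∀ u w, P.GeneratorMaps u w ↔ u = J (lam • u - w) := by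
  obtain ⟨Q, hQ, hgen⟩ := exists_contraction_semigroup hJ hinj
  have hQiff : ∀ u w, Q.GeneratorMaps u w ↔ u = J (-w) := by
    intro u w
    refine ⟨fun h => ?_, fun h => by rw [h]; simpa using hgen (-w)⟩
    -- Maximality: `y = (J + 1)⁻¹(u - w)` produces a vector `J y` in the domain at which identity
    -- minus generator takes the same value `u - w` as at `u`. The difference `v = u - J y` would be
    -- an eigenvector of the generator with eigenvalue `1`, which contractivity excludes unless `v =
    -- 0`.
    obtain ⟨Y, hY, -⟩ := exists_inverse_add_smul hJ one_pos
    set y := Y (u - w) with hy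
    have h1 : J y + y = u - w := by simpa only [one_smul] using hY (u - w)
    have h2 : Q.GeneratorMaps (u - J y) (u - J y) := by
      have h3 := h.sub (hgen y)
      have h4 : w - -y = u - J y := by
        rw [sub_neg_eq_add, eq_sub_iff_add_eq, add_assoc, add_comm y, h1]; abel
      rwa [h4] at h3
    set v := u - J y with hv
    have h5 : ⟪v, v⟫_ℝ ≤ 0 := by
      have h6 : Tendsto (fun t : ℝ≥0 => ⟪(t : ℝ)⁻¹ • (Q.op t v - v), v⟫_ℝ) (𝓝[>] 0)
          (𝓝 ⟪v, v⟫_ℝ) := Tendsto.inner h2 tendsto_const_nhds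
      refine le_of_tendsto h6 (Eventually.of_forall fun t => ?_)
      rw [inner_smul_left, inner_sub_left]
      have h7 := real_inner_le_norm (Q.op t v) v
      have h8 := hQ t v
      have h9 := real_inner_self_eq_norm_sq v
      have h10 : ⟪Q.op t v, v⟫_ℝ - ⟪v, v⟫_ℝ ≤ 0 := by nlinarith [norm_nonneg v]
      exact mul_nonpos_of_nonneg_of_nonpos (by simp) h10
    have h6 : v = 0 := inner_self_eq_zero.1 (le_antisymm h5 real_inner_self_nonneg)
    have h7 : u = J y := sub_eq_zero.1 h6
    have h8 : y = -w := by
      rw [h7] at h1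
      have : J y + y = J y + -w := by rw [h1]; abel
      exact add_left_cancel this
    rw [← h8, ← h7]
  refine ⟨⟨fun t => Real.exp (lam * t) • Q.op t, ?_, ?_, ?_⟩, ?_⟩
  · simp [Q.op_zero]
  · intro s t
    ext x
    simp only [Q.op_add, NNReal.coe_add, mul_add, Real.exp_add]
    simp [smul_smul, mul_comm]
  · intro x
    have h1 := Q.continuous_orbit x
    have h2 : Continuous fun t : ℝ≥0 => Real.exp (lam * t) := by fun_prop
    exact h2.smul h1
  · intro u w
    -- The two difference quotients differ by `t⁻¹(e^{λt} - 1) Q_t u`, which tends to `λu`;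
    -- rescaling therefore shifts the generator by `λ` without changing its domain.
    have hkey : ∀ u, Tendsto (fun t : ℝ≥0 => (t : ℝ)⁻¹ • (Real.exp (lam * t) • Q.op t u - u)
        - (t : ℝ)⁻¹ • (Q.op t u - u)) (𝓝[>] 0) (𝓝 (lam • u)) := by
      intro u
      have h1 : Tendsto (fun t : ℝ≥0 => (t : ℝ)⁻¹ * (Real.exp (lam * t) - 1)) (𝓝[>] 0)
          (𝓝 lam) := by
        have h2 : HasDerivAt (fun t : ℝ => Real.exp (lam * t)) lam 0 := by
          have := ((hasDerivAt_id (0 : ℝ)).const_mul lam).exp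
          simpa using this
        have h3 := h2.tendsto_slope_zero_right
        have h4 : Tendsto (fun t : ℝ≥0 => (t : ℝ)) (𝓝[>] 0) (𝓝[>] 0) :=
          tendsto_nhdsWithin_of_tendsto_nhds_of_eventually_within _
            ((NNReal.continuous_coe.tendsto 0).mono_left nhdsWithin_le_nhds)
            (by filter_upwards [self_mem_nhdsWithin] with t ht using by exact_mod_cast ht)
        have h5 := h3.comp h4
        simpa [Function.comp_def] using h5
      have h2 : Tendsto (fun t : ℝ≥0 => Q.op t u) (𝓝[>] 0) (𝓝 u) := by
        have h3 := (Q.continuous_orbit u).tendsto 0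
        rw [Q.op_zero] at h3
        exact h3.mono_left nhdsWithin_le_nhds
      refine (h1.smul h2).congr fun t => ?_
      rw [← smul_sub, mul_smul, sub_smul, one_smul]
      congr 1
      abel
    have h1 : (Tendsto (fun t : ℝ≥0 => (t : ℝ)⁻¹ • ((Real.exp (lam * t) • Q.op t) u - u))
        (𝓝[>] 0) (𝓝 w)) ↔ Q.GeneratorMaps u (w - lam • u) := by
      constructor
      · intro h
        refine (Tendsto.sub h (hkey u)).congr fun t => ?_
        simp
      · intro h
        have h2 := Tendsto.add h (hkey u)
        rw [sub_add_cancel] at h2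
        refine h2.congr fun t => ?_
        simp
    refine h1.trans ((hQiff _ _).trans ?_)
    rw [neg_sub]

end HilbertSemigroup

/-! ### Coercive forms and weak compactness -/

section HilbertWeak

open scoped InnerProductSpace

variable {H : Type*} [NormedAddCommGroup H] [InnerProductSpace ℝ H] [CompleteSpace H]

/-- Lax–Milgram, for a coercive operator from `H` to its dual. -/
lemma exists_inverse_of_coercive (B : H →L[ℝ] H →L[ℝ] ℝ) {c : ℝ} (hc : 0 < c)
    (hB : ∀ u, c * ‖u‖ ^ 2 ≤ B u u) :
    ∃ R : (H →L[ℝ] ℝ) →L[ℝ] H, B.comp R = ContinuousLinearMap.id ℝ (H →L[ℝ] ℝ) ∧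
      R.comp B = ContinuousLinearMap.id ℝ H ∧ ‖R‖ ≤ c⁻¹ := by
  have hco : IsCoercive B := ⟨c, hc, fun u => by have := hB u; rwa [sq, ← mul_assoc] at this⟩
  set T := hco.continuousLinearEquivOfBilin
  set D : H ≃L[ℝ] (H →L[ℝ] ℝ) :=
    (InnerProductSpace.toDual ℝ H).toContinuousLinearEquiv with hD
  have hBT : ∀ u, B u = D (T u) := by
    intro u
    ext v
    exact (hco.continuousLinearEquivOfBilin_apply u v).symm
  set R : (H →L[ℝ] ℝ) →L[ℝ] H :=
    (T.symm : H →L[ℝ] H).comp (D.symm : (H →L[ℝ] ℝ) →L[ℝ] H) with hR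
  have hBR : ∀ F, B (R F) = F := fun F => by simp [hBT, hR]
  refine ⟨R, ContinuousLinearMap.ext hBR, ContinuousLinearMap.ext fun u => ?_, ?_⟩
  · simp [hBT, hR]
  · refine ContinuousLinearMap.opNorm_le_bound _ (by positivity) fun F => ?_
    rcases eq_or_ne (R F) 0 with h0 | h0
    · rw [h0, norm_zero]; positivity
    have h1 := hB (R F)
    rw [hBR] at h1
    have h2 : F (R F) ≤ ‖F‖ * ‖R F‖ := (le_abs_self _).trans (F.le_opNorm _)
    have h3 : 0 < ‖R F‖ := norm_pos_iff.2 h0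
    rw [← div_eq_inv_mul, le_div_iff₀ hc]
    nlinarith

/-- Bounded sequences of operators into a separable Hilbert space have subsequences that converge
in the weak operator topology. -/
lemma exists_subseq_tendsto_weak_operator {D : Type*} [NormedAddCommGroup D] [NormedSpace ℝ D]
    [TopologicalSpace.SeparableSpace D] [TopologicalSpace.SeparableSpace H]
    (T : ℕ → D →L[ℝ] H) {C : ℝ} (hT : ∀ m, ‖T m‖ ≤ C) :
    ∃ l : ℕ → ℕ, StrictMono l ∧ ∃ G : D →L[ℝ] H,
      ∀ x y, Tendsto (fun m => ⟪T (l m) x, y⟫_ℝ) atTop (𝓝 ⟪G x, y⟫_ℝ) := by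
  have hC : 0 ≤ C := (norm_nonneg _).trans (hT 0)
  have hbd : ∀ m x y, |⟪T m x, y⟫_ℝ| ≤ C * ‖x‖ * ‖y‖ := fun m x y =>
    (abs_real_inner_le_norm _ _).trans
      (mul_le_mul_of_nonneg_right ((T m).le_of_opNorm_le (hT m) x) (norm_nonneg _))
  set e := TopologicalSpace.denseSeq D
  set f := TopologicalSpace.denseSeq H
  have he : DenseRange e := TopologicalSpace.denseRange_denseSeq D
  have hf : DenseRange f := TopologicalSpace.denseRange_denseSeq H
  -- Tychonoff replaces the diagonal argument: the matrix coefficients on two countable dense sets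
  -- form a point of a countable product of compact intervals, which is sequentially compact.
  have hK : IsCompact (Set.pi Set.univ fun q : ℕ × ℕ =>
      Set.Icc (-(C * ‖e q.1‖ * ‖f q.2‖)) (C * ‖e q.1‖ * ‖f q.2‖)) :=
    isCompact_univ_pi fun _ => isCompact_Icc
  obtain ⟨z, -, l, hl, hz⟩ := hK.tendsto_subseq
    (x := fun m (q : ℕ × ℕ) => ⟪T m (e q.1), f q.2⟫_ℝ)
    (fun m q _ => abs_le.1 (hbd m _ _))
  rw [tendsto_pi_nhds] at hz
  have hlim : ∀ x y, ∃ b, Tendsto (fun m => ⟪T (l m) x, y⟫_ℝ) atTop (𝓝 b) := by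
    intro x y
    refine cauchySeq_tendsto_of_complete (Metric.cauchySeq_iff.2 fun δ hδ => ?_)
    obtain ⟨i, hi⟩ := he.exists_dist_lt x (show 0 < δ / 6 / (C * ‖y‖ + 1) by positivity)
    obtain ⟨j, hj⟩ := hf.exists_dist_lt y (show 0 < δ / 6 / (C * ‖e i‖ + 1) by positivity)
    obtain ⟨N, hN⟩ := Metric.cauchySeq_iff.1 (hz (i, j)).cauchySeq (δ / 3) (by positivity)
    refine ⟨N, fun m hm n hn => ?_⟩
    have h1 := hN m hm n hn
    rw [dist_eq_norm, lt_div_iff₀ (by positivity)] at hi hj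
    simp only [Function.comp_apply, Real.dist_eq] at h1 ⊢
    have hsplit : ∀ k, |⟪T k x, y⟫_ℝ - ⟪T k (e i), f j⟫_ℝ| < δ / 3 := by
      intro k
      have h2 : ⟪T k x, y⟫_ℝ - ⟪T k (e i), f j⟫_ℝ
          = ⟪T k (x - e i), y⟫_ℝ + ⟪T k (e i), y - f j⟫_ℝ := by
        rw [map_sub, inner_sub_left, inner_sub_right]; ring
      rw [h2]
      have h3 := hbd k (x - e i) y
      have h4 := hbd k (e i) (y - f j)
      have h5 := abs_add_le ⟪T k (x - e i), y⟫_ℝ ⟪T k (e i), y - f j⟫_ℝ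
      have h6 := norm_nonneg (x - e i)
      have h7 := norm_nonneg (y - f j)
      nlinarith
    have h2 := abs_lt.1 (hsplit (l m))
    have h3 := abs_lt.1 (hsplit (l n))
    have h4 := abs_lt.1 h1
    exact abs_lt.2 ⟨by linarith, by linarith⟩
  choose b hb using hlim
  -- The limits of the coefficients form a bilinear form bounded by `C`; the Riesz isomorphism turns
  -- it into the limit operator.
  set β : D →ₗ[ℝ] H →ₗ[ℝ] ℝ := LinearMap.mk₂ ℝ b
    (fun x x' y => tendsto_nhds_unique (hb _ _)
      (((hb x y).add (hb x' y)).congr fun m => by rw [map_add, inner_add_left]))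
    (fun c x y => tendsto_nhds_unique (hb _ _)
      (((hb x y).const_mul c).congr fun m => by rw [map_smul, real_inner_smul_left]))
    (fun x y y' => tendsto_nhds_unique (hb _ _)
      (((hb x y).add (hb x y')).congr fun m => by rw [inner_add_right]))
    (fun c x y => tendsto_nhds_unique (hb _ _)
      (((hb x y).const_mul c).congr fun m => by rw [real_inner_smul_right])) with hβ
  set β' : D →L[ℝ] H →L[ℝ] ℝ := β.mkContinuous₂ C fun x y =>
    le_of_tendsto' (hb x y).abs fun m => hbd (l m) x y with hβ'
  set E : H ≃L[ℝ] (H →L[ℝ] ℝ) := (InnerProductSpace.toDual ℝ H).toContinuousLinearEquiv with hE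
  refine ⟨l, hl, (E.symm : (H →L[ℝ] ℝ) →L[ℝ] H).comp β', fun x y => ?_⟩
  have h1 : ⟪E.symm (β' x), y⟫_ℝ = b x y := InnerProductSpace.toDual_symm_apply
  change Tendsto _ _ (𝓝 ⟪E.symm (β' x), y⟫_ℝ)
  rw [h1]
  exact hb x y

end HilbertWeak

/-! ### Topology and measure on `M`, and the projection from `ℝᵈ` -/

noncomputable section

namespace BaseSpace

variable {d : ℕ}

instance instT2SpacePt : (S : BaseSpace) → T2Space (S.Pt d)
  | .euclidean => inferInstanceAs (T2Space (EuclideanSpace ℝ (Fin d)))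
  | .torus => inferInstanceAs (T2Space (UnitAddTorus (Fin d)))

instance instSecondCountableTopologyPt : (S : BaseSpace) → SecondCountableTopology (S.Pt d)
  | .euclidean => inferInstanceAs (SecondCountableTopology (EuclideanSpace ℝ (Fin d)))
  | .torus => inferInstanceAs (SecondCountableTopology (UnitAddTorus (Fin d)))

instance instLocallyCompactSpacePt : (S : BaseSpace) → LocallyCompactSpace (S.Pt d)
  | .euclidean => inferInstanceAs (LocallyCompactSpace (EuclideanSpace ℝ (Fin d)))
  | .torus => inferInstanceAs (LocallyCompactSpace (UnitAddTorus (Fin d)))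

instance instRegularPt : (S : BaseSpace) → (volume : Measure (S.Pt d)).Regular
  | .euclidean => inferInstanceAs (volume : Measure (EuclideanSpace ℝ (Fin d))).Regular
  | .torus => inferInstanceAs (volume : Measure (UnitAddTorus (Fin d))).Regular

lemma continuous_proj (S : BaseSpace) :
    Continuous (S.proj : EuclideanSpace ℝ (Fin d) → S.Pt d) :=
  S.isOpenQuotientMap_proj.continuous

lemma proj_zero (S : BaseSpace) : S.proj (0 : EuclideanSpace ℝ (Fin d)) = 0 := by
  have h := S.proj_add (0 : EuclideanSpace ℝ (Fin d)) 0
  simpa using h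

lemma proj_neg (S : BaseSpace) (x : EuclideanSpace ℝ (Fin d)) : S.proj (-x) = -S.proj x := by
  have h := S.proj_add x (-x)
  rw [add_neg_cancel, proj_zero] at h
  exact (neg_eq_of_add_eq_zero_right h.symm).symm

lemma proj_sub (S : BaseSpace) (x y : EuclideanSpace ℝ (Fin d)) :
    S.proj (x - y) = S.proj x - S.proj y := by
  rw [sub_eq_add_neg, proj_add, proj_neg, sub_eq_add_neg]

/-- The half-open unit cube with lower corner `a`. -/
def unitCube (a : EuclideanSpace ℝ (Fin d)) : Set (EuclideanSpace ℝ (Fin d)) :=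
  {z | ∀ i, z i ∈ Set.Ioc (a i) (a i + 1)}

lemma measurePreserving_proj_torus (a : EuclideanSpace ℝ (Fin d)) :
    MeasurePreserving (BaseSpace.torus.proj : EuclideanSpace ℝ (Fin d) → BaseSpace.torus.Pt d)
      (volume.restrict (unitCube a)) volume := by
  have h1 := measurePreserving_pi (fun i : Fin d => volume.restrict (Set.Ioc (a i) (a i + 1)))
    (fun _ : Fin d => (volume : Measure UnitAddCircle))
    (fun i => UnitAddCircle.measurePreserving_mk (a i))
  rw [← Measure.restrict_pi_pi] at h1
  have h2 := (PiLp.volume_preserving_ofLp (Fin d)).restrict_preimage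
    (s := Set.univ.pi fun i => Set.Ioc (a i) (a i + 1))
    (MeasurableSet.univ_pi fun i => measurableSet_Ioc)
  have h3 : WithLp.ofLp ⁻¹' (Set.univ.pi fun i => Set.Ioc (a i) (a i + 1)) = unitCube a := by
    ext z
    simp [unitCube]
  rw [h3] at h2
  exact h1.comp h2

/-- Over a compact set the projection covers `M` finitely many times. -/
lemma exists_map_proj_restrict_le (S : BaseSpace) {K : Set (EuclideanSpace ℝ (Fin d))}
    (hK : IsCompact K) :
    ∃ N : ℝ≥0, ((volume.restrict K).map S.proj : Measure (S.Pt d)) ≤ N • volume := by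
  cases S with
  | euclidean =>
    refine ⟨1, ?_⟩
    have h1 : (BaseSpace.euclidean.proj : EuclideanSpace ℝ (Fin d) → _) = id := rfl
    rw [one_smul]
    change Measure.map id (volume.restrict K) ≤ (volume : Measure (EuclideanSpace ℝ (Fin d)))
    rw [Measure.map_id]
    exact Measure.restrict_le_self
  | torus =>
    have hm : Measurable (BaseSpace.torus.proj : EuclideanSpace ℝ (Fin d) → _) :=
      (continuous_proj _).measurable
    -- The property passes to subsets and finite unions, so only small neighbourhoods of points have
    -- to be checked.
    refine hK.induction_on (p := fun K => ∃ N : ℝ≥0,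
      ((volume.restrict K).map BaseSpace.torus.proj : Measure (BaseSpace.torus.Pt d))
        ≤ N • volume) ?_ ?_ ?_ ?_
    · exact ⟨0, by simp⟩
    · rintro s t hst ⟨N, hN⟩
      exact ⟨N, (Measure.map_mono (Measure.restrict_mono hst le_rfl) hm).trans hN⟩
    · rintro s t ⟨N, hN⟩ ⟨N', hN'⟩
      refine ⟨N + N', (Measure.map_mono (Measure.restrict_union_le s t) hm).trans ?_⟩
      rw [Measure.map_add _ _ hm, add_smul]
      exact add_le_add hN hN'
    · intro x _
      -- Centring the half-open cube at `x` makes it a neighbourhood of `x` and still a fundamental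
      -- domain.
      set a : EuclideanSpace ℝ (Fin d) := WithLp.toLp 2 fun i => x i - 1 / 2 with ha
      refine ⟨unitCube a, mem_nhdsWithin_of_mem_nhds ?_, 1, ?_⟩
      · have h1 : ∀ i, ∀ᶠ z : EuclideanSpace ℝ (Fin d) in 𝓝 x,
            z i ∈ Set.Ioc (a i) (a i + 1) := by
          intro i
          have h2 : Continuous fun z : EuclideanSpace ℝ (Fin d) => z i := by fun_prop
          refine h2.continuousAt.eventually (Ioc_mem_nhds ?_ ?_)
          · simp only [ha]; linarith
          · simp only [ha]; linarith
        exact eventually_all.2 h1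
      · rw [(measurePreserving_proj_torus a).map_eq, one_smul]

/-- On each ball the pushforward of Lebesgue measure is dominated by a multiple of the volume of
`M`, and countably many balls exhaust `ℝᵈ`. -/
lemma quasiMeasurePreserving_proj (S : BaseSpace) :
    Measure.QuasiMeasurePreserving (S.proj : EuclideanSpace ℝ (Fin d) → S.Pt d) volume volume := by
  refine ⟨S.continuous_proj.measurable, ?_⟩
  refine Measure.AbsolutelyContinuous.mk fun s hs h0 => ?_
  rw [Measure.map_apply S.continuous_proj.measurable hs]
  have h1 : S.proj ⁻¹' s = ⋃ n : ℕ, S.proj ⁻¹' s ∩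
      Metric.closedBall (0 : EuclideanSpace ℝ (Fin d)) n := by
    rw [← Set.inter_iUnion, Metric.iUnion_closedBall_nat, Set.inter_univ]
  rw [h1]
  refine measure_iUnion_null fun n => ?_
  obtain ⟨N, hN⟩ := S.exists_map_proj_restrict_le
    (isCompact_closedBall (0 : EuclideanSpace ℝ (Fin d)) n)
  have h2 := hN s
  rw [Measure.map_apply S.continuous_proj.measurable hs,
    Measure.restrict_apply (S.continuous_proj.measurable hs), Measure.smul_apply, h0] at h2
  simpa using h2

lemma quasiMeasurePreserving_sub_proj (S : BaseSpace) (x : S.Pt d) :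
    Measure.QuasiMeasurePreserving (fun z : EuclideanSpace ℝ (Fin d) => x - S.proj z)
      volume volume :=
  (Measure.measurePreserving_sub_left volume x).quasiMeasurePreserving.comp S.quasiMeasurePreserving_proj

end BaseSpace

/-! ### Convolution of functions on `M` with kernels on `ℝᵈ` -/

variable {d : ℕ} {S : BaseSpace}

/-- The finite multiplicity of the projection over `K` bounds the `Lᵖ` norm on `K`, and Hölder on
the finite measure space `K` gives `L¹`. Reflection and translation preserve the volume of `M`, so
the constant does not depend on `x`; this is what makes mollified coefficients bounded functions. -/
lemma exists_eLpNorm_one_translate_le (S : BaseSpace) {K : Set (EuclideanSpace ℝ (Fin d))}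
    (hK : IsCompact K) {p : ℝ≥0∞} (hp : 1 ≤ p) :
    ∃ C : ℝ≥0∞, C ≠ ⊤ ∧ ∀ (f : S.Pt d → ℝ), AEStronglyMeasurable f volume → ∀ x,
      eLpNorm (fun z => f (x - S.proj z)) 1 (volume.restrict K) ≤ C * eLpNorm f p volume := by
  obtain ⟨N, hN⟩ := S.exists_map_proj_restrict_le hK
  have : IsFiniteMeasure (volume.restrict K) :=
    ⟨by rw [Measure.restrict_apply_univ]; exact hK.measure_lt_top⟩
  have hfin : (volume.restrict K : Measure (EuclideanSpace ℝ (Fin d))) Set.univ ≠ ⊤ :=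
    measure_ne_top _ _
  have he : 0 ≤ 1 / (1 : ℝ≥0∞).toReal - 1 / p.toReal := by
    rcases eq_or_ne p ⊤ with rfl | hp'
    · simp
    · have h1 : 1 ≤ p.toReal := by simpa using ENNReal.toReal_mono hp' hp
      rw [ENNReal.toReal_one, div_one, sub_nonneg, div_le_one (by linarith)]
      exact h1
  refine ⟨(N : ℝ≥0∞) ^ (1 / p).toReal * (volume.restrict K :
    Measure (EuclideanSpace ℝ (Fin d))) Set.univ ^ (1 / (1 : ℝ≥0∞).toReal - 1 / p.toReal),
    ENNReal.mul_ne_top (ENNReal.rpow_ne_top_of_nonneg (by positivity) ENNReal.coe_ne_top)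
      (ENNReal.rpow_ne_top_of_nonneg he hfin), fun f hf x => ?_⟩
  have hfx : AEStronglyMeasurable (fun y => f (x - y)) volume :=
    hf.comp_measurePreserving (Measure.measurePreserving_sub_left volume x)
  have hmeas : AEStronglyMeasurable (fun z => f (x - S.proj z))
      (volume.restrict K : Measure (EuclideanSpace ℝ (Fin d))) :=
    (hf.comp_quasiMeasurePreserving (S.quasiMeasurePreserving_sub_proj x)).restrict
  have hac : ((volume.restrict K).map S.proj : Measure (S.Pt d)) ≪ volume :=
    (Measure.absolutelyContinuous_of_le hN).trans Measure.smul_absolutelyContinuous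
  have h1 : eLpNorm (fun z => f (x - S.proj z)) p (volume.restrict K)
      ≤ (N : ℝ≥0∞) ^ (1 / p).toReal * eLpNorm f p volume := by
    have h2 : eLpNorm (fun z => f (x - S.proj z)) p (volume.restrict K)
        = eLpNorm (fun y => f (x - y)) p ((volume.restrict K).map S.proj) :=
      (eLpNorm_map_measure (hfx.mono_ac hac) S.continuous_proj.measurable.aemeasurable).symm
    rw [h2]
    refine (eLpNorm_mono_measure _ hN).trans ?_
    have h3 : eLpNorm (fun y => f (x - y)) p volume = eLpNorm f p volume :=
      eLpNorm_comp_measurePreserving hf (Measure.measurePreserving_sub_left volume x)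
    rw [← h3]
    rcases eq_or_ne N 0 with h0 | h0
    · simp [h0]
    · have h4 := eLpNorm_smul_measure_of_ne_zero (c := (N : ℝ≥0∞)) (by simpa using h0)
        (fun y => f (x - y)) p (volume : Measure (S.Pt d))
      rw [smul_eq_mul] at h4
      exact h4.le
  refine (eLpNorm_le_eLpNorm_mul_rpow_measure_univ hp hmeas).trans ?_
  calc _ ≤ ((N : ℝ≥0∞) ^ (1 / p).toReal * eLpNorm f p volume) * _ := by gcongr
    _ = _ := by ring

lemma MeasureTheory.MemLp.integrableOn_translate {p : ℝ≥0∞} {f : S.Pt d → ℝ}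
    (hf : MemLp f p volume) (hp : 1 ≤ p) {K : Set (EuclideanSpace ℝ (Fin d))}
    (hK : IsCompact K) (x : S.Pt d) : IntegrableOn (fun z => f (x - S.proj z)) K := by
  obtain ⟨C, hC, h⟩ := exists_eLpNorm_one_translate_le S hK hp
  rw [IntegrableOn, ← memLp_one_iff_integrable]
  exact ⟨(hf.1.comp_quasiMeasurePreserving (S.quasiMeasurePreserving_sub_proj x)).restrict,
    (h f hf.1 x).trans_lt (ENNReal.mul_lt_top hC.lt_top hf.2)⟩

lemma MeasureTheory.MemLp.locallyIntegrable_comp_proj {p : ℝ≥0∞} {f : S.Pt d → ℝ}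
    (hf : MemLp f p volume) (hp : 1 ≤ p) : LocallyIntegrable (f ∘ S.proj) volume := by
  rw [locallyIntegrable_iff]
  intro K hK
  have h1 : MemLp (fun y => f (-y)) p volume :=
    hf.comp_measurePreserving (Measure.measurePreserving_neg volume)
  have h2 := h1.integrableOn_translate hp hK 0
  simpa [Function.comp_def] using h2

/-- The convolution over `ℝᵈ` of a function on `M` with a kernel `κ`. -/
def kernelConv (κ : EuclideanSpace ℝ (Fin d) → ℝ) (f : S.Pt d → ℝ) (x : S.Pt d) : ℝ :=
  ∫ z, κ z * f (x - S.proj z)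

lemma integrable_kernel_mul {κ : EuclideanSpace ℝ (Fin d) → ℝ} (hκ : Continuous κ)
    (hκs : HasCompactSupport κ) {p : ℝ≥0∞} (hp : 1 ≤ p) {f : S.Pt d → ℝ}
    (hf : MemLp f p volume) (x : S.Pt d) : Integrable fun z => κ z * f (x - S.proj z) := by
  have h1 : IntegrableOn (fun z => κ z * f (x - S.proj z)) (tsupport κ) :=
    (hf.integrableOn_translate hp hκs x).continuousOn_mul hκ.continuousOn hκs
  refine (integrableOn_iff_integrable_of_support_subset fun z hz => ?_).1 h1
  exact subset_tsupport κ (left_ne_zero_of_mul hz)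

lemma exists_abs_kernelConv_le {κ : EuclideanSpace ℝ (Fin d) → ℝ} (hκ : Continuous κ)
    (hκs : HasCompactSupport κ) {p : ℝ≥0∞} (hp : 1 ≤ p) {f : S.Pt d → ℝ}
    (hf : MemLp f p volume) : ∃ C, ∀ x, |kernelConv κ f x| ≤ C := by
  obtain ⟨M, hM⟩ := hκs.exists_bound_of_continuous hκ
  have hM0 : 0 ≤ M := (norm_nonneg _).trans (hM 0)
  obtain ⟨C, hC, h⟩ := exists_eLpNorm_one_translate_le S hκs hp
  refine ⟨M * (C * eLpNorm f p volume).toReal, fun x => ?_⟩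
  have hI := hf.integrableOn_translate hp hκs x
  have h1 : kernelConv κ f x = ∫ z in tsupport κ, κ z * f (x - S.proj z) := by
    refine (setIntegral_eq_integral_of_forall_compl_eq_zero fun z hz => ?_).symm
    rw [image_eq_zero_of_notMem_tsupport hz, zero_mul]
  rw [h1, ← Real.norm_eq_abs]
  refine (norm_integral_le_of_norm_le (hI.norm.const_mul M)
    (Eventually.of_forall fun z => ?_)).trans ?_
  · rw [norm_mul]
    exact mul_le_mul_of_nonneg_right (hM z) (norm_nonneg _)
  · rw [integral_const_mul]
    refine mul_le_mul_of_nonneg_left ?_ hM0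
    rw [integral_norm_eq_lintegral_enorm hI.1, ← eLpNorm_one_eq_lintegral_enorm]
    exact ENNReal.toReal_mono (ENNReal.mul_ne_top hC hf.2.ne) (h f hf.1 x)

/-- The map `z ↦ x - S.proj z` pulls null sets back to null sets for every `x`, so equality holds at
every point. Almost everywhere identities such as the antisymmetry of `A` thus become pointwise
after mollification. -/
lemma kernelConv_congr_ae (κ : EuclideanSpace ℝ (Fin d) → ℝ) {f g : S.Pt d → ℝ}
    (h : f =ᵐ[volume] g) : kernelConv κ f = kernelConv κ g := by
  funext x
  refine integral_congr_ae ?_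
  filter_upwards [(S.quasiMeasurePreserving_sub_proj x).ae h] with z hz
  rw [hz]

lemma kernelConv_neg (κ : EuclideanSpace ℝ (Fin d) → ℝ) (f : S.Pt d → ℝ) (x : S.Pt d) :
    kernelConv κ (fun y => -f y) x = -kernelConv κ f x := by
  simp only [kernelConv, mul_neg, integral_neg]

lemma kernelConv_add {κ : EuclideanSpace ℝ (Fin d) → ℝ} (hκ : Continuous κ)
    (hκs : HasCompactSupport κ) {p q : ℝ≥0∞} (hp : 1 ≤ p) (hq : 1 ≤ q) {f g : S.Pt d → ℝ}
    (hf : MemLp f p volume) (hg : MemLp g q volume) (x : S.Pt d) :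
    kernelConv κ (fun y => f y + g y) x = kernelConv κ f x + kernelConv κ g x := by
  simp only [kernelConv, mul_add]
  exact integral_add (integrable_kernel_mul hκ hκs hp hf x) (integrable_kernel_mul hκ hκs hq hg x)

/-- Lifted to `ℝᵈ`, this is an ordinary convolution, so smoothness and differentiation of the kernel
can be taken from the Euclidean theory. -/
lemma kernelConv_comp_proj (κ : EuclideanSpace ℝ (Fin d) → ℝ) (f : S.Pt d → ℝ) :
    kernelConv κ f ∘ S.proj
      = convolution κ (f ∘ S.proj) (ContinuousLinearMap.mul ℝ ℝ) volume := by
  funext y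
  simp [kernelConv, convolution, BaseSpace.proj_sub]

lemma contDiff_kernelConv_comp_proj {κ : EuclideanSpace ℝ (Fin d) → ℝ} (hκ : ContDiff ℝ ∞ κ)
    (hκs : HasCompactSupport κ) {p : ℝ≥0∞} (hp : 1 ≤ p) {f : S.Pt d → ℝ}
    (hf : MemLp f p volume) : ContDiff ℝ ∞ (kernelConv κ f ∘ S.proj) := by
  rw [kernelConv_comp_proj]
  exact hκs.contDiff_convolution_left _ hκ (hf.locallyIntegrable_comp_proj hp)

lemma continuous_of_continuous_comp_proj {f : S.Pt d → ℝ} (h : Continuous (f ∘ S.proj)) :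
    Continuous f :=
  S.isOpenQuotientMap_proj.isQuotientMap.continuous_iff.2 h

lemma continuous_kernelConv {κ : EuclideanSpace ℝ (Fin d) → ℝ} (hκ : ContDiff ℝ ∞ κ)
    (hκs : HasCompactSupport κ) {p : ℝ≥0∞} (hp : 1 ≤ p) {f : S.Pt d → ℝ}
    (hf : MemLp f p volume) : Continuous (kernelConv κ f) :=
  continuous_of_continuous_comp_proj (contDiff_kernelConv_comp_proj hκ hκs hp hf).continuous

/-- The classical partial derivatives of a smooth function on `M`, along lines. -/
lemma hasDerivAt_line {φ : S.Pt d → ℝ} (h : ContDiff ℝ ∞ (φ ∘ S.proj)) (i : Fin d)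
    (x : S.Pt d) : HasDerivAt (fun t : ℝ => φ (x + S.proj (EuclideanSpace.single i t)))
      (partialDeriv i φ x) 0 := by
  obtain ⟨y, rfl⟩ := S.isOpenQuotientMap_proj.surjective x
  have h1 : (fun t : ℝ => φ (S.proj y + S.proj (EuclideanSpace.single i t)))
      = fun t : ℝ => (φ ∘ S.proj) (y + t • EuclideanSpace.single i (1 : ℝ)) := by
    funext t
    have h2 : t • EuclideanSpace.single i (1 : ℝ) = EuclideanSpace.single i t := by
      ext j
      simp
    rw [h2, Function.comp_apply, BaseSpace.proj_add]
  have h2 : DifferentiableAt ℝ (fun t : ℝ => φ (S.proj y + S.proj (EuclideanSpace.single i t)))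
      0 := by
    rw [h1]
    have h3 : Differentiable ℝ (φ ∘ S.proj) := h.differentiable (by simp)
    exact (h3.comp (by fun_prop : Differentiable ℝ
      fun t : ℝ => y + t • EuclideanSpace.single i (1 : ℝ))).differentiableAt
  exact h2.hasDerivAt

lemma partialDeriv_proj_of_contDiff {φ : S.Pt d → ℝ} (h : ContDiff ℝ ∞ (φ ∘ S.proj)) (i : Fin d)
    (y : EuclideanSpace ℝ (Fin d)) :
    partialDeriv i φ (S.proj y)
      = fderiv ℝ (φ ∘ S.proj) y (EuclideanSpace.single i 1) := by
  have hd : DifferentiableAt ℝ (φ ∘ S.proj) y :=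
    (h.differentiable (by simp)).differentiableAt
  rw [← hd.lineDeriv_eq_fderiv]
  unfold partialDeriv lineDeriv
  congr 1
  funext t
  have h1 : EuclideanSpace.single i t = t • EuclideanSpace.single i (1 : ℝ) := by
    ext j
    simp
  simp [← BaseSpace.proj_add, h1]

lemma contDiff_partialDeriv {φ : S.Pt d → ℝ} (h : ContDiff ℝ ∞ (φ ∘ S.proj)) (i : Fin d) :
    ContDiff ℝ ∞ (partialDeriv i φ ∘ S.proj) := by
  have h1 : partialDeriv i φ ∘ S.proj
      = fun y => fderiv ℝ (φ ∘ S.proj) y (EuclideanSpace.single i 1) :=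
    funext fun y => partialDeriv_proj_of_contDiff h i y
  rw [h1]
  exact (h.fderiv_right (m := ∞) (by simp)).clm_apply contDiff_const

lemma partialDeriv_mul {φ ψ : S.Pt d → ℝ} (hφ : ContDiff ℝ ∞ (φ ∘ S.proj))
    (hψ : ContDiff ℝ ∞ (ψ ∘ S.proj)) (i : Fin d) (x : S.Pt d) :
    partialDeriv i (fun y => φ y * ψ y) x
      = partialDeriv i φ x * ψ x + φ x * partialDeriv i ψ x := by
  have h := ((hasDerivAt_line hφ i x).mul (hasDerivAt_line hψ i x)).deriv
  have h0 : S.proj (EuclideanSpace.single i (0 : ℝ)) = 0 := by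
    have h1 : EuclideanSpace.single i (0 : ℝ) = 0 := by ext j; simp
    rw [h1, BaseSpace.proj_zero]
  rw [h0, add_zero] at h
  exact h

lemma partialDeriv_neg (φ : S.Pt d → ℝ) (i : Fin d) (x : S.Pt d) :
    partialDeriv i (fun y => -φ y) x = -partialDeriv i φ x :=
  deriv.fun_neg

lemma partialDeriv_kernelConv {κ : EuclideanSpace ℝ (Fin d) → ℝ} (hκ : ContDiff ℝ ∞ κ)
    (hκs : HasCompactSupport κ) {p : ℝ≥0∞} (hp : 1 ≤ p) {f : S.Pt d → ℝ}
    (hf : MemLp f p volume) (i : Fin d) (x : S.Pt d) :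
    partialDeriv i (kernelConv κ f) x
      = kernelConv (fun z => fderiv ℝ κ z (EuclideanSpace.single i 1)) f x := by
  obtain ⟨y, rfl⟩ := S.isOpenQuotientMap_proj.surjective x
  have hloc := hf.locallyIntegrable_comp_proj hp
  rw [partialDeriv_proj_of_contDiff (contDiff_kernelConv_comp_proj hκ hκs hp hf),
    kernelConv_comp_proj,
    (hκs.hasFDerivAt_convolution_left _ (hκ.of_le (by simp)) hloc y).fderiv]
  have hcv : ConvolutionExistsAt (fderiv ℝ κ) (f ∘ S.proj) y
      ((ContinuousLinearMap.mul ℝ ℝ).precompL (EuclideanSpace ℝ (Fin d))) volume :=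
    (hκs.fderiv ℝ).convolutionExists_left _ (hκ.continuous_fderiv (by simp)) hloc y
  rw [convolution, ContinuousLinearMap.integral_apply hcv]
  simp [kernelConv, BaseSpace.proj_sub, ContinuousLinearMap.precompL_apply]

/-! ### Mollifiers: contraction on `Lˢ` and convergence in `L²` -/

lemma IsMollifier.scaled {ρ : EuclideanSpace ℝ (Fin d) → ℝ} (hρ : IsMollifier ρ) (n : ℕ+) :
    IsMollifier (scaledMollifier ρ n) where
  smooth := contDiff_const.mul (hρ.smooth.comp (contDiff_const_smul _))
  compactSupport := by
    have h0 : (n : ℝ) ≠ 0 := by exact_mod_cast n.ne_zero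
    exact (hρ.compactSupport.comp_smul h0).mul_left
  nonneg := fun x => mul_nonneg (by positivity) (hρ.nonneg _)
  integral_eq_one := by
    have h0 : (0 : ℝ) < n := by exact_mod_cast n.pos
    unfold scaledMollifier
    rw [integral_const_mul, Measure.integral_comp_smul, hρ.integral_eq_one,
      finrank_euclideanSpace_fin, abs_of_pos (by positivity), smul_eq_mul, mul_one,
      mul_inv_cancel₀ (by positivity)]

lemma IsMollifier.exists_radius {ρ : EuclideanSpace ℝ (Fin d) → ℝ} (hρ : IsMollifier ρ) :
    ∃ R : ℝ, 0 < R ∧ ∀ (n : ℕ+) z, scaledMollifier ρ n z ≠ 0 → ‖z‖ ≤ R / n := by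
  obtain ⟨R, hR0, hR⟩ := hρ.compactSupport.isBounded.exists_pos_norm_le
  refine ⟨R, hR0, fun n z hz => ?_⟩
  have h0 : (0 : ℝ) < n := by exact_mod_cast n.pos
  have h1 := hR _ (subset_tsupport ρ (right_ne_zero_of_mul hz))
  rw [norm_smul, Real.norm_of_nonneg h0.le] at h1
  rw [le_div_iff₀ h0]
  linarith

lemma IsMollifier.measurable_ofReal {ρ : EuclideanSpace ℝ (Fin d) → ℝ} (hρ : IsMollifier ρ) :
    Measurable fun z => ENNReal.ofReal (ρ z) :=
  hρ.smooth.continuous.measurable.ennreal_ofReal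

lemma IsMollifier.lintegral_eq_one {ρ : EuclideanSpace ℝ (Fin d) → ℝ} (hρ : IsMollifier ρ) :
    ∫⁻ z, ENNReal.ofReal (ρ z) = 1 := by
  rw [← ofReal_integral_eq_lintegral_ofReal
    (hρ.smooth.continuous.integrable_of_hasCompactSupport hρ.compactSupport)
    (Eventually.of_forall hρ.nonneg), hρ.integral_eq_one, ENNReal.ofReal_one]

/-- Jensen's inequality for the probability density `ρ`. -/
lemma IsMollifier.enorm_integral_mul_rpow_le {ρ : EuclideanSpace ℝ (Fin d) → ℝ}
    (hρ : IsMollifier ρ) {h : EuclideanSpace ℝ (Fin d) → ℝ} (hh : AEStronglyMeasurable h volume)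
    {s : ℝ} (hs : 1 ≤ s) :
    ‖∫ z, ρ z * h z‖ₑ ^ s ≤ ∫⁻ z, ENNReal.ofReal (ρ z) * ‖h z‖ₑ ^ s := by
  -- For the probability measure with density `ρ`, the claim is the comparison of the `L¹` and `Lˢ`
  -- norms of `h`.
  set μ : Measure (EuclideanSpace ℝ (Fin d)) :=
    volume.withDensity fun z => ENNReal.ofReal (ρ z) with hμ
  have hprob : IsProbabilityMeasure μ :=
    ⟨by rw [hμ, withDensity_apply _ MeasurableSet.univ, Measure.restrict_univ,
      hρ.lintegral_eq_one]⟩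
  have hac : μ ≪ volume := withDensity_absolutelyContinuous _ _
  have hint : ∀ r : ℝ, ∫⁻ z, ‖h z‖ₑ ^ r ∂μ = ∫⁻ z, ENNReal.ofReal (ρ z) * ‖h z‖ₑ ^ r := by
    intro r
    rw [hμ, lintegral_withDensity_eq_lintegral_mul₀ hρ.measurable_ofReal.aemeasurable
      (hh.enorm.pow_const r)]
    rfl
  have hs0 : 0 < s := one_pos.trans_le hs
  have h1 : ‖∫ z, ρ z * h z‖ₑ ≤ eLpNorm h 1 μ := by
    rw [eLpNorm_one_eq_lintegral_enorm]
    have h2 := hint 1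
    simp only [ENNReal.rpow_one] at h2
    rw [h2]
    refine (enorm_integral_le_lintegral_enorm _).trans (lintegral_mono fun z => ?_)
    rw [enorm_mul, Real.enorm_of_nonneg (hρ.nonneg z)]
  have h2 : eLpNorm h 1 μ ≤ eLpNorm h (ENNReal.ofReal s) μ :=
    eLpNorm_le_eLpNorm_of_exponent_le (by simpa using hs) (hh.mono_ac hac)
  have h3 : eLpNorm h (ENNReal.ofReal s) μ ^ s = ∫⁻ z, ‖h z‖ₑ ^ s ∂μ := by
    rw [eLpNorm_eq_lintegral_rpow_enorm_toReal (by simpa using hs0) ENNReal.ofReal_ne_top,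
      ENNReal.toReal_ofReal hs0.le, ← ENNReal.rpow_mul, one_div, inv_mul_cancel₀ hs0.ne',
      ENNReal.rpow_one]
  rw [← hint, ← h3]
  exact ENNReal.rpow_le_rpow (h1.trans h2) hs0.le

lemma stronglyMeasurable_sub_proj {f : S.Pt d → ℝ} (hf : StronglyMeasurable f) :
    StronglyMeasurable fun q : S.Pt d × EuclideanSpace ℝ (Fin d) => f (q.1 - S.proj q.2) :=
  hf.comp_measurable
    (measurable_fst.sub (S.continuous_proj.measurable.comp measurable_snd))

/-- Mollification is a contraction on `Lˢ(M)`. -/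
lemma IsMollifier.eLpNorm_kernelConv_le {ρ : EuclideanSpace ℝ (Fin d) → ℝ} (hρ : IsMollifier ρ)
    {s : ℝ≥0∞} (hs : 1 ≤ s) (hs' : s ≠ ⊤) {f : S.Pt d → ℝ} (hf : AEStronglyMeasurable f volume) :
    eLpNorm (kernelConv ρ f) s volume ≤ eLpNorm f s volume := by
  -- A strongly measurable representative makes `(x, z) ↦ g (x - S.proj z)` jointly measurable, as
  -- Tonelli requires; then Jensen in `z` and translation invariance in `x` give the bound.
  rw [kernelConv_congr_ae ρ hf.ae_eq_mk, eLpNorm_congr_ae hf.ae_eq_mk]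
  set g := hf.mk f
  have hg : StronglyMeasurable g := hf.stronglyMeasurable_mk
  have hs0 : s ≠ 0 := (one_pos.trans_le hs).ne'
  have hs1 : 1 ≤ s.toReal := by simpa using ENNReal.toReal_mono hs' hs
  have hsp : 0 < s.toReal := one_pos.trans_le hs1
  rw [eLpNorm_eq_lintegral_rpow_enorm_toReal hs0 hs', eLpNorm_eq_lintegral_rpow_enorm_toReal hs0 hs']
  refine ENNReal.rpow_le_rpow ?_ (by positivity)
  calc ∫⁻ x, ‖kernelConv ρ g x‖ₑ ^ s.toReal
      ≤ ∫⁻ x, ∫⁻ z, ENNReal.ofReal (ρ z) * ‖g (x - S.proj z)‖ₑ ^ s.toReal := by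
        refine lintegral_mono fun x => hρ.enorm_integral_mul_rpow_le ?_ hs1
        exact hg.aestronglyMeasurable.comp_quasiMeasurePreserving
          (S.quasiMeasurePreserving_sub_proj x)
    _ = ∫⁻ z, ∫⁻ x, ENNReal.ofReal (ρ z) * ‖g (x - S.proj z)‖ₑ ^ s.toReal := by
        refine lintegral_lintegral_swap (Measurable.aemeasurable ?_)
        exact (hρ.measurable_ofReal.comp measurable_snd).mul
          ((stronglyMeasurable_sub_proj hg).enorm.pow_const _)
    _ = ∫⁻ z, ENNReal.ofReal (ρ z) * ∫⁻ x, ‖g x‖ₑ ^ s.toReal := by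
        refine lintegral_congr fun z => ?_
        rw [lintegral_const_mul' _ _ ENNReal.ofReal_ne_top,
          lintegral_sub_right_eq_self (fun x => ‖g x‖ₑ ^ s.toReal) (S.proj z)]
    _ = ∫⁻ x, ‖g x‖ₑ ^ s.toReal := by
        rw [lintegral_mul_const _ hρ.measurable_ofReal, hρ.lintegral_eq_one, one_mul]

lemma IsMollifier.memLp_kernelConv {ρ : EuclideanSpace ℝ (Fin d) → ℝ} (hρ : IsMollifier ρ)
    {s : ℝ≥0∞} (hs : 1 ≤ s) (hs' : s ≠ ⊤) {f : S.Pt d → ℝ} (hf : MemLp f s volume) :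
    MemLp (kernelConv ρ f) s volume :=
  ⟨(continuous_kernelConv hρ.smooth hρ.compactSupport hs hf).aestronglyMeasurable,
    (hρ.eLpNorm_kernelConv_le hs hs' hf.1).trans_lt hf.2⟩

/-- Translations act continuously on `L²(M)`. -/
lemma tendsto_eLpNorm_translate_sub {f : S.Pt d → ℝ} (hf : MemLp f 2 volume) :
    Tendsto (fun a : S.Pt d => eLpNorm (fun x => f (x - a) - f x) 2 volume) (𝓝 0) (𝓝 0) := by
  have : Fact ((2 : ℝ≥0∞) ≠ ⊤) := ⟨by simp⟩
  have h1 : Continuous fun a : S.Pt d => DomAddAct.mk (-a) +ᵥ hf.toLp f :=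
    (DomAddAct.continuous_mk.comp continuous_neg).vadd continuous_const
  have h2 : Tendsto (fun a : S.Pt d => edist (DomAddAct.mk (-a) +ᵥ hf.toLp f) (hf.toLp f)) (𝓝 0)
      (𝓝 0) := by
    have h3 := (h1.edist continuous_const : Continuous
      fun a : S.Pt d => edist (DomAddAct.mk (-a) +ᵥ hf.toLp f) (hf.toLp f)).tendsto 0
    have h4 : DomAddAct.mk (-(0 : S.Pt d)) +ᵥ hf.toLp f = hf.toLp f := by
      rw [neg_zero, DomAddAct.mk_zero, zero_vadd]
    simp only [h4, edist_self] at h3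
    exact h3
  refine h2.congr fun a => ?_
  rw [DomAddAct.mk_vadd_toLp, Lp.edist_toLp_toLp]
  congr 1
  funext x
  simp [sub_eq_neg_add]

/-- Mollifications converge in `L²(M)`. -/
lemma IsMollifier.tendsto_eLpNorm_kernelConv_sub {ρ : EuclideanSpace ℝ (Fin d) → ℝ}
    (hρ : IsMollifier ρ) {f : S.Pt d → ℝ} (hf : MemLp f 2 volume) :
    Tendsto (fun n : ℕ+ => eLpNorm (fun x => kernelConv (scaledMollifier ρ n) f x - f x) 2 volume)
      atTop (𝓝 0) := by
  have hae := hf.1.ae_eq_mk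
  have hcongr : ∀ n : ℕ+, eLpNorm (fun x => kernelConv (scaledMollifier ρ n) f x - f x) 2 volume
      = eLpNorm (fun x => kernelConv (scaledMollifier ρ n) (hf.1.mk f) x - hf.1.mk f x) 2
        volume := by
    intro n
    rw [kernelConv_congr_ae _ hae]
    refine eLpNorm_congr_ae ?_
    filter_upwards [hae] with x hx
    rw [hx]
  simp_rw [hcongr]
  have hg2 : MemLp (hf.1.mk f) 2 volume := hf.ae_eq hae
  set g := hf.1.mk f
  have hg : StronglyMeasurable g := hf.1.stronglyMeasurable_mk
  obtain ⟨R, hR, hsupp⟩ := hρ.exists_radius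
  rw [ENNReal.tendsto_nhds_zero]
  intro ε hε
  have h1 := (S.continuous_proj (d := d)).tendsto 0
  rw [S.proj_zero] at h1
  have h2 := ENNReal.tendsto_nhds_zero.1 ((tendsto_eLpNorm_translate_sub hg2).comp h1) ε hε
  obtain ⟨δ, hδ, hball⟩ := Metric.eventually_nhds_iff.1 h2
  -- For `n ≥ N` the support of the rescaled mollifier lies in the `δ`-ball, where translations move
  -- `g` by at most `ε` in `L²`; averaging over `z` keeps the bound.
  obtain ⟨N, hN⟩ := exists_nat_gt (R / δ)
  have hN0 : 0 < N := by
    have : (0 : ℝ) < N := lt_trans (by positivity) hN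
    exact_mod_cast this
  filter_upwards [eventually_ge_atTop (⟨N, hN0⟩ : ℕ+)] with n hn
  have hn0 : (0 : ℝ) < n := by exact_mod_cast n.pos
  have hnN : (N : ℝ) ≤ n := by exact_mod_cast (show N ≤ (n : ℕ) from hn)
  have hRn : R / n < δ := by
    rw [div_lt_iff₀ hδ] at hN
    rw [div_lt_iff₀ hn0]
    nlinarith
  have hm := hρ.scaled n
  rw [← ENNReal.rpow_le_rpow_iff (z := 2) (by norm_num)]
  have hsq : ∀ h : S.Pt d → ℝ, eLpNorm h 2 volume ^ (2 : ℝ) = ∫⁻ x, ‖h x‖ₑ ^ (2 : ℝ) := by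
    intro h
    rw [eLpNorm_eq_lintegral_rpow_enorm_toReal (by simp) (by simp), ← ENNReal.rpow_mul]
    simp
  rw [hsq]
  calc ∫⁻ x, ‖kernelConv (scaledMollifier ρ n) g x - g x‖ₑ ^ (2 : ℝ)
      ≤ ∫⁻ x, ∫⁻ z, ENNReal.ofReal (scaledMollifier ρ n z)
          * ‖g (x - S.proj z) - g x‖ₑ ^ (2 : ℝ) := by
        refine lintegral_mono fun x => ?_
        have h3 : kernelConv (scaledMollifier ρ n) g x - g x
            = ∫ z, scaledMollifier ρ n z * (g (x - S.proj z) - g x) := by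
          simp only [mul_sub]
          rw [integral_sub (integrable_kernel_mul hm.smooth.continuous hm.compactSupport
            (by norm_num : (1 : ℝ≥0∞) ≤ 2) hg2 x)
            ((hm.smooth.continuous.integrable_of_hasCompactSupport hm.compactSupport).mul_const _),
            integral_mul_const, hm.integral_eq_one, one_mul]
          rfl
        rw [h3]
        refine hm.enorm_integral_mul_rpow_le ?_ (by norm_num)
        exact (hg.aestronglyMeasurable.comp_quasiMeasurePreserving
          (S.quasiMeasurePreserving_sub_proj x)).sub aestronglyMeasurable_const
    _ = ∫⁻ z, ∫⁻ x, ENNReal.ofReal (scaledMollifier ρ n z)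
          * ‖g (x - S.proj z) - g x‖ₑ ^ (2 : ℝ) := by
        refine lintegral_lintegral_swap (Measurable.aemeasurable ?_)
        exact (hm.measurable_ofReal.comp measurable_snd).mul
          (((stronglyMeasurable_sub_proj hg).sub
            (hg.comp_measurable measurable_fst)).enorm.pow_const _)
    _ ≤ ∫⁻ z, ENNReal.ofReal (scaledMollifier ρ n z) * ε ^ (2 : ℝ) := by
        refine lintegral_mono fun z => ?_
        rw [lintegral_const_mul' _ _ ENNReal.ofReal_ne_top]
        rcases eq_or_ne (scaledMollifier ρ n z) 0 with h0 | h0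
        · simp [h0]
        · refine mul_le_mul_right ?_ _
          rw [← hsq]
          refine ENNReal.rpow_le_rpow (hball ?_) (by norm_num)
          rw [dist_zero_right]
          exact (hsupp n z h0).trans_lt hRn
    _ = ε ^ (2 : ℝ) := by
        rw [lintegral_mul_const _ hm.measurable_ofReal, hm.lintegral_eq_one, one_mul]

/-! ### Pairings in `L²` -/

lemma integral_mul_eq_inner (u : LTwo S d) {ψ : S.Pt d → ℝ} (hψ : MemLp ψ 2 volume) :
    ∫ x, u x * ψ x = inner ℝ u (hψ.toLp ψ) := by
  rw [L2.inner_def]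
  refine integral_congr_ae ?_
  filter_upwards [hψ.coeFn_toLp] with x hx
  rw [hx, real_inner_eq_re_inner, RCLike.inner_apply]
  simp [mul_comm]

lemma integral_mul_eq_inner' (u v : LTwo S d) : ∫ x, u x * v x = inner ℝ u v := by
  have h := integral_mul_eq_inner u (Lp.memLp v)
  rwa [Lp.toLp_coeFn] at h

lemma MeasureTheory.MemLp.bdd_mul' {g f : S.Pt d → ℝ} (hf : MemLp f 2 volume)
    (hg : AEStronglyMeasurable g volume) {C : ℝ} (hC : ∀ x, |g x| ≤ C) :
    MemLp (fun x => g x * f x) 2 volume := by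
  refine hf.of_le_mul (c := C) (hg.mul hf.1) (Eventually.of_forall fun x => ?_)
  rw [norm_mul]
  exact mul_le_mul_of_nonneg_right (hC x) (norm_nonneg _)

/-! ### The Hilbert space `H¹` -/

namespace SobolevH1

lemma norm_sq_eq (U : SobolevH1 S d) :
    ‖U‖ ^ 2 = ‖H1ToLTwo S d U‖ ^ 2 + ∑ i, ‖U.partial i‖ ^ 2 := by
  have h1 : ‖U‖ ^ 2 = ‖U.1.fst‖ ^ 2 + ‖U.1.snd‖ ^ 2 := WithLp.prod_norm_sq_eq_of_L2 U.1
  rw [h1, PiLp.norm_sq_eq_of_L2]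
  rfl

lemma norm_H1ToLTwo_le (U : SobolevH1 S d) : ‖H1ToLTwo S d U‖ ≤ ‖U‖ := by
  refine le_of_sq_le_sq ?_ (norm_nonneg U)
  rw [norm_sq_eq]
  have : 0 ≤ ∑ i, ‖U.partial i‖ ^ 2 := Finset.sum_nonneg fun i _ => by positivity
  linarith

lemma norm_partial_le (U : SobolevH1 S d) (i : Fin d) : ‖U.partial i‖ ≤ ‖U‖ := by
  refine le_of_sq_le_sq ?_ (norm_nonneg U)
  rw [norm_sq_eq]
  have h1 := Finset.single_le_sum (f := fun i => ‖U.partial i‖ ^ 2)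
    (fun i _ => by positivity) (Finset.mem_univ i)
  have h2 : 0 ≤ ‖H1ToLTwo S d U‖ ^ 2 := by positivity
  linarith

/-- The weak partial derivative as a bounded operator. -/
def partialL (i : Fin d) : SobolevH1 S d →L[ℝ] LTwo S d :=
  LinearMap.mkContinuous
    { toFun := fun u => u.partial i
      map_add' := fun _ _ => rfl
      map_smul' := fun _ _ => rfl } 1 fun u => by
    rw [one_mul]
    exact norm_partial_le u i

@[simp] lemma partialL_apply (i : Fin d) (U : SobolevH1 S d) : partialL i U = U.partial i := rfl

lemma hasWeakPartial (U : SobolevH1 S d) (i : Fin d) :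
    HasWeakPartial i (H1ToLTwo S d U) (U.partial i) := U.2 i

lemma tendsto_of_components {ι : Type*} {l : Filter ι} {U : ι → SobolevH1 S d}
    {V : SobolevH1 S d} (h0 : Tendsto (fun n => H1ToLTwo S d (U n)) l (𝓝 (H1ToLTwo S d V)))
    (h1 : ∀ i, Tendsto (fun n => (U n).partial i) l (𝓝 (V.partial i))) :
    Tendsto U l (𝓝 V) := by
  rw [tendsto_iff_norm_sub_tendsto_zero] at h0 ⊢
  have h2 : ∀ i, Tendsto (fun n => ‖(U n).partial i - V.partial i‖) l (𝓝 0) := fun i =>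
    tendsto_iff_norm_sub_tendsto_zero.1 (h1 i)
  have h3 : Tendsto (fun n => ‖U n - V‖ ^ 2) l (𝓝 0) := by
    have h4 : ∀ n, ‖U n - V‖ ^ 2 = ‖H1ToLTwo S d (U n) - H1ToLTwo S d V‖ ^ 2
        + ∑ i, ‖(U n).partial i - V.partial i‖ ^ 2 := fun n => norm_sq_eq (U n - V)
    simp_rw [h4]
    have h5 := (h0.pow 2).add (tendsto_finsetSum Finset.univ fun i _ => (h2 i).pow 2)
    simpa using h5
  have h6 := h3.sqrt
  simpa [Real.sqrt_sq (norm_nonneg _)] using h6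

/-- The element of `H¹` given by a function and its weak gradient. -/
def mk (f : S.Pt d → ℝ) (g : Fin d → S.Pt d → ℝ) (hf : MemLp f 2 volume)
    (hg : ∀ i, MemLp (g i) 2 volume)
    (hw : ∀ i φ, IsTestFunction φ → ∫ x, f x * partialDeriv i φ x = -∫ x, g i x * φ x) :
    SobolevH1 S d :=
  ⟨WithLp.toLp 2 (hf.toLp f, WithLp.toLp 2 fun i => (hg i).toLp (g i)), by
    intro i φ hφ
    have h1 : ∫ x, hf.toLp f x * partialDeriv i φ x = ∫ x, f x * partialDeriv i φ x := by
      refine integral_congr_ae ?_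
      filter_upwards [hf.coeFn_toLp] with x hx
      rw [hx]
    have h2 : ∫ x, (hg i).toLp (g i) x * φ x = ∫ x, g i x * φ x := by
      refine integral_congr_ae ?_
      filter_upwards [(hg i).coeFn_toLp] with x hx
      rw [hx]
    change ∫ x, hf.toLp f x * partialDeriv i φ x = -∫ x, (hg i).toLp (g i) x * φ x
    rw [h1, h2, hw i φ hφ]⟩

end SobolevH1

/-- Each weak derivative identity is an equality of two continuous functionals, as test functions
and their derivatives are in `L²`. Completeness of `H¹` follows. -/
lemma isClosed_sobolevH1 : IsClosed (sobolevH1 S d : Set (WithLp 2 (LTwo S d ×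
    PiLp 2 (fun _ : Fin d => LTwo S d)))) := by
  have h1 : (sobolevH1 S d : Set (WithLp 2 (LTwo S d × PiLp 2 (fun _ : Fin d => LTwo S d))))
      = ⋂ (i : Fin d) (φ : S.Pt d → ℝ) (h : IsTestFunction φ),
        {U | (inner ℝ U.fst ((h.memLp_partialDeriv i).toLp _) : ℝ)
          = -inner ℝ (U.snd i) (h.memLp.toLp _)} := by
    ext U
    simp only [Set.mem_iInter, Set.mem_ofPred_eq, ← integral_mul_eq_inner]
    rfl
  rw [h1]
  refine isClosed_iInter fun i => isClosed_iInter fun φ => isClosed_iInter fun h => ?_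
  refine isClosed_eq ?_ ?_
  · exact ((WithLp.continuous_fst 2 _ _).inner continuous_const)
  · have h2 : Continuous fun U : WithLp 2 (LTwo S d × PiLp 2 (fun _ : Fin d => LTwo S d)) =>
        U.snd i :=
      (PiLp.continuous_apply 2 _ i).comp (WithLp.continuous_snd 2 _ _)
    exact (h2.inner continuous_const).neg

instance : CompleteSpace (SobolevH1 S d) :=
  (isClosed_sobolevH1 (S := S) (d := d)).completeSpace_coe

instance : TopologicalSpace.SeparableSpace (SobolevH1 S d) := by
  have : Fact ((2 : ℝ≥0∞) ≠ ⊤) := ⟨by simp⟩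
  have h1 : SecondCountableTopology (WithLp 2 (LTwo S d × PiLp 2 (fun _ : Fin d => LTwo S d))) :=
    inferInstance
  have h2 : SecondCountableTopology (sobolevH1 S d) := TopologicalSpace.Subtype.secondCountableTopology _
  have h3 : TopologicalSpace.SeparableSpace (sobolevH1 S d) := inferInstance
  exact h3

/-! ### Calculus of test functions -/

lemma partialDeriv_eq_zero_of_notMem_tsupport {φ : S.Pt d → ℝ} (i : Fin d) {x : S.Pt d}
    (hx : x ∉ tsupport φ) : partialDeriv i φ x = 0 := by
  have hcont : Continuous fun t : ℝ => x + S.proj (EuclideanSpace.single i t) := by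
    refine continuous_const.add (S.continuous_proj.comp ?_)
    have h1 : (fun t : ℝ => EuclideanSpace.single i t)
        = fun t : ℝ => t • EuclideanSpace.single i (1 : ℝ) := by
      funext t
      ext j
      simp
    change Continuous (fun t : ℝ => EuclideanSpace.single i t)
    exact h1 ▸ continuous_id.smul continuous_const
  have h0 : S.proj (EuclideanSpace.single i (0 : ℝ)) = 0 := by
    have h1 : EuclideanSpace.single i (0 : ℝ) = 0 := by ext j; simp
    rw [h1, BaseSpace.proj_zero]
  have hev : (fun t : ℝ => φ (x + S.proj (EuclideanSpace.single i t))) =ᶠ[𝓝 0] fun _ => 0 := by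
    have hmem : (tsupport φ)ᶜ ∈ 𝓝 (x + S.proj (EuclideanSpace.single i (0 : ℝ))) := by
      rw [h0, add_zero]
      exact (isClosed_tsupport φ).isOpen_compl.mem_nhds hx
    filter_upwards [hcont.continuousAt.preimage_mem_nhds hmem] with t ht
    exact image_eq_zero_of_notMem_tsupport ht
  unfold partialDeriv
  rw [hev.deriv_eq]
  simp

lemma partialDeriv_translate (φ : S.Pt d → ℝ) (z : EuclideanSpace ℝ (Fin d)) (i : Fin d)
    (x : S.Pt d) :
    partialDeriv i (fun x => φ (x + S.proj z)) x
      = partialDeriv i φ (x + S.proj z) := by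
  unfold partialDeriv
  simp only [add_right_comm]

namespace IsTestFunction

lemma continuous {φ : S.Pt d → ℝ} (h : IsTestFunction φ) : Continuous φ :=
  continuous_of_continuous_comp_proj h.smooth.continuous

lemma exists_bound {φ : S.Pt d → ℝ} (h : IsTestFunction φ) : ∃ C, ∀ x, |φ x| ≤ C :=
  h.compactSupport.exists_bound_of_continuous h.continuous

lemma pderiv {φ : S.Pt d → ℝ} (h : IsTestFunction φ) (i : Fin d) :
    IsTestFunction (partialDeriv i φ) where
  smooth := contDiff_partialDeriv h.smooth i
  compactSupport := h.compactSupport.mono' fun x hx => by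
    by_contra hx'
    exact hx (partialDeriv_eq_zero_of_notMem_tsupport i hx')

lemma smooth_mul {φ ψ : S.Pt d → ℝ} (hφ : ContDiff ℝ ∞ (φ ∘ S.proj)) (hψ : IsTestFunction ψ) :
    IsTestFunction fun x => φ x * ψ x where
  smooth := hφ.mul hψ.smooth
  compactSupport := hψ.compactSupport.mul_left

lemma translate {φ : S.Pt d → ℝ} (h : IsTestFunction φ) (z : EuclideanSpace ℝ (Fin d)) :
    IsTestFunction fun x => φ (x + S.proj z) where
  smooth := by
    have h1 : (fun x => φ (x + S.proj z)) ∘ S.proj = (φ ∘ S.proj) ∘ fun y => y + z := by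
      funext y
      simp [BaseSpace.proj_add]
    rw [h1]
    exact h.smooth.comp (contDiff_id.add contDiff_const)
  compactSupport := h.compactSupport.comp_homeomorph (Homeomorph.addRight (S.proj z))

end IsTestFunction

lemma single_add (i : Fin d) (s t : ℝ) :
    EuclideanSpace.single i (s + t) = EuclideanSpace.single i s + EuclideanSpace.single i t := by
  ext j
  by_cases h : j = i <;> simp [h]

/-- By translation invariance `t ↦ ∫ ψ(x + t eᵢ)` is constant; differentiating under the integral at
`t = 0` gives the claim. -/
lemma IsTestFunction.integral_partialDeriv_eq_zero {ψ : S.Pt d → ℝ} (h : IsTestFunction ψ)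
    (i : Fin d) : ∫ x, partialDeriv i ψ x = 0 := by
  obtain ⟨C, hC⟩ := (h.pderiv i).exists_bound
  -- The support of `ψ` enlarged by unit translations: outside `K` the integrand vanishes for all
  -- `|t| < 1`, so a constant on the compact set `K` dominates.
  set K : Set (S.Pt d) := (fun q : S.Pt d × EuclideanSpace ℝ (Fin d) => q.1 - S.proj q.2) ''
    (tsupport ψ ×ˢ Metric.closedBall 0 1) with hK
  have hKc : IsCompact K := (h.compactSupport.isCompact.prod (isCompact_closedBall _ _)).image
    (continuous_fst.sub (S.continuous_proj.comp continuous_snd))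
  have hcont : ∀ t : ℝ, Continuous fun x : S.Pt d => x + S.proj (EuclideanSpace.single i t) :=
    fun t => continuous_id.add continuous_const
  have hd : HasDerivAt (fun t : ℝ => ∫ x, ψ (x + S.proj (EuclideanSpace.single i t)))
      (∫ x, partialDeriv i ψ (x + S.proj (EuclideanSpace.single i (0 : ℝ)))) 0 := by
    refine (hasDerivAt_integral_of_dominated_loc_of_deriv_le
      (F' := fun t x => partialDeriv i ψ (x + S.proj (EuclideanSpace.single i t)))
      (bound := K.indicator fun _ => C) (s := Metric.ball 0 1)
      (Metric.ball_mem_nhds 0 one_pos) ?_ ?_ ?_ ?_ ?_ ?_).2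
    · exact Eventually.of_forall fun t => (h.continuous.comp (hcont t)).aestronglyMeasurable
    · exact ((h.translate _).continuous).integrable_of_hasCompactSupport (h.translate _).compactSupport
    · exact ((h.pderiv i).continuous.comp (hcont 0)).aestronglyMeasurable
    · refine Eventually.of_forall fun x t ht => ?_
      by_cases hx : x ∈ K
      · rw [Set.indicator_of_mem hx]
        exact hC _
      · rw [Set.indicator_of_notMem hx, partialDeriv_eq_zero_of_notMem_tsupport i, norm_zero]
        intro hmem
        refine hx ⟨(x + S.proj (EuclideanSpace.single i t), EuclideanSpace.single i t),
          ⟨hmem, ?_⟩, by simp⟩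
        rw [mem_closedBall_zero_iff, PiLp.norm_single]
        exact (mem_ball_zero_iff.1 ht).le
    · exact (integrable_indicator_iff hKc.measurableSet).2
        (integrableOn_const hKc.measure_lt_top.ne)
    · refine Eventually.of_forall fun x t _ => ?_
      have h1 := hasDerivAt_line h.smooth i (x + S.proj (EuclideanSpace.single i t))
      have h2 : HasDerivAt (fun s : ℝ => s - t) 1 t := (hasDerivAt_id t).sub_const t
      have h3 : HasDerivAt (fun r : ℝ => ψ (x + S.proj (EuclideanSpace.single i t)
          + S.proj (EuclideanSpace.single i r)))
          (partialDeriv i ψ (x + S.proj (EuclideanSpace.single i t))) (t - t) := by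
        rw [sub_self]
        exact h1
      have h4 := HasDerivAt.comp (h := fun s : ℝ => s - t) t h3 h2
      rw [mul_one] at h4
      refine h4.congr_of_eventuallyEq (Eventually.of_forall fun s => ?_)
      simp only [Function.comp_apply]
      rw [add_assoc, ← BaseSpace.proj_add, ← single_add, add_sub_cancel]
  have hconst : (fun t : ℝ => ∫ x, ψ (x + S.proj (EuclideanSpace.single i t)))
      = fun _ => ∫ x, ψ x := by
    funext t
    exact integral_add_right_eq_self ψ _
  rw [hconst] at hd
  have h1 := hd.unique (hasDerivAt_const _ _)
  rwa [integral_add_right_eq_self (partialDeriv i ψ)] at h1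

/-- Integration by parts on `M`. -/
lemma IsTestFunction.integral_mul_partialDeriv {φ ψ : S.Pt d → ℝ}
    (hφ : ContDiff ℝ ∞ (φ ∘ S.proj)) (hψ : IsTestFunction ψ) (i : Fin d) :
    ∫ x, φ x * partialDeriv i ψ x = -∫ x, partialDeriv i φ x * ψ x := by
  have h1 := (IsTestFunction.smooth_mul hφ hψ).integral_partialDeriv_eq_zero i
  simp only [partialDeriv_mul hφ hψ.smooth] at h1
  have hA := IsTestFunction.smooth_mul (contDiff_partialDeriv hφ i) hψ
  have hB := IsTestFunction.smooth_mul hφ (hψ.pderiv i)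
  rw [integral_add (hA.continuous.integrable_of_hasCompactSupport hA.compactSupport)
    (hB.continuous.integrable_of_hasCompactSupport hB.compactSupport)] at h1
  linarith

/-- The class in `H¹` of a test function. -/
def IsTestFunction.toH1 {φ : S.Pt d → ℝ} (h : IsTestFunction φ) : SobolevH1 S d :=
  SobolevH1.mk φ (fun i => partialDeriv i φ) h.memLp (fun i => h.memLp_partialDeriv i)
    fun i _ hψ => IsTestFunction.integral_mul_partialDeriv h.smooth hψ i

lemma IsTestFunction.H1ToLTwo_toH1 {φ : S.Pt d → ℝ} (h : IsTestFunction φ) :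
    H1ToLTwo S d h.toH1 = h.memLp.toLp φ := rfl

lemma IsTestFunction.partial_toH1 {φ : S.Pt d → ℝ} (h : IsTestFunction φ) (i : Fin d) :
    h.toH1.partial i = (h.memLp_partialDeriv i).toLp (partialDeriv i φ) := rfl

/-! ### Mollification of `L²` and `H¹` functions -/

lemma exists_isMollifier (d : ℕ) : ∃ ρ : EuclideanSpace ℝ (Fin d) → ℝ, IsMollifier ρ := by
  let f : ContDiffBump (0 : EuclideanSpace ℝ (Fin d)) := ⟨1, 2, one_pos, one_lt_two⟩
  exact ⟨f.normed volume, f.contDiff_normed, f.hasCompactSupport_normed, f.nonneg_normed,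
    f.integral_normed⟩

lemma isTestFunction_kernelConv {κ : EuclideanSpace ℝ (Fin d) → ℝ} (hκ : ContDiff ℝ ∞ κ)
    (hκs : HasCompactSupport κ) {f : S.Pt d → ℝ} (hf : MemLp f 2 volume)
    (hfs : HasCompactSupport f) : IsTestFunction (kernelConv κ f) where
  smooth := contDiff_kernelConv_comp_proj hκ hκs (by norm_num : (1 : ℝ≥0∞) ≤ 2) hf
  compactSupport := by
    refine HasCompactSupport.intro (K := (fun q : S.Pt d × EuclideanSpace ℝ (Fin d) =>
      q.1 + S.proj q.2) '' (tsupport f ×ˢ tsupport κ))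
      ((hfs.isCompact.prod hκs.isCompact).image
        (continuous_fst.add (S.continuous_proj.comp continuous_snd))) fun x hx => ?_
    unfold kernelConv
    refine integral_eq_zero_of_ae (Eventually.of_forall fun z => ?_)
    by_contra hne
    refine hx ⟨(x - S.proj z, z), ⟨subset_tsupport f (right_ne_zero_of_mul hne),
      subset_tsupport κ (left_ne_zero_of_mul hne)⟩, by simp⟩

/-- An `L²` function that annihilates all test functions vanishes. -/
lemma eq_zero_of_forall_integral_test_eq_zero {u : LTwo S d}
    (h : ∀ φ : S.Pt d → ℝ, IsTestFunction φ → ∫ x, u x * φ x = 0) : u = 0 := by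
  obtain ⟨ρ, hρ⟩ := exists_isMollifier d
  -- Mollifying a compactly supported `g` gives test functions converging to `g`, so `u` is
  -- orthogonal to every such `g`. Choosing `g` within `‖u‖ / 2` of `u` then yields `‖u‖² = ⟪u, u -
  -- g⟫ ≤ ‖u‖² / 2`.
  have hcc : ∀ g : S.Pt d → ℝ, HasCompactSupport g → ∀ hg : MemLp g 2 volume,
      inner ℝ u (hg.toLp g) = 0 := by
    intro g hgs hg
    have hm : ∀ n, MemLp (kernelConv (scaledMollifier ρ n) g) 2 volume := fun n =>
      (hρ.scaled n).memLp_kernelConv (by norm_num) (by simp) hg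
    have h1 : Tendsto (fun n : ℕ+ => (hm n).toLp _) atTop (𝓝 (hg.toLp g)) :=
      (Lp.tendsto_Lp_iff_tendsto_eLpNorm'' _ hm g hg).2 (hρ.tendsto_eLpNorm_kernelConv_sub hg)
    have h2 := Tendsto.inner (𝕜 := ℝ) (tendsto_const_nhds (x := u)) h1
    refine tendsto_nhds_unique h2 (tendsto_const_nhds.congr fun n => ?_)
    rw [← integral_mul_eq_inner]
    exact (h _ (isTestFunction_kernelConv (hρ.scaled n).smooth (hρ.scaled n).compactSupport hg
      hgs)).symm
  by_contra hne
  have hpos : 0 < ‖u‖ := norm_pos_iff.2 hne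
  obtain ⟨g, hgs, hgε, -, hg⟩ := (Lp.memLp u).exists_hasCompactSupport_eLpNorm_sub_le
    (by simp : (2 : ℝ≥0∞) ≠ ⊤) (ε := ENNReal.ofReal (‖u‖ / 2)) (by simpa using hpos)
  have h1 : ‖u - hg.toLp g‖ ≤ ‖u‖ / 2 := by
    have h2 : edist u (hg.toLp g) ≤ ENNReal.ofReal (‖u‖ / 2) := by
      conv_lhs => rw [← Lp.toLp_coeFn u (Lp.memLp u), Lp.edist_toLp_toLp]
      exact hgε
    rw [edist_dist, ENNReal.ofReal_le_ofReal_iff (by positivity), dist_eq_norm] at h2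
    exact h2
  have h2 : inner ℝ u (u - hg.toLp g) = ‖u‖ ^ 2 := by
    rw [inner_sub_right, hcc g hgs hg, sub_zero, real_inner_self_eq_norm_sq]
  have h3 := real_inner_le_norm u (u - hg.toLp g)
  rw [h2] at h3
  nlinarith

/-- An element of `H¹` is determined by the underlying function. -/
lemma SobolevH1.ext_of_H1ToLTwo {U V : SobolevH1 S d} (h : H1ToLTwo S d U = H1ToLTwo S d V) :
    U = V := by
  have h0 : H1ToLTwo S d (U - V) = 0 := by rw [map_sub, h, sub_self]
  have h1 : ∀ i, (U - V).partial i = 0 := by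
    intro i
    refine eq_zero_of_forall_integral_test_eq_zero fun φ hφ => ?_
    have h2 := (U - V).hasWeakPartial i φ hφ
    rw [h0, integral_mul_eq_inner _ (hφ.memLp_partialDeriv i), inner_zero_left] at h2
    linarith
  have h2 : ‖U - V‖ ^ 2 = 0 := by
    rw [SobolevH1.norm_sq_eq, h0]
    simp [h1]
  exact sub_eq_zero.1 (norm_eq_zero.1 (pow_eq_zero_iff two_ne_zero |>.1 h2))

lemma lintegral_enorm_mul_le {f g : S.Pt d → ℝ} (hf : AEStronglyMeasurable f volume)
    (hg : AEStronglyMeasurable g volume) :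
    ∫⁻ x, ‖f x * g x‖ₑ ≤ eLpNorm f 2 volume * eLpNorm g 2 volume := by
  have h := eLpNorm_smul_le_mul_eLpNorm (p := 2) (q := 2) (r := 1) hg hf
  rw [eLpNorm_one_eq_lintegral_enorm] at h
  exact h

/-- Mollification is moved to translations of the other factor. -/
lemma integral_kernelConv_mul {κ : EuclideanSpace ℝ (Fin d) → ℝ} (hκ : Continuous κ)
    (hκs : HasCompactSupport κ) (u : LTwo S d) {g : S.Pt d → ℝ} (hg : MemLp g 2 volume) :
    ∫ x, kernelConv κ u x * g x = ∫ z, κ z * ∫ x, u (x - S.proj z) * g x := by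
  have hu := Lp.stronglyMeasurable u
  have hmeas : AEStronglyMeasurable
      (fun q : S.Pt d × EuclideanSpace ℝ (Fin d) => κ q.2 * u (q.1 - S.proj q.2) * g q.1)
      (volume.prod volume) :=
    ((hκ.comp continuous_snd).aestronglyMeasurable.mul
      (stronglyMeasurable_sub_proj hu).aestronglyMeasurable).mul hg.1.comp_fst
  have hint : Integrable
      (fun q : S.Pt d × EuclideanSpace ℝ (Fin d) => κ q.2 * u (q.1 - S.proj q.2) * g q.1)
      (volume.prod volume) := by
    refine ⟨hmeas, ?_⟩
    rw [HasFiniteIntegral, lintegral_prod_symm _ hmeas.enorm]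
    have h1 : ∀ z : EuclideanSpace ℝ (Fin d),
        ∫⁻ x, ‖κ z * u (x - S.proj z) * g x‖ₑ
          ≤ ‖κ z‖ₑ * (eLpNorm u 2 volume * eLpNorm g 2 volume) := by
      intro z
      have hmp : MeasurePreserving (fun x : S.Pt d => x - S.proj z) volume volume :=
        measurePreserving_sub_right volume (S.proj z)
      simp only [mul_assoc, enorm_mul (κ z)]
      rw [lintegral_const_mul' _ _ enorm_ne_top]
      refine mul_le_mul_right ?_ _
      have h2 := lintegral_enorm_mul_le (hu.aestronglyMeasurable.comp_measurePreserving hmp) hg.1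
      rw [eLpNorm_comp_measurePreserving hu.aestronglyMeasurable hmp] at h2
      exact h2
    refine (lintegral_mono h1).trans_lt ?_
    rw [lintegral_mul_const _ hκ.measurable.enorm]
    exact ENNReal.mul_lt_top (hκ.integrable_of_hasCompactSupport hκs).2
      (ENNReal.mul_lt_top (Lp.memLp u).2 hg.2)
  calc ∫ x, kernelConv κ u x * g x = ∫ x, ∫ z, κ z * u (x - S.proj z) * g x := by
        simp only [kernelConv, integral_mul_const]
    _ = ∫ z, ∫ x, κ z * u (x - S.proj z) * g x := integral_integral_swap hint
    _ = _ := by simp only [mul_assoc, integral_const_mul]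

/-- Weak differentiation commutes with convolution: Fubini shifts the translations onto the test
function, and translates of test functions are test functions. -/
lemma integral_kernelConv_mul_partialDeriv {κ : EuclideanSpace ℝ (Fin d) → ℝ} (hκ : Continuous κ)
    (hκs : HasCompactSupport κ) (U : SobolevH1 S d) (i : Fin d) {φ : S.Pt d → ℝ}
    (hφ : IsTestFunction φ) :
    ∫ x, kernelConv κ (H1ToLTwo S d U) x * partialDeriv i φ x
      = -∫ x, kernelConv κ (U.partial i) x * φ x := by
  rw [integral_kernelConv_mul hκ hκs _ (hφ.memLp_partialDeriv i),
    integral_kernelConv_mul hκ hκs _ hφ.memLp, ← integral_neg]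
  congr 1
  funext z
  have h1 : ∫ x, H1ToLTwo S d U (x - S.proj z) * partialDeriv i φ x
      = ∫ x, H1ToLTwo S d U x * partialDeriv i (fun x => φ (x + S.proj z)) x := by
    rw [← integral_sub_right_eq_self
      (fun x => H1ToLTwo S d U x * partialDeriv i (fun x => φ (x + S.proj z)) x) (S.proj z)]
    simp [partialDeriv_translate]
  have h2 : ∫ x, U.partial i (x - S.proj z) * φ x
      = ∫ x, U.partial i x * φ (x + S.proj z) := by
    rw [← integral_sub_right_eq_self (fun x => U.partial i x * φ (x + S.proj z)) (S.proj z)]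
    simp
  rw [h1, h2, U.hasWeakPartial i _ (hφ.translate z), mul_neg]

namespace IsMollifier

variable {ρ : EuclideanSpace ℝ (Fin d) → ℝ}

lemma memLp_kernelConv_Lp (hρ : IsMollifier ρ) (u : LTwo S d) :
    MemLp (kernelConv ρ u) 2 volume :=
  hρ.memLp_kernelConv (by norm_num) (by simp) (Lp.memLp u)

/-- Mollification on `H¹`. -/
def mollifyH1 (hρ : IsMollifier ρ) (U : SobolevH1 S d) : SobolevH1 S d :=
  SobolevH1.mk (kernelConv ρ (H1ToLTwo S d U)) (fun i => kernelConv ρ (U.partial i))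
    (hρ.memLp_kernelConv_Lp _) (fun _ => hρ.memLp_kernelConv_Lp _)
    fun _ _ hφ => integral_kernelConv_mul_partialDeriv hρ.smooth.continuous hρ.compactSupport U _ hφ

lemma tendsto_mollify_Lp (hρ : IsMollifier ρ) (u : LTwo S d) :
    Tendsto (fun n : ℕ+ => ((hρ.scaled n).memLp_kernelConv_Lp u).toLp _) atTop (𝓝 u) := by
  have h := (Lp.tendsto_Lp_iff_tendsto_eLpNorm'' (fun n : ℕ+ => kernelConv (scaledMollifier ρ n) u)
    (fun n => (hρ.scaled n).memLp_kernelConv_Lp u) u (Lp.memLp u)).2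
    (hρ.tendsto_eLpNorm_kernelConv_sub (Lp.memLp u))
  rwa [Lp.toLp_coeFn] at h

lemma tendsto_mollifyH1 (hρ : IsMollifier ρ) (U : SobolevH1 S d) :
    Tendsto (fun n : ℕ+ => (hρ.scaled n).mollifyH1 U) atTop (𝓝 U) :=
  SobolevH1.tendsto_of_components (hρ.tendsto_mollify_Lp _) fun _ => hρ.tendsto_mollify_Lp _

end IsMollifier

/-- The mollifications of `U` converge to it in `H¹`. Their underlying functions are smooth with
compact support, and an element of `H¹` is determined by its function, so they are the classes of
test functions. -/
lemma SobolevH1.mem_closure_of_compactSupport {U : SobolevH1 S d} {f : S.Pt d → ℝ}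
    (hf : MemLp f 2 volume) (hfs : HasCompactSupport f) (hU : H1ToLTwo S d U = hf.toLp f) :
    U ∈ closure (Set.range fun φ : {φ : S.Pt d → ℝ // IsTestFunction φ} => φ.2.toH1) := by
  obtain ⟨ρ, hρ⟩ := exists_isMollifier d
  refine mem_closure_of_tendsto (hρ.tendsto_mollifyH1 U) (Eventually.of_forall fun n => ?_)
  have ht := isTestFunction_kernelConv (hρ.scaled n).smooth (hρ.scaled n).compactSupport hf hfs
  refine ⟨⟨_, ht⟩, SobolevH1.ext_of_H1ToLTwo ?_⟩
  have h1 : kernelConv (scaledMollifier ρ n) (H1ToLTwo S d U)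
      = kernelConv (scaledMollifier ρ n) f := by
    rw [hU]
    exact kernelConv_congr_ae _ hf.coeFn_toLp
  change ht.memLp.toLp _ = ((hρ.scaled n).memLp_kernelConv_Lp (H1ToLTwo S d U)).toLp _
  simp only [h1]

/-! ### Cutoffs -/

lemma tendsto_eLpNorm_bdd_mul {h : ℕ → S.Pt d → ℝ} (hh : ∀ m, AEStronglyMeasurable (h m) volume)
    {C : ℝ} (hC : ∀ m x, |h m x| ≤ C) (hlim : ∀ x, Tendsto (fun m => h m x) atTop (𝓝 0))
    {f : S.Pt d → ℝ} (hf : MemLp f 2 volume) :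
    Tendsto (fun m => eLpNorm (fun x => h m x * f x) 2 volume) atTop (𝓝 0) := by
  have hsq : ∀ g : S.Pt d → ℝ, eLpNorm g 2 volume = (∫⁻ x, ‖g x‖ₑ ^ (2 : ℝ)) ^ (1 / 2 : ℝ) := by
    intro g
    rw [eLpNorm_eq_lintegral_rpow_enorm_toReal (by simp) (by simp)]
    simp
  have hfin : ∫⁻ x, ‖f x‖ₑ ^ (2 : ℝ) ≠ ⊤ := by
    have := hf.2
    rw [hsq] at this
    intro htop
    rw [htop] at this
    simp at this
  have hC0 : 0 ≤ C := (abs_nonneg _).trans (hC 0 0)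
  have h1 : Tendsto (fun m => ∫⁻ x, ‖h m x * f x‖ₑ ^ (2 : ℝ)) atTop (𝓝 (∫⁻ _ : S.Pt d, 0)) := by
    refine tendsto_lintegral_of_dominated_convergence'
      (fun x => ENNReal.ofReal C ^ (2 : ℝ) * ‖f x‖ₑ ^ (2 : ℝ))
      (fun m => ((hh m).mul hf.1).enorm.pow_const _) ?_ ?_ ?_
    · refine fun m => Eventually.of_forall fun x => ?_
      change ‖h m x * f x‖ₑ ^ (2 : ℝ) ≤ ENNReal.ofReal C ^ (2 : ℝ) * ‖f x‖ₑ ^ (2 : ℝ)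
      rw [enorm_mul, ENNReal.mul_rpow_of_nonneg _ _ (by norm_num)]
      gcongr
      rw [Real.enorm_eq_ofReal_abs]
      exact ENNReal.ofReal_le_ofReal (hC m x)
    · rw [lintegral_const_mul' _ _ (ENNReal.rpow_ne_top_of_nonneg (by norm_num)
        ENNReal.ofReal_ne_top)]
      exact ENNReal.mul_ne_top (ENNReal.rpow_ne_top_of_nonneg (by norm_num)
        ENNReal.ofReal_ne_top) hfin
    · refine Eventually.of_forall fun x => ?_
      have h2 : Tendsto (fun m => h m x * f x) atTop (𝓝 0) := by
        simpa using (hlim x).mul_const (f x)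
      have h3 := ((continuous_enorm.tendsto (0 : ℝ)).comp h2).ennrpow_const 2
      simpa using h3
  simp_rw [hsq]
  have h2 := h1.ennrpow_const (1 / 2)
  simpa using h2

/-- On the torus the constant `1` serves. On `ℝᵈ` the bump is dilated by `m + 1`, which divides its
gradient by `m + 1`, so all bounds are uniform in `m`; together with the pointwise eventual
equalities they feed dominated convergence. -/
lemma exists_cutoffs (S : BaseSpace) (d : ℕ) : ∃ χ : ℕ → S.Pt d → ℝ, (∀ m, IsTestFunction (χ m)) ∧
    (∃ C, ∀ m x, |χ m x| ≤ C ∧ ∀ i, |partialDeriv i (χ m) x| ≤ C) ∧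
    ∀ x, ∀ᶠ m in atTop, χ m x = 1 ∧ ∀ i, partialDeriv i (χ m) x = 0 := by
  cases S with
  | torus =>
    have h0 : ∀ (i : Fin d) x, partialDeriv i (fun _ : BaseSpace.torus.Pt d => (1 : ℝ)) x = 0 :=
      fun i x => by simp [partialDeriv]
    have hcpt : CompactSpace (BaseSpace.torus.Pt d) :=
      inferInstanceAs (CompactSpace (UnitAddTorus (Fin d)))
    refine ⟨fun _ _ => 1, fun m => ⟨contDiff_const, HasCompactSupport.of_compactSpace _⟩,
      ⟨1, fun m x => ⟨by simp, fun i => by rw [h0]; simp⟩⟩, fun x => Eventually.of_forall fun m =>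
      ⟨rfl, fun i => h0 i x⟩⟩
  | euclidean =>
    let f : ContDiffBump (0 : EuclideanSpace ℝ (Fin d)) := ⟨1, 2, one_pos, one_lt_two⟩
    have hfs : HasCompactSupport f := f.hasCompactSupport
    have hfd : ContDiff ℝ ∞ f := f.contDiff
    obtain ⟨C, hC⟩ := (hfs.fderiv ℝ).exists_bound_of_continuous (hfd.continuous_fderiv (by simp))
    have hC0 : 0 ≤ C := (norm_nonneg _).trans (hC 0)
    let χ : ℕ → EuclideanSpace ℝ (Fin d) → ℝ := fun m x => f ((1 / ((m : ℝ) + 1)) • x)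
    have hpos : ∀ m : ℕ, 0 < 1 / ((m : ℝ) + 1) := fun m => by positivity
    have hle : ∀ m : ℕ, 1 / ((m : ℝ) + 1) ≤ 1 := fun m => by
      rw [div_le_one (by positivity)]
      have : (0 : ℝ) ≤ m := by positivity
      linarith
    have ht : ∀ m, IsTestFunction (S := BaseSpace.euclidean) (χ m) := fun m =>
      ⟨hfd.comp (contDiff_const_smul _), hfs.comp_smul (hpos m).ne'⟩
    have hpd : ∀ m (i : Fin d) (x : EuclideanSpace ℝ (Fin d)), partialDeriv (S := BaseSpace.euclidean) i (χ m) x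
        = (1 / ((m : ℝ) + 1)) * fderiv ℝ f ((1 / ((m : ℝ) + 1)) • x)
          (EuclideanSpace.single i 1) := by
      intro m i x
      have h1 := partialDeriv_proj (S := BaseSpace.euclidean) (ht m) i x
      change partialDeriv (S := BaseSpace.euclidean) i (χ m) x
        = fderiv ℝ (χ m) x (EuclideanSpace.single i 1) at h1
      rw [h1]
      have h2 : HasFDerivAt f (fderiv ℝ f ((1 / ((m : ℝ) + 1)) • x)) ((1 / ((m : ℝ) + 1)) • x) :=
        ((hfd.differentiable (by simp)) _).hasFDerivAt
      have h3 : HasFDerivAt (fun y : EuclideanSpace ℝ (Fin d) => (1 / ((m : ℝ) + 1)) • y)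
          ((1 / ((m : ℝ) + 1)) • ContinuousLinearMap.id ℝ _) x :=
        ((1 / ((m : ℝ) + 1)) • ContinuousLinearMap.id ℝ (EuclideanSpace ℝ (Fin d))).hasFDerivAt
      have h4 : HasFDerivAt (χ m) _ x := h2.comp x h3
      rw [h4.fderiv]
      simp
    refine ⟨χ, ht, ⟨max 1 C, fun m (x : EuclideanSpace ℝ (Fin d)) => ⟨?_, fun i => ?_⟩⟩,
      fun (x : EuclideanSpace ℝ (Fin d)) => ?_⟩
    · refine le_max_of_le_left ?_
      change |f ((1 / ((m : ℝ) + 1)) • x)| ≤ 1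
      rw [abs_of_nonneg f.nonneg]
      exact f.le_one
    · refine le_max_of_le_right ?_
      rw [hpd, abs_mul, abs_of_pos (hpos m)]
      have h1 := (fderiv ℝ f ((1 / ((m : ℝ) + 1)) • x)).le_of_opNorm_le (hC _)
        (EuclideanSpace.single i (1 : ℝ))
      rw [PiLp.norm_single, norm_one, mul_one, Real.norm_eq_abs] at h1
      calc _ ≤ 1 * C := mul_le_mul (hle m) h1 (abs_nonneg _) zero_le_one
        _ = C := one_mul C
    · have hx : ∀ᶠ m : ℕ in atTop, ‖(1 / ((m : ℝ) + 1)) • (x : EuclideanSpace ℝ (Fin d))‖ < 1 := by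
        have h1 : Tendsto (fun m : ℕ => ‖(1 / ((m : ℝ) + 1)) • (x : EuclideanSpace ℝ (Fin d))‖)
            atTop (𝓝 0) := by
          have h2 := (tendsto_one_div_add_atTop_nhds_zero_nat (𝕜 := ℝ)).smul_const
            (x : EuclideanSpace ℝ (Fin d))
          simpa using h2.norm
        exact h1.eventually (gt_mem_nhds one_pos)
      filter_upwards [hx] with m hm
      refine ⟨f.one_of_mem_closedBall (mem_closedBall_zero_iff.2 hm.le), fun i => ?_⟩
      rw [hpd]
      have h1 : (f : EuclideanSpace ℝ (Fin d) → ℝ)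
          =ᶠ[𝓝 ((1 / ((m : ℝ) + 1)) • x)] fun _ => 1 :=
        f.eventuallyEq_one_of_mem_ball (mem_ball_zero_iff.2 hm)
      rw [h1.fderiv_eq]
      simp

lemma integrable_Lp_mul (u : LTwo S d) {ψ : S.Pt d → ℝ} (hψ : MemLp ψ 2 volume) :
    Integrable fun x => u x * ψ x :=
  (Lp.memLp u).integrable_mul hψ

lemma IsTestFunction.integral_cutoff {χ : S.Pt d → ℝ} (hχ : IsTestFunction χ)
    (U : SobolevH1 S d) (i : Fin d) {φ : S.Pt d → ℝ} (hφ : IsTestFunction φ) :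
    ∫ x, (χ x * H1ToLTwo S d U x) * partialDeriv i φ x
      = -∫ x, (χ x * U.partial i x + partialDeriv i χ x * H1ToLTwo S d U x) * φ x := by
  have hχφ := IsTestFunction.smooth_mul hχ.smooth hφ
  have hdχφ := IsTestFunction.smooth_mul (hχ.pderiv i).smooth hφ
  have hχdφ := IsTestFunction.smooth_mul hχ.smooth (hφ.pderiv i)
  have h1 := U.hasWeakPartial i _ hχφ
  simp only [partialDeriv_mul hχ.smooth hφ.smooth, mul_add] at h1
  rw [integral_add (integrable_Lp_mul _ hdχφ.memLp)
    (integrable_Lp_mul _ hχdφ.memLp)] at h1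
  have h2 : ∫ x, (χ x * U.partial i x + partialDeriv i χ x * H1ToLTwo S d U x) * φ x
      = (∫ x, U.partial i x * (χ x * φ x))
        + ∫ x, H1ToLTwo S d U x * (partialDeriv i χ x * φ x) := by
    rw [← integral_add (integrable_Lp_mul _ hχφ.memLp)
      (integrable_Lp_mul _ hdχφ.memLp)]
    congr 1
    funext x
    ring
  have h3 : ∫ x, (χ x * H1ToLTwo S d U x) * partialDeriv i φ x
      = ∫ x, H1ToLTwo S d U x * (χ x * partialDeriv i φ x) := by
    congr 1
    funext x
    ring
  rw [h2, h3]
  linarith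

lemma IsTestFunction.memLp_mul {χ f : S.Pt d → ℝ} (hχ : IsTestFunction χ)
    (hf : MemLp f 2 volume) : MemLp (fun x => χ x * f x) 2 volume := by
  obtain ⟨C, hC⟩ := hχ.exists_bound
  exact hf.bdd_mul' hχ.continuous.aestronglyMeasurable hC

/-- Multiplication by a test function on `H¹`. -/
def IsTestFunction.mulH1 {χ : S.Pt d → ℝ} (hχ : IsTestFunction χ) (U : SobolevH1 S d) :
    SobolevH1 S d :=
  SobolevH1.mk (fun x => χ x * H1ToLTwo S d U x)
    (fun i x => χ x * U.partial i x + partialDeriv i χ x * H1ToLTwo S d U x)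
    (hχ.memLp_mul (Lp.memLp _))
    (fun i => (hχ.memLp_mul (Lp.memLp _)).add ((hχ.pderiv i).memLp_mul (Lp.memLp _)))
    fun i _ hφ => hχ.integral_cutoff U i hφ

/-- Test functions are dense in `H¹(M)`. -/
lemma denseRange_toH1 :
    DenseRange fun φ : {φ : S.Pt d → ℝ // IsTestFunction φ} => φ.2.toH1 := by
  intro U
  obtain ⟨χ, hχ, ⟨C, hC⟩, hlim⟩ := exists_cutoffs S d
  have hU : Tendsto (fun m => (hχ m).mulH1 U) atTop (𝓝 U) := by
    have hone : ∀ x, Tendsto (fun m => χ m x - 1) atTop (𝓝 0) := fun x =>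
      tendsto_const_nhds.congr' (by
        filter_upwards [hlim x] with m hm
        rw [hm.1, sub_self])
    have hsub : ∀ f : S.Pt d → ℝ, MemLp f 2 volume →
        Tendsto (fun m => eLpNorm (fun x => (χ m x - 1) * f x) 2 volume) atTop (𝓝 0) := by
      intro f hf
      refine tendsto_eLpNorm_bdd_mul (h := fun m x => χ m x - 1) (C := C + 1)
        (fun m => ((hχ m).continuous.sub continuous_const).aestronglyMeasurable) ?_ hone hf
      intro m x
      have h1 := abs_sub (χ m x) 1
      have h2 := (hC m x).1
      rw [abs_one] at h1
      exact h1.trans (by linarith)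
    have hder : ∀ i, ∀ f : S.Pt d → ℝ, MemLp f 2 volume →
        Tendsto (fun m => eLpNorm (fun x => partialDeriv i (χ m) x * f x) 2 volume)
          atTop (𝓝 0) := by
      intro i f hf
      refine tendsto_eLpNorm_bdd_mul (h := fun m => partialDeriv i (χ m)) (C := C)
        (fun m => ((hχ m).pderiv i).continuous.aestronglyMeasurable)
        (fun m x => (hC m x).2 i) ?_ hf
      exact fun x => tendsto_const_nhds.congr' (by
        filter_upwards [hlim x] with m hm
        rw [hm.2 i])
    refine SobolevH1.tendsto_of_components ?_ fun i => ?_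
    · have h1 := (Lp.tendsto_Lp_iff_tendsto_eLpNorm''
        (fun (m : ℕ) x => χ m x * H1ToLTwo S d U x)
        (fun m => (hχ m).memLp_mul (Lp.memLp _)) _ (Lp.memLp (H1ToLTwo S d U))).2 (by
          refine (hsub _ (Lp.memLp (H1ToLTwo S d U))).congr fun m => ?_
          congr 1
          funext x
          simp only [Pi.sub_apply]
          ring)
      rwa [Lp.toLp_coeFn] at h1
    · have h1 := (Lp.tendsto_Lp_iff_tendsto_eLpNorm''
        (fun (m : ℕ) x => χ m x * U.partial i x
          + partialDeriv i (χ m) x * H1ToLTwo S d U x)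
        (fun m => ((hχ m).memLp_mul (Lp.memLp _)).add
          (((hχ m).pderiv i).memLp_mul (Lp.memLp _))) _ (Lp.memLp (U.partial i))).2 (by
          have h2 := (hsub _ (Lp.memLp (U.partial i))).add
            (hder i _ (Lp.memLp (H1ToLTwo S d U)))
          rw [add_zero] at h2
          refine tendsto_of_tendsto_of_tendsto_of_le_of_le tendsto_const_nhds h2
            (fun _ => zero_le) fun m => ?_
          have h3 : ((fun x => χ m x * U.partial i x
              + partialDeriv i (χ m) x * H1ToLTwo S d U x) - ⇑(U.partial i) : S.Pt d → ℝ)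
              = (fun x => (χ m x - 1) * U.partial i x)
                + fun x => partialDeriv i (χ m) x * H1ToLTwo S d U x := by
            funext x
            simp only [Pi.sub_apply, Pi.add_apply]
            ring
          rw [h3]
          exact eLpNorm_add_le
            (((hχ m).continuous.sub continuous_const).aestronglyMeasurable.mul (Lp.memLp _).1)
            (((hχ m).pderiv i).continuous.aestronglyMeasurable.mul (Lp.memLp _).1)
            (by norm_num))
      rwa [Lp.toLp_coeFn] at h1
  -- Two approximations in a row: cutoffs converge to `U`, and each cutoff is a limit of test
  -- functions.
  rw [← closure_closure]
  refine mem_closure_of_tendsto hU (Eventually.of_forall fun m => ?_)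
  exact SobolevH1.mem_closure_of_compactSupport ((hχ m).memLp_mul (Lp.memLp _))
    (hχ m).compactSupport.mul_right rfl

/-! ### Sobolev embeddings -/

lemma eLpNorm_two_rpow {α F : Type*} [MeasurableSpace α] [NormedAddCommGroup F] (μ : Measure α)
    (g : α → F) : eLpNorm g 2 μ ^ 2 = ∫⁻ x, ‖g x‖ₑ ^ 2 ∂μ := by
  rw [eLpNorm_eq_lintegral_rpow_enorm_toReal (by simp) (by simp), ← ENNReal.rpow_natCast,
    ← ENNReal.rpow_mul]
  simp

/-- In two dimensions, powers of `w` are controlled by the `H¹` norm. -/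
lemma exists_lintegral_pow_le (k : ℕ) : ∃ C : ℝ≥0∞, C ≠ ⊤ ∧
    ∀ w : EuclideanSpace ℝ (Fin 2) → ℝ, ContDiff ℝ 1 w → HasCompactSupport w →
      ∫⁻ x, ‖w x‖ₑ ^ (2 * (k + 1))
        ≤ C * ((∫⁻ x, ‖w x‖ₑ ^ 2) + ∫⁻ x, ‖fderiv ℝ w x‖ₑ ^ 2) ^ (k + 1) := by
  induction k with
  | zero =>
    refine ⟨1, by simp, fun w _ _ => ?_⟩
    simp
  | succ k ih =>
    obtain ⟨C, hC, h⟩ := ih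
    -- The constant of the Gagliardo–Nirenberg inequality `W^{1,1}(ℝ²) ⊂ L²`. Applied to `w^(k+2)`,
    -- it gives by Cauchy–Schwarz `‖w^(k+2)‖₂ ≤ G (k+2) ‖w^(k+1)‖₂ ‖∇w‖₂`, which is the induction
    -- step.
    set G : ℝ≥0 := eLpNormLESNormFDerivOneConst
      (volume : Measure (EuclideanSpace ℝ (Fin 2))) 2 with hG
    refine ⟨((G : ℝ≥0∞) * (k + 2)) ^ 2 * C, ENNReal.mul_ne_top (ENNReal.pow_ne_top
      (ENNReal.mul_ne_top ENNReal.coe_ne_top (by finiteness))) hC, fun w hw hws => ?_⟩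
    set a := (∫⁻ x, ‖w x‖ₑ ^ 2) + ∫⁻ x, ‖fderiv ℝ w x‖ₑ ^ 2 with ha
    have hconj : NNReal.HolderConjugate (Module.finrank ℝ (EuclideanSpace ℝ (Fin 2))) 2 := by
      rw [finrank_euclideanSpace_fin, NNReal.holderConjugate_iff]
      constructor
      · norm_num
      · norm_num
    have hwk : ContDiff ℝ 1 fun x => w x ^ (k + 2) := hw.pow _
    have hwks : HasCompactSupport fun x => w x ^ (k + 2) :=
      hws.comp_left (g := fun t : ℝ => t ^ (k + 2)) (by simp)
    have h1 := eLpNorm_le_eLpNorm_fderiv_one volume hwk hwks hconj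
    have hwm : Measurable fun x => ‖w x‖ₑ := hw.continuous.measurable.enorm
    have hdm : Measurable fun x => ‖fderiv ℝ w x‖ₑ :=
      (hw.continuous_fderiv (by simp)).measurable.enorm
    have hfd : ∀ x, ‖fderiv ℝ (fun x => w x ^ (k + 2)) x‖ₑ
        = (k + 2) * (‖w x‖ₑ ^ (k + 1) * ‖fderiv ℝ w x‖ₑ) := by
      intro x
      have hd : DifferentiableAt ℝ w x := (hw.differentiable (by simp)).differentiableAt
      have h2 : fderiv ℝ (fun x => w x ^ (k + 2)) x
          = ((k + 2 : ℕ) * w x ^ (k + 1)) • fderiv ℝ w x := by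
        have h3 := (hd.hasFDerivAt.pow (k + 2)).fderiv
        simpa using h3
      rw [h2, enorm_smul, enorm_mul, enorm_pow, mul_assoc]
      congr 1
      rw [Real.enorm_eq_ofReal (by positivity), ENNReal.ofReal_natCast]
      push_cast
      rfl
    have h2 : eLpNorm (fderiv ℝ fun x => w x ^ (k + 2)) 1 volume
        ≤ (k + 2) * ((∫⁻ x, ‖w x‖ₑ ^ (2 * (k + 1))) ^ (1 / 2 : ℝ)
          * (∫⁻ x, ‖fderiv ℝ w x‖ₑ ^ 2) ^ (1 / 2 : ℝ)) := by
      rw [eLpNorm_one_eq_lintegral_enorm]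
      simp_rw [hfd]
      rw [lintegral_const_mul' _ _ (by finiteness)]
      refine mul_le_mul_right ?_ _
      have h3 := ENNReal.lintegral_mul_le_Lp_mul_Lq volume
        (Real.HolderConjugate.two_two) (hwm.pow_const (k + 1)).aemeasurable hdm.aemeasurable
      simpa [← pow_mul, mul_comm] using h3
    have h3 : ∫⁻ x, ‖w x‖ₑ ^ (2 * (k + 1 + 1)) = eLpNorm (fun x => w x ^ (k + 2)) 2 volume ^ 2 := by
      rw [eLpNorm_two_rpow]
      refine lintegral_congr fun x => ?_
      rw [enorm_pow, ← pow_mul, mul_comm]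
    have hhalf : ∀ b : ℝ≥0∞, (b ^ (1 / 2 : ℝ)) ^ 2 = b := fun b => by
      rw [← ENNReal.rpow_natCast, ← ENNReal.rpow_mul]
      norm_num
    rw [h3]
    calc eLpNorm (fun x => w x ^ (k + 2)) 2 volume ^ 2
        ≤ ((G : ℝ≥0∞) * ((k + 2) * ((∫⁻ x, ‖w x‖ₑ ^ (2 * (k + 1))) ^ (1 / 2 : ℝ)
          * (∫⁻ x, ‖fderiv ℝ w x‖ₑ ^ 2) ^ (1 / 2 : ℝ)))) ^ 2 := by
          exact pow_le_pow_left' (h1.trans (mul_le_mul_right h2 _)) 2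
      _ = ((G : ℝ≥0∞) * (k + 2)) ^ 2 * ((∫⁻ x, ‖w x‖ₑ ^ (2 * (k + 1)))
          * ∫⁻ x, ‖fderiv ℝ w x‖ₑ ^ 2) := by
          rw [← mul_assoc, mul_pow, mul_pow (_ ^ (1 / 2 : ℝ)), hhalf, hhalf]
      _ ≤ ((G : ℝ≥0∞) * (k + 2)) ^ 2 * ((C * a ^ (k + 1)) * a) := by
          gcongr
          · exact h w hw hws
          · exact le_add_self
      _ = _ := by ring

/-- Exponents `s`, `q` with `1/s + 1/q = 1/2` and `s ≤ r`, for which `H¹(ℝᵈ)` embeds into `L^q`. -/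
lemma exists_sobolev_exponents (hd : 2 ≤ d) {r : ℝ≥0∞}
    (hr : (d : ℝ≥0∞) < r ∨ (3 ≤ d ∧ r = d)) :
    ∃ s q : ℝ≥0∞, 1 ≤ s ∧ s ≠ ⊤ ∧ s ≤ r ∧ ENNReal.HolderTriple s q 2 ∧ ∃ C : ℝ≥0∞, C ≠ ⊤ ∧
      ∀ w : EuclideanSpace ℝ (Fin d) → ℝ, ContDiff ℝ 1 w → HasCompactSupport w →
        eLpNorm w q volume ≤ C * (eLpNorm w 2 volume + eLpNorm (fderiv ℝ w) 2 volume) := by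
  rcases eq_or_lt_of_le hd with rfl | hd3
  · have hr2 : ((2 : ℝ≥0) : ℝ≥0∞) < r := by
      rcases hr with h | h
      · simpa using h
      · omega
    obtain ⟨t, ht2, htr⟩ := ENNReal.lt_iff_exists_nnreal_btwn.1 hr2
    have ht : (2 : ℝ) < t := by exact_mod_cast ht2
    -- In dimension two, where `q = ∞` is not available, the exponents are `q = 2(m + 2)` and `s = 2
    -- + 2/(m + 1)`. This choice of `m` ensures `s ≤ t < r`.
    obtain ⟨m, hm⟩ := exists_nat_gt (2 / ((t : ℝ) - 2))
    have ht' : 0 < (t : ℝ) - 2 := by linarith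
    rw [div_lt_iff₀ ht'] at hm
    have hm0 : (0 : ℝ) ≤ m := by positivity
    obtain ⟨C, hC, h⟩ := exists_lintegral_pow_le (m + 1)
    have hs2 : (2 : ℝ≥0) ≤ 2 + 2 / (m + 1) := le_self_add
    refine ⟨((2 + 2 / (m + 1) : ℝ≥0) : ℝ≥0∞), ((2 * (m + 2) : ℕ) : ℝ≥0∞), ?_,
      ENNReal.coe_ne_top, le_trans ?_ htr.le, ?_, C ^ (1 / (2 * (m + 2) : ℝ)),
      ENNReal.rpow_ne_top_of_nonneg (by positivity) hC, fun w hw hws => ?_⟩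
    · exact_mod_cast (by norm_num : (1 : ℝ≥0) ≤ 2).trans hs2
    · refine ENNReal.coe_le_coe.2 ?_
      rw [← NNReal.coe_le_coe]
      push_cast
      rw [← le_sub_iff_add_le', div_le_iff₀ (by positivity)]
      nlinarith
    · constructor
      have h1 : ((2 * (m + 2) : ℕ) : ℝ≥0∞) = ((2 * (m + 2) : ℝ≥0) : ℝ≥0∞) := by push_cast; rfl
      have h2 : (2 : ℝ≥0∞) = ((2 : ℝ≥0) : ℝ≥0∞) := rfl
      rw [h1, h2, ← ENNReal.coe_inv (by positivity), ← ENNReal.coe_inv (by positivity),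
        ← ENNReal.coe_inv (by positivity), ← ENNReal.coe_add]
      congr 1
      field_simp
      rw [← NNReal.coe_inj]
      push_cast
      ring
    · have h1 := h w hw hws
      have hexp : (2 * (m + 2) : ℝ) ≠ 0 := by positivity
      have h2 : eLpNorm w ((2 * (m + 2) : ℕ) : ℝ≥0∞) volume
          = (∫⁻ x, ‖w x‖ₑ ^ (2 * (m + 1 + 1))) ^ (1 / (2 * (m + 2) : ℝ)) := by
        rw [eLpNorm_eq_lintegral_rpow_enorm_toReal (by simp) (ENNReal.natCast_ne_top _)]
        simp only [ENNReal.toReal_natCast, ENNReal.rpow_natCast]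
        push_cast
        rfl
      rw [h2]
      set x := eLpNorm w 2 volume
      set y := eLpNorm (fderiv ℝ w) 2 volume
      rw [← eLpNorm_two_rpow, ← eLpNorm_two_rpow] at h1
      have h3 : C * (x ^ 2 + y ^ 2) ^ (m + 1 + 1) ≤ C * (x + y) ^ (2 * (m + 2)) := by
        rw [pow_mul]
        refine mul_le_mul_right (pow_le_pow_left' ?_ _) _
        have h4 : (x + y) ^ 2 = x ^ 2 + y ^ 2 + 2 * x * y := by ring
        rw [h4]
        exact le_self_add
      refine (ENNReal.rpow_le_rpow (h1.trans h3) (by positivity)).trans ?_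
      rw [ENNReal.mul_rpow_of_nonneg _ _ (by positivity)]
      refine mul_le_mul_right ?_ _
      rw [← ENNReal.rpow_natCast, ← ENNReal.rpow_mul]
      push_cast
      rw [mul_one_div_cancel hexp, ENNReal.rpow_one]
  · have hd3' : (3 : ℝ) ≤ d := by exact_mod_cast hd3
    have hpos : 0 < (2 : ℝ)⁻¹ - (d : ℝ)⁻¹ := by
      rw [sub_pos]
      exact inv_strictAnti₀ (by norm_num) (by linarith)
    -- For `d ≥ 3` the critical exponent `q = 2d/(d - 2)` pairs with `s = d`, so the endpoint `r =
    -- d` is included.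
    set q : ℝ≥0 := ⟨((2 : ℝ)⁻¹ - (d : ℝ)⁻¹)⁻¹, by positivity⟩ with hq
    have hqinv : (q : ℝ)⁻¹ = (2 : ℝ)⁻¹ - (d : ℝ)⁻¹ := inv_inv _
    have hq0 : q ≠ 0 := by
      rw [← NNReal.coe_ne_zero]
      exact (inv_pos.2 hpos).ne'
    have hd0 : (d : ℝ≥0) ≠ 0 := by
      have : d ≠ 0 := by omega
      exact_mod_cast this
    refine ⟨d, q, ?_, ENNReal.natCast_ne_top d, ?_, ?_,
      (SNormLESNormFDerivOfEqConst ℝ (volume : Measure (EuclideanSpace ℝ (Fin d))) 2 : ℝ≥0),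
      ENNReal.coe_ne_top, fun w hw hws => ?_⟩
    · exact_mod_cast (by omega : 1 ≤ d)
    · rcases hr with h | h
      · exact h.le
      · exact h.2.ge
    · constructor
      have h1 : (d : ℝ≥0∞) = ((d : ℝ≥0) : ℝ≥0∞) := by simp
      have h2 : (2 : ℝ≥0∞) = ((2 : ℝ≥0) : ℝ≥0∞) := rfl
      rw [h1, h2, ← ENNReal.coe_inv hd0, ← ENNReal.coe_inv hq0,
        ← ENNReal.coe_inv (by norm_num), ← ENNReal.coe_add]
      congr 1
      rw [← NNReal.coe_inj]
      push_cast
      rw [hqinv]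
      ring
    · have h1 := eLpNorm_le_eLpNorm_fderiv_of_eq (F := ℝ) volume hw hws (p := 2) (p' := q)
        (by norm_num) (by rw [finrank_euclideanSpace_fin]; omega)
        (by rw [finrank_euclideanSpace_fin, hqinv]; rfl)
      refine h1.trans ?_
      refine mul_le_mul_right ?_ _
      exact le_add_self

/-- A cutoff on `ℝᵈ` that transfers functions from `M` to `ℝᵈ`. -/
lemma exists_unfolding (S : BaseSpace) (d : ℕ) : ∃ (χ : EuclideanSpace ℝ (Fin d) → ℝ)
    (Q : Set (EuclideanSpace ℝ (Fin d))) (N : ℝ≥0) (B : ℝ), ContDiff ℝ ∞ χ ∧ MeasurableSet Q ∧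
    (∀ z, |χ z| ≤ B ∧ ‖fderiv ℝ χ z‖ ≤ B) ∧
    (∀ φ : S.Pt d → ℝ, HasCompactSupport φ → HasCompactSupport fun z => χ z * φ (S.proj z)) ∧
    (∀ z ∈ Q, χ z = 1) ∧
    (volume : Measure (S.Pt d)) ≤ (volume.restrict Q).map S.proj ∧
    ((volume.restrict (tsupport χ)).map S.proj : Measure (S.Pt d)) ≤ N • volume := by
  cases S with
  | euclidean =>
    have hmap : ∀ μ : Measure (EuclideanSpace ℝ (Fin d)),
        Measure.map (BaseSpace.euclidean.proj : EuclideanSpace ℝ (Fin d) → _) μ = μ :=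
      fun μ => Measure.map_id
    -- No cutoff is needed on `ℝᵈ`: `φ` already has compact support.
    refine ⟨fun _ => 1, Set.univ, 1, 1, contDiff_const, MeasurableSet.univ, fun z => by simp,
      fun φ hφ => hφ.mul_left, fun z _ => rfl, ?_, ?_⟩
    · rw [hmap, Measure.restrict_univ]
      exact le_rfl
    · rw [hmap, one_smul]
      exact Measure.restrict_le_self
  | torus =>
    -- Points of the unit cube have norm at most `√d ≤ d + 1`, so the bump equals `1` on a
    -- fundamental domain.
    let f : ContDiffBump (0 : EuclideanSpace ℝ (Fin d)) :=
      ⟨(d : ℝ) + 1, (d : ℝ) + 2, by positivity, by linarith⟩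
    have hfs : HasCompactSupport f := f.hasCompactSupport
    have hfd : ContDiff ℝ ∞ f := f.contDiff
    obtain ⟨C, hC⟩ := (hfs.fderiv ℝ).exists_bound_of_continuous (hfd.continuous_fderiv (by simp))
    obtain ⟨N, hN⟩ := BaseSpace.torus.exists_map_proj_restrict_le hfs.isCompact
    refine ⟨f, BaseSpace.unitCube 0, N, max 1 C, hfd, ?_, fun z => ⟨?_, ?_⟩,
      fun φ _ => hfs.mul_right, fun z hz => ?_, ?_, hN⟩
    · have h1 : BaseSpace.unitCube (0 : EuclideanSpace ℝ (Fin d))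
          = ⋂ i, (fun z : EuclideanSpace ℝ (Fin d) => z i) ⁻¹' Set.Ioc 0 1 := by
        ext z
        simp [BaseSpace.unitCube]
      rw [h1]
      exact MeasurableSet.iInter fun i =>
        (by fun_prop : Measurable fun z : EuclideanSpace ℝ (Fin d) => z i) measurableSet_Ioc
    · rw [abs_of_nonneg f.nonneg]
      exact le_max_of_le_left f.le_one
    · exact le_max_of_le_right (hC z)
    · refine f.one_of_mem_closedBall (mem_closedBall_zero_iff.2 ?_)
      change ‖z‖ ≤ (d : ℝ) + 1
      refine le_of_sq_le_sq ?_ (by positivity)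
      rw [EuclideanSpace.norm_sq_eq]
      have h1 : ∀ i, ‖z i‖ ^ 2 ≤ 1 := by
        intro i
        have h2 := hz i
        simp only [PiLp.zero_apply, zero_add] at h2
        rw [Real.norm_of_nonneg h2.1.le]
        exact pow_le_one₀ h2.1.le h2.2
      have h2 : ∑ i, ‖z i‖ ^ 2 ≤ ∑ _i : Fin d, (1 : ℝ) := Finset.sum_le_sum fun i _ => h1 i
      simp only [Finset.sum_const, Finset.card_univ, Fintype.card_fin, nsmul_eq_mul,
        mul_one] at h2
      nlinarith [(by positivity : (0 : ℝ) ≤ d)]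
    · exact (BaseSpace.measurePreserving_proj_torus 0).map_eq.ge

lemma norm_le_sum_apply_single (L : EuclideanSpace ℝ (Fin d) →L[ℝ] ℝ) :
    ‖L‖ ≤ ∑ i, |L (EuclideanSpace.single i 1)| := by
  refine L.opNorm_le_bound (Finset.sum_nonneg fun i _ => abs_nonneg _) fun x => ?_
  have h1 : L x = ∑ i, x i * L (EuclideanSpace.single i 1) := by
    conv_lhs => rw [← (EuclideanSpace.basisFun (Fin d) ℝ).sum_repr x]
    simp
  rw [h1, Finset.sum_mul]
  refine (norm_sum_le _ _).trans (Finset.sum_le_sum fun i _ => ?_)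
  rw [norm_mul, mul_comm, Real.norm_eq_abs]
  exact mul_le_mul_of_nonneg_left (PiLp.norm_apply_le x i) (abs_nonneg _)

lemma IsTestFunction.eLpNorm_two_eq {φ : S.Pt d → ℝ} (h : IsTestFunction φ) :
    eLpNorm φ 2 volume ≤ ENNReal.ofReal ‖h.toH1‖ := by
  have h1 := h.toH1.norm_H1ToLTwo_le
  rw [h.H1ToLTwo_toH1, Lp.norm_toLp] at h1
  rw [← ENNReal.ofReal_toReal h.memLp.2.ne]
  exact ENNReal.ofReal_le_ofReal h1

lemma IsTestFunction.eLpNorm_partialDeriv_le {φ : S.Pt d → ℝ} (h : IsTestFunction φ) (i : Fin d) :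
    eLpNorm (partialDeriv i φ) 2 volume ≤ ENNReal.ofReal ‖h.toH1‖ := by
  have h1 := h.toH1.norm_partial_le i
  rw [h.partial_toH1, Lp.norm_toLp] at h1
  rw [← ENNReal.ofReal_toReal (h.memLp_partialDeriv i).2.ne]
  exact ENNReal.ofReal_le_ofReal h1

/-- A Sobolev embedding on `ℝᵈ` gives one on `M`. -/
lemma exists_sobolev_embedding (S : BaseSpace) {q : ℝ≥0∞} {C : ℝ≥0∞} (hC : C ≠ ⊤)
    (h : ∀ w : EuclideanSpace ℝ (Fin d) → ℝ, ContDiff ℝ 1 w → HasCompactSupport w →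
      eLpNorm w q volume ≤ C * (eLpNorm w 2 volume + eLpNorm (fderiv ℝ w) 2 volume)) :
    ∃ C' : ℝ≥0∞, C' ≠ ⊤ ∧ ∀ (φ : S.Pt d → ℝ) (hφ : IsTestFunction φ),
      eLpNorm φ q volume ≤ C' * ENNReal.ofReal ‖hφ.toH1‖ := by
  obtain ⟨χ, Q, N, B, hχ, hQm, hB, hcs, hQ, hQle, hNle⟩ := exists_unfolding S d
  have hB0 : 0 ≤ B := (abs_nonneg _).trans (hB 0).1
  refine ⟨C * (2 * (ENNReal.ofReal B * ((N : ℝ≥0∞) ^ (1 / 2 : ℝ) * (1 + d)))), ?_,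
    fun φ hφ => ?_⟩
  · have h1 : (N : ℝ≥0∞) ^ (1 / 2 : ℝ) ≠ ⊤ :=
      ENNReal.rpow_ne_top_of_nonneg (by norm_num) ENNReal.coe_ne_top
    finiteness
  -- The lift `w` equals `φ ∘ S.proj` on `Q`, which covers `M`, so its `L^q` norm dominates that of
  -- `φ`. Conversely, its `L²` norms are controlled by those of `φ`, with loss given by the
  -- multiplicity `N` over the support of `χ`.
  set w : EuclideanSpace ℝ (Fin d) → ℝ := fun z => χ z * φ (S.proj z) with hw
  have hwsm : ContDiff ℝ ∞ w := hχ.mul hφ.smooth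
  have hwK : tsupport w ⊆ tsupport χ := tsupport_mul_subset_left
  -- A common majorant: both `|w|` and `‖∇w‖` are at most `B · (g ∘ S.proj)`.
  set g : S.Pt d → ℝ := fun x => |φ x| + ∑ i, |partialDeriv i φ x| with hg
  have hgc : Continuous g := hφ.continuous.abs.add
    (continuous_finsetSum _ fun i _ => (hφ.pderiv i).continuous.abs)
  have hg0 : ∀ x, 0 ≤ ∑ i, |partialDeriv i φ x| := fun x =>
    Finset.sum_nonneg fun i _ => abs_nonneg _
  have hg2 : eLpNorm g 2 volume ≤ (1 + d) * ENNReal.ofReal ‖hφ.toH1‖ := by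
    have hsum : g = (fun x => |φ x|) + ∑ i, fun x => |partialDeriv i φ x| := by
      funext x
      simp [hg]
    have habs : ∀ f : S.Pt d → ℝ, eLpNorm (fun x => |f x|) 2 volume = eLpNorm f 2 volume :=
      fun f => eLpNorm_norm f
    rw [hsum]
    refine (eLpNorm_add_le hφ.continuous.abs.aestronglyMeasurable
      (Finset.aestronglyMeasurable_sum _ fun i _ =>
        (hφ.pderiv i).continuous.abs.aestronglyMeasurable) (by norm_num)).trans ?_
    rw [add_mul, one_mul]
    refine add_le_add ?_ ?_
    · rw [habs]
      exact hφ.eLpNorm_two_eq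
    · refine (eLpNorm_sum_le (fun i _ =>
        (hφ.pderiv i).continuous.abs.aestronglyMeasurable) (by norm_num)).trans ?_
      have h1 : ∀ i ∈ Finset.univ, eLpNorm (fun x => |partialDeriv i φ x|) 2 volume
          ≤ ENNReal.ofReal ‖hφ.toH1‖ := by
        intro i _
        rw [habs]
        exact hφ.eLpNorm_partialDeriv_le i
      refine (Finset.sum_le_sum h1).trans ?_
      simp
  have hgproj : eLpNorm (g ∘ S.proj) 2 (volume.restrict (tsupport χ))
      ≤ (N : ℝ≥0∞) ^ (1 / 2 : ℝ) * eLpNorm g 2 volume := by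
    rw [← eLpNorm_map_measure hgc.aestronglyMeasurable S.continuous_proj.measurable.aemeasurable]
    refine (eLpNorm_mono_measure _ hNle).trans ?_
    rcases eq_or_ne N 0 with h0 | h0
    · simp [h0]
    · have h4 := eLpNorm_smul_measure_of_ne_zero (c := (N : ℝ≥0∞)) (by simpa using h0)
        g 2 (volume : Measure (S.Pt d))
      have h5 : (1 / (2 : ℝ≥0∞)).toReal = 1 / 2 := by simp
      rw [smul_eq_mul, h5] at h4
      exact h4.le
  have hbound : ∀ {F : Type} [NormedAddCommGroup F] (v : EuclideanSpace ℝ (Fin d) → F),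
      Function.support v ⊆ tsupport χ → (∀ z, ‖v z‖ ≤ B * g (S.proj z)) →
      eLpNorm v 2 volume ≤ ENNReal.ofReal B * ((N : ℝ≥0∞) ^ (1 / 2 : ℝ) * (1 + d))
        * ENNReal.ofReal ‖hφ.toH1‖ := by
    intro F _ v hv hle
    rw [← eLpNorm_restrict_eq_of_support_subset hv]
    have h1 := eLpNorm_le_mul_eLpNorm_of_ae_le_mul (f := v) (g := g ∘ S.proj) (c := B)
      (μ := volume.restrict (tsupport χ)) (Eventually.of_forall fun z => by
        refine (hle z).trans (mul_le_mul_of_nonneg_left (le_abs_self _) hB0)) 2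
    refine h1.trans ?_
    calc _ ≤ ENNReal.ofReal B * ((N : ℝ≥0∞) ^ (1 / 2 : ℝ) * ((1 + d) *
          ENNReal.ofReal ‖hφ.toH1‖)) := by
            refine mul_le_mul_right (hgproj.trans (mul_le_mul_right hg2 _)) _
      _ = _ := by ring
  have h1 : eLpNorm φ q volume ≤ eLpNorm w q volume := by
    refine (eLpNorm_mono_measure _ hQle).trans ?_
    rw [eLpNorm_map_measure hφ.continuous.aestronglyMeasurable
      S.continuous_proj.measurable.aemeasurable]
    have h2 : eLpNorm (φ ∘ S.proj) q (volume.restrict Q) = eLpNorm w q (volume.restrict Q) := by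
      refine eLpNorm_congr_ae ?_
      filter_upwards [ae_restrict_mem hQm] with z hz
      simp [hw, hQ z hz]
    rw [h2]
    exact eLpNorm_restrict_le _ _ _ _
  have h2 : eLpNorm w 2 volume ≤ ENNReal.ofReal B * ((N : ℝ≥0∞) ^ (1 / 2 : ℝ) * (1 + d))
      * ENNReal.ofReal ‖hφ.toH1‖ := by
    refine hbound w ((subset_tsupport w).trans hwK) fun z => ?_
    rw [norm_mul]
    refine mul_le_mul (hB z).1 ?_ (norm_nonneg _) hB0
    have := hg0 (S.proj z)
    simp only [hg, Real.norm_eq_abs]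
    linarith
  have h3 : eLpNorm (fderiv ℝ w) 2 volume ≤ ENNReal.ofReal B * ((N : ℝ≥0∞) ^ (1 / 2 : ℝ) * (1 + d))
      * ENNReal.ofReal ‖hφ.toH1‖ := by
    refine hbound (fderiv ℝ w) ((support_fderiv_subset ℝ).trans hwK) fun z => ?_
    have h4 : fderiv ℝ w z = χ z • fderiv ℝ (φ ∘ S.proj) z + φ (S.proj z) • fderiv ℝ χ z :=
      fderiv_mul ((hχ.differentiable (by simp)) z) ((hφ.smooth.differentiable (by simp)) z)
    have h5 : ‖fderiv ℝ (φ ∘ S.proj) z‖ ≤ ∑ i, |partialDeriv i φ (S.proj z)| := by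
      refine (norm_le_sum_apply_single _).trans (le_of_eq ?_)
      refine Finset.sum_congr rfl fun i _ => ?_
      rw [partialDeriv_proj hφ]
    rw [h4]
    refine (norm_add_le _ _).trans ?_
    rw [norm_smul, norm_smul]
    have h6 : ‖χ z‖ * ‖fderiv ℝ (φ ∘ S.proj) z‖ ≤ B * ∑ i, |partialDeriv i φ (S.proj z)| :=
      mul_le_mul (hB z).1 h5 (norm_nonneg _) hB0
    have h7 : ‖φ (S.proj z)‖ * ‖fderiv ℝ χ z‖ ≤ |φ (S.proj z)| * B :=
      mul_le_mul_of_nonneg_left (hB z).2 (norm_nonneg _)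
    simp only [hg, mul_add]
    linarith
  calc eLpNorm φ q volume ≤ eLpNorm w q volume := h1
    _ ≤ C * (eLpNorm w 2 volume + eLpNorm (fderiv ℝ w) 2 volume) :=
        h w (hwsm.of_le (by simp)) (hcs φ hφ.compactSupport)
    _ ≤ C * (_ + _) := mul_le_mul_right (add_le_add h2 h3) _
    _ = _ := by ring

/-! ### Multiplication operators -/

/-- Bounded measurable functions. -/
def IsBddMeas (g : S.Pt d → ℝ) : Prop :=
  AEStronglyMeasurable g volume ∧ ∃ C, ∀ x, |g x| ≤ C

lemma IsBddMeas.memLp_mul {g : S.Pt d → ℝ} (hg : IsBddMeas g) (u : LTwo S d) :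
    MemLp (fun x => g x * u x) 2 volume := by
  obtain ⟨C, hC⟩ := hg.2
  exact (Lp.memLp u).bdd_mul' hg.1 hC

lemma norm_toLp_mul_le {g : S.Pt d → ℝ} {u : LTwo S d}
    (h : MemLp (fun x => g x * u x) 2 volume) {C : ℝ} (hC : ∀ x, |g x| ≤ C) :
    ‖h.toLp _‖ ≤ C * ‖u‖ := by
  have hC0 : 0 ≤ C := (abs_nonneg _).trans (hC 0)
  rw [Lp.norm_toLp]
  have h1 := eLpNorm_le_mul_eLpNorm_of_ae_le_mul (μ := volume) (f := fun x => g x * u x)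
    (g := u) (c := C) (Eventually.of_forall fun x => by
      rw [norm_mul]; exact mul_le_mul_of_nonneg_right (hC x) (norm_nonneg _)) 2
  refine (ENNReal.toReal_mono (ENNReal.mul_ne_top ENNReal.ofReal_ne_top (Lp.memLp u).2.ne)
    h1).trans ?_
  rw [ENNReal.toReal_mul, ENNReal.toReal_ofReal hC0, Lp.norm_def]

/-- Multiplication by a bounded function on `L²`. -/
def IsBddMeas.mulL {g : S.Pt d → ℝ} (hg : IsBddMeas g) : LTwo S d →L[ℝ] LTwo S d :=
  LinearMap.mkContinuous
    { toFun := fun u => (hg.memLp_mul u).toLp _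
      map_add' := fun u v => by
        rw [← MemLp.toLp_add]
        refine MemLp.toLp_congr _ _ ?_
        filter_upwards [Lp.coeFn_add u v] with x hx
        change g x * (u + v : LTwo S d) x = g x * u x + g x * v x
        rw [hx, Pi.add_apply, mul_add]
      map_smul' := fun c u => by
        rw [RingHom.id_apply, ← MemLp.toLp_const_smul]
        refine MemLp.toLp_congr _ _ ?_
        filter_upwards [Lp.coeFn_smul c u] with x hx
        change g x * (c • u : LTwo S d) x = c * (g x * u x)
        rw [hx, Pi.smul_apply, smul_eq_mul]
        ring } hg.2.choose fun u => norm_toLp_mul_le (hg.memLp_mul u) hg.2.choose_spec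

lemma IsBddMeas.mulL_apply {g : S.Pt d → ℝ} (hg : IsBddMeas g) (u : LTwo S d) :
    hg.mulL u = (hg.memLp_mul u).toLp _ := rfl

lemma IsBddMeas.norm_mulL_le {g : S.Pt d → ℝ} (hg : IsBddMeas g) (u : LTwo S d) {C : ℝ}
    (hC : ∀ x, |g x| ≤ C) : ‖hg.mulL u‖ ≤ C * ‖u‖ :=
  norm_toLp_mul_le (hg.memLp_mul u) hC

lemma IsBddMeas.inner_mulL {g : S.Pt d → ℝ} (hg : IsBddMeas g) (u v : LTwo S d) :
    inner ℝ (hg.mulL u) v = ∫ x, g x * u x * v x := by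
  rw [← integral_mul_eq_inner']
  refine integral_congr_ae ?_
  filter_upwards [(hg.memLp_mul u).coeFn_toLp] with x hx
  rw [hg.mulL_apply, hx]

lemma IsBddMeas.inner_mulL_comm {g : S.Pt d → ℝ} (hg : IsBddMeas g) (u v : LTwo S d) :
    inner ℝ (hg.mulL u) v = inner ℝ u (hg.mulL v) := by
  rw [hg.inner_mulL, real_inner_comm, hg.inner_mulL]
  congr 1
  funext x
  ring

lemma IsBddMeas.mulL_add {g h : S.Pt d → ℝ} (hg : IsBddMeas g) (hh : IsBddMeas h)
    (hgh : IsBddMeas fun x => g x + h x) (u : LTwo S d) :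
    hgh.mulL u = hg.mulL u + hh.mulL u := by
  rw [hg.mulL_apply, hh.mulL_apply, hgh.mulL_apply, ← MemLp.toLp_add]
  refine MemLp.toLp_congr _ _ (Eventually.of_forall fun x => ?_)
  simp [add_mul]

lemma IsBddMeas.add {g h : S.Pt d → ℝ} (hg : IsBddMeas g) (hh : IsBddMeas h) :
    IsBddMeas fun x => g x + h x := by
  obtain ⟨C, hC⟩ := hg.2
  obtain ⟨D, hD⟩ := hh.2
  exact ⟨hg.1.add hh.1, C + D, fun x => (abs_add_le _ _).trans (add_le_add (hC x) (hD x))⟩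

lemma IsBddMeas.sum {ι : Type*} {s : Finset ι} {g : ι → S.Pt d → ℝ}
    (hg : ∀ i, IsBddMeas (g i)) : IsBddMeas fun x => ∑ i ∈ s, g i x := by
  choose C hC using fun i => (hg i).2
  refine ⟨Finset.aestronglyMeasurable_fun_sum s fun i _ => (hg i).1, ∑ i ∈ s, C i, fun x => ?_⟩
  exact (Finset.abs_sum_le_sum_abs _ _).trans (Finset.sum_le_sum fun i _ => hC i x)

lemma IsBddMeas.integrable_mul {g : S.Pt d → ℝ} (hg : IsBddMeas g) (u v : LTwo S d) :
    Integrable fun x => g x * u x * v x :=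
  (hg.memLp_mul u).integrable_mul (Lp.memLp v)

lemma isBddMeas_kernelConv {κ : EuclideanSpace ℝ (Fin d) → ℝ} (hκ : ContDiff ℝ ∞ κ)
    (hκs : HasCompactSupport κ) {p : ℝ≥0∞} (hp : 1 ≤ p) {f : S.Pt d → ℝ}
    (hf : MemLp f p volume) : IsBddMeas (kernelConv κ f) :=
  ⟨(continuous_kernelConv hκ hκs hp hf).aestronglyMeasurable,
    exists_abs_kernelConv_le hκ.continuous hκs hp hf⟩

/-- The bilinear form `(u, v) ↦ ⟨X u, Y v⟩` on `H¹`. -/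
def pairing (X Y : SobolevH1 S d →L[ℝ] LTwo S d) : SobolevH1 S d →L[ℝ] SobolevHm1 S d :=
  ((ContinuousLinearMap.compL ℝ (SobolevH1 S d) (LTwo S d) ℝ).flip Y).comp
    ((innerSL ℝ : LTwo S d →L[ℝ] LTwo S d →L[ℝ] ℝ).comp X)

lemma pairing_apply (X Y : SobolevH1 S d →L[ℝ] LTwo S d) (u v : SobolevH1 S d) :
    pairing X Y u v = inner ℝ (X u) (Y v) := rfl

lemma H1ToHm1_apply (u v : SobolevH1 S d) :
    H1ToHm1 S d u v = inner ℝ (H1ToLTwo S d u) (H1ToLTwo S d v) := rfl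

/-- The operator `Δ + β · ∇ : H¹ → H⁻¹` for a bounded drift `β`. -/
def driftOp {β : Fin d → S.Pt d → ℝ} (hβ : ∀ j, IsBddMeas (β j)) :
    SobolevH1 S d →L[ℝ] SobolevHm1 S d :=
  -(∑ j, pairing (SobolevH1.partialL j) (SobolevH1.partialL j))
    + ∑ j, pairing ((hβ j).mulL.comp (SobolevH1.partialL j)) (H1ToLTwo S d)

lemma driftOp_apply {β : Fin d → S.Pt d → ℝ} (hβ : ∀ j, IsBddMeas (β j)) (u v : SobolevH1 S d) :
    driftOp hβ u v = -(∑ j, inner ℝ (u.partial j) (v.partial j))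
      + ∑ j, inner ℝ ((hβ j).mulL (u.partial j)) (H1ToLTwo S d v) := by
  simp [driftOp, pairing_apply]

lemma isLaplacianPlusDrift_driftOp {β : Fin d → S.Pt d → ℝ} (hβ : ∀ j, IsBddMeas (β j)) :
    IsLaplacianPlusDrift (fun x j => β j x) (driftOp hβ) := by
  intro u v
  have h1 : ∀ j, Integrable fun x => β j x * u.partial j x * H1ToLTwo S d v x := fun j =>
    (hβ j).integrable_mul _ _
  simp only [Finset.sum_mul]
  refine ⟨integrable_finsetSum _ fun j _ => h1 j, ?_⟩
  rw [integral_finsetSum _ fun j _ => h1 j, driftOp_apply]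
  simp only [integral_mul_eq_inner', IsBddMeas.inner_mulL]

/-! ### The antisymmetric part -/

lemma partialDeriv_comm {φ : S.Pt d → ℝ} (h : IsTestFunction φ) (i j : Fin d) (x : S.Pt d) :
    partialDeriv i (partialDeriv j φ) x = partialDeriv j (partialDeriv i φ) x := by
  obtain ⟨y, rfl⟩ := S.isOpenQuotientMap_proj.surjective x
  have hkey : ∀ i j : Fin d, partialDeriv i (partialDeriv j φ) (S.proj y)
      = fderiv ℝ (fderiv ℝ (φ ∘ S.proj)) y (EuclideanSpace.single i 1)
        (EuclideanSpace.single j 1) := by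
    intro i j
    rw [partialDeriv_proj (h.pderiv j)]
    have h1 : partialDeriv j φ ∘ S.proj
        = fun y => fderiv ℝ (φ ∘ S.proj) y (EuclideanSpace.single j 1) :=
      funext fun y => partialDeriv_proj h j y
    have h2 : DifferentiableAt ℝ (fderiv ℝ (φ ∘ S.proj)) y :=
      ((h.smooth.fderiv_right (m := ∞) (by simp)).differentiable (by simp)).differentiableAt
    rw [h1, fderiv_clm_apply h2 (by fun_prop)]
    simp
  rw [hkey, hkey]
  exact ((contDiff_infty.1 h.smooth 2).contDiffAt.isSymmSndFDerivAt (by simp)).eq _ _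

lemma sum_eq_zero_of_antisymm {X : Fin d → Fin d → ℝ} (h : ∀ i j, X i j = -X j i) :
    ∑ i, ∑ j, X i j = 0 := by
  have h1 : ∑ i, ∑ j, X i j = -∑ i, ∑ j, X i j := by
    conv_lhs => rw [Finset.sum_comm]
    rw [← Finset.sum_neg_distrib]
    refine Finset.sum_congr rfl fun j _ => ?_
    rw [← Finset.sum_neg_distrib]
    exact Finset.sum_congr rfl fun i _ => h i j
  linarith

/-- The quadratic form of an antisymmetric matrix vanishes pointwise. This is why no bound on `A`
enters the coercivity constant. -/
lemma sum_inner_mulL_antisymm {a : Fin d → Fin d → S.Pt d → ℝ}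
    (ha : ∀ i j, IsBddMeas (a i j)) (hanti : ∀ i j x, a i j x = -a j i x)
    (X : Fin d → LTwo S d) : ∑ i, ∑ j, inner ℝ ((ha i j).mulL (X j)) (X i) = 0 := by
  refine sum_eq_zero_of_antisymm fun i j => ?_
  rw [IsBddMeas.inner_mulL, IsBddMeas.inner_mulL, ← integral_neg]
  congr 1
  funext x
  rw [hanti i j]
  ring

/-- For antisymmetric `a`, the drift `∂ᵢ aᵢⱼ` acts as the divergence form operator `∇·(a·∇)`. -/
lemma sum_inner_mulL_partialDeriv {a : Fin d → Fin d → S.Pt d → ℝ}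
    (hsm : ∀ i j, ContDiff ℝ ∞ (a i j ∘ S.proj)) (ha : ∀ i j, IsBddMeas (a i j))
    (hda : ∀ i j, IsBddMeas (partialDeriv i (a i j))) (hanti : ∀ i j x, a i j x = -a j i x)
    (u v : SobolevH1 S d) :
    ∑ i, ∑ j, inner ℝ ((hda i j).mulL (u.partial j)) (H1ToLTwo S d v)
      = -∑ i, ∑ j, inner ℝ ((ha i j).mulL (u.partial j)) (v.partial i) := by
  -- Both sides are continuous in `v` because the coefficients and their derivatives are bounded, so
  -- `v` may be a test function.
  refine denseRange_toH1.induction_on (p := fun v =>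
    ∑ i, ∑ j, inner ℝ ((hda i j).mulL (u.partial j)) (H1ToLTwo S d v)
      = -∑ i, ∑ j, inner ℝ ((ha i j).mulL (u.partial j)) (v.partial i)) v ?_ ?_
  · refine isClosed_eq ?_ ?_
    · exact continuous_finsetSum _ fun i _ => continuous_finsetSum _ fun j _ =>
        continuous_const.inner (H1ToLTwo S d).continuous
    · exact (continuous_finsetSum _ fun i _ => continuous_finsetSum _ fun j _ =>
        continuous_const.inner (SobolevH1.partialL i).continuous).neg
  · rintro ⟨φ, hφ⟩
    have hψ : ∀ i j, IsTestFunction fun x => a i j x * φ x := fun i j =>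
      IsTestFunction.smooth_mul (hsm i j) hφ
    -- Moving `∂ⱼ` off `u` gives `X i j = -∫ u ∂ⱼ∂ᵢ(aᵢⱼ φ)`. The second derivatives are symmetric
    -- and `a` is antisymmetric, so `X` is antisymmetric and its entries sum to zero; the product
    -- rule for `∂ᵢ(aᵢⱼ φ)` then splits the sum into the two sides. No second derivative of `u` is
    -- required.
    set X : Fin d → Fin d → ℝ := fun i j =>
      ∫ x, u.partial j x * partialDeriv i (fun y => a i j y * φ y) x with hX
    have hX' : ∀ i j, X i j
        = -∫ x, H1ToLTwo S d u x * partialDeriv j (partialDeriv i fun y => a i j y * φ y) x := by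
      intro i j
      have h1 := u.hasWeakPartial j _ ((hψ i j).pderiv i)
      rw [h1, neg_neg]
    have hXanti : ∀ i j, X i j = -X j i := by
      intro i j
      rw [hX', hX', neg_neg, ← integral_neg]
      congr 1
      funext x
      have h1 : (fun y => a j i y * φ y) = fun y => -(a i j y * φ y) := by
        funext y
        rw [hanti j i, neg_mul]
      have h2 : partialDeriv j (fun y => -(a i j y * φ y))
          = fun x => -partialDeriv j (fun y => a i j y * φ y) x :=
        funext fun x => partialDeriv_neg _ j x
      rw [h1, h2, partialDeriv_neg, partialDeriv_comm (hψ i j), mul_neg]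
    have hterm : ∀ i j, inner ℝ ((hda i j).mulL (u.partial j)) (H1ToLTwo S d hφ.toH1)
        = X i j - inner ℝ ((ha i j).mulL (u.partial j)) (hφ.toH1.partial i) := by
      intro i j
      have h1 : inner ℝ ((hda i j).mulL (u.partial j)) (H1ToLTwo S d hφ.toH1)
          = ∫ x, u.partial j x * (partialDeriv i (a i j) x * φ x) := by
        rw [IsBddMeas.inner_mulL]
        refine integral_congr_ae ?_
        filter_upwards [hφ.memLp.coeFn_toLp] with x hx
        rw [hφ.H1ToLTwo_toH1, hx]
        ring
      have h2 : inner ℝ ((ha i j).mulL (u.partial j)) (hφ.toH1.partial i)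
          = ∫ x, u.partial j x * (a i j x * partialDeriv i φ x) := by
        rw [IsBddMeas.inner_mulL]
        refine integral_congr_ae ?_
        filter_upwards [(hφ.memLp_partialDeriv i).coeFn_toLp] with x hx
        rw [hφ.partial_toH1, hx]
        ring
      have h3 : X i j = (∫ x, u.partial j x * (partialDeriv i (a i j) x * φ x))
          + ∫ x, u.partial j x * (a i j x * partialDeriv i φ x) := by
        rw [← integral_add
          (integrable_Lp_mul _ (IsTestFunction.smooth_mul (contDiff_partialDeriv (hsm i j) i)
            hφ).memLp)
          (integrable_Lp_mul _ (IsTestFunction.smooth_mul (hsm i j) (hφ.pderiv i)).memLp)]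
        simp only [hX, partialDeriv_mul (hsm i j) hφ.smooth, mul_add]
      rw [h1, h2, h3]
      ring
    simp only [hterm, Finset.sum_sub_distrib, sum_eq_zero_of_antisymm hXanti, zero_sub]

/-! ### Splitting of the drift `b₂` -/

/-- A function in `Lʳ` is the sum of a bounded function and one that is small in `Lˢ`. -/
lemma exists_bdd_add_small {r s : ℝ≥0∞} (hs : 1 ≤ s) (hsr : s ≤ r)
    {f : S.Pt d → ℝ} (hf : MemLp f r volume) {ε : ℝ} (hε : 0 < ε) :
    ∃ (M : ℝ) (g h : S.Pt d → ℝ), 0 ≤ M ∧ AEStronglyMeasurable g volume ∧ (∀ x, |g x| ≤ M) ∧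
      MemLp h s volume ∧ eLpNorm h s volume ≤ ENNReal.ofReal ε ∧
      f =ᵐ[volume] fun x => g x + h x := by
  have hae := hf.1.ae_eq_mk
  have hf' : MemLp (hf.1.mk f) r volume := hf.ae_eq hae
  have hfm : StronglyMeasurable (hf.1.mk f) := hf.1.stronglyMeasurable_mk
  set F := hf.1.mk f
  have hFm : Measurable fun x => |F x| := hfm.measurable.abs
  rcases eq_or_ne r ⊤ with rfl | hr
  -- For `r = ∞` the small part is zero; truncation at the essential supremum turns the almost
  -- everywhere bound into a pointwise one.
  · set M := (eLpNormEssSup F volume).toReal with hM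
    have hle : ∀ᵐ x, |F x| ≤ M := by
      have h1 := ae_le_eLpNormEssSup (f := F) (μ := (volume : Measure (S.Pt d)))
      have h2 : eLpNormEssSup F volume ≠ ⊤ := by
        have := hf'.2
        rw [eLpNorm_exponent_top] at this
        exact this.ne
      filter_upwards [h1] with x hx
      have h3 := ENNReal.toReal_mono h2 hx
      simpa using h3
    have hset : MeasurableSet {x | |F x| ≤ M} := measurableSet_le hFm measurable_const
    refine ⟨M, {x | |F x| ≤ M}.indicator F, 0, ENNReal.toReal_nonneg,
      (hfm.indicator hset).aestronglyMeasurable, fun x => ?_, MemLp.zero, by simp, ?_⟩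
    · by_cases hx : x ∈ {x | |F x| ≤ M}
      · rw [Set.indicator_of_mem hx]
        exact hx
      · rw [Set.indicator_of_notMem hx, abs_zero]
        exact ENNReal.toReal_nonneg
    · filter_upwards [hae, hle] with x hx hx'
      rw [Set.indicator_of_mem (show x ∈ {x | |F x| ≤ M} from hx')]
      simpa using hx
  · have hr0 : r ≠ 0 := (one_pos.trans_le (hs.trans hsr)).ne'
    -- For `r < ∞` this set has finite measure, so on it `Lʳ` is contained in `Lˢ`.
    set T : Set (S.Pt d) := {x | 1 ≤ |F x|} with hT
    have hTm : MeasurableSet T := measurableSet_le measurable_const hFm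
    have hTfin : volume T ≠ ⊤ := by
      have h1 := hf'.meas_ge_lt_top hr0 hr (ε := 1) one_ne_zero
      refine (lt_of_le_of_lt (measure_mono fun x hx => ?_) h1).ne
      exact_mod_cast (show (1 : ℝ) ≤ ‖F x‖ from hx)
    set f₁ := T.indicator F with hf₁
    have hf₁m : StronglyMeasurable f₁ := hfm.indicator hTm
    have hf₁s : MemLp f₁ s volume :=
      (hf'.indicator hTm).mono_exponent_of_measure_support_ne_top
        (fun x hx => Set.indicator_of_notMem hx _) hTfin hsr
    -- The small part `h` is `F` restricted to its largest values, where the `Lˢ` norm is at most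
    -- `ε`. The remainder is below `1` off `T` and below `M` on `T` off `D`, whence the bound `max 1
    -- M`.
    obtain ⟨M, hM0, hM⟩ := hf₁s.eLpNorm_indicator_norm_ge_pos_le hf₁m hε
    set D : Set (S.Pt d) := {x | M ≤ ‖f₁ x‖₊} with hD
    have hDm : MeasurableSet D := measurableSet_le measurable_const hf₁m.measurable.norm
    refine ⟨max 1 M, fun x => F x - D.indicator f₁ x, D.indicator f₁, by positivity,
      (hfm.sub (hf₁m.indicator hDm)).aestronglyMeasurable, fun x => ?_,
      hf₁s.indicator hDm, hM, ?_⟩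
    · change |F x - D.indicator f₁ x| ≤ max 1 M
      by_cases hxT : x ∈ T
      · have h1 : f₁ x = F x := Set.indicator_of_mem hxT _
        by_cases hxD : x ∈ D
        · rw [Set.indicator_of_mem hxD, h1, sub_self, abs_zero]
          positivity
        · rw [Set.indicator_of_notMem hxD, sub_zero]
          refine le_max_of_le_right ?_
          have h2 : ¬ M ≤ ‖f₁ x‖ := hxD
          rw [h1, Real.norm_eq_abs] at h2
          exact (not_le.1 h2).le
      · have h1 : f₁ x = 0 := Set.indicator_of_notMem hxT _
        have h2 : D.indicator f₁ x = 0 := by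
          by_cases hxD : x ∈ D
          · rw [Set.indicator_of_mem hxD, h1]
          · rw [Set.indicator_of_notMem hxD]
        rw [h2, sub_zero]
        exact le_max_of_le_left (not_le.1 hxT).le
    · filter_upwards [hae] with x hx
      rw [hx]
      ring

/-! ### Uniform bounds and convergence of the mollified coefficients -/

lemma IsMollifier.abs_kernelConv_le {ρ : EuclideanSpace ℝ (Fin d) → ℝ} (hρ : IsMollifier ρ)
    {g : S.Pt d → ℝ} {M : ℝ} (hg : ∀ x, |g x| ≤ M) (x : S.Pt d) : |kernelConv ρ g x| ≤ M := by
  have hint : Integrable ρ :=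
    hρ.smooth.continuous.integrable_of_hasCompactSupport hρ.compactSupport
  have h1 : |kernelConv ρ g x| ≤ ∫ z, ρ z * M := by
    rw [← Real.norm_eq_abs]
    refine norm_integral_le_of_norm_le (hint.mul_const M) (Eventually.of_forall fun z => ?_)
    rw [norm_mul, Real.norm_of_nonneg (hρ.nonneg z)]
    exact mul_le_mul_of_nonneg_left (hg _) (hρ.nonneg z)
  rwa [integral_mul_const, hρ.integral_eq_one, one_mul] at h1

/-- Mollifications of an `Lʳ` function are form bounded by the Laplacian, with arbitrarily small
relative bound, uniformly in the mollification parameter. -/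
lemma exists_norm_mulL_kernelConv_le (hd : 2 ≤ d) {r : ℝ≥0∞}
    (hr : (d : ℝ≥0∞) < r ∨ (3 ≤ d ∧ r = d)) {ρ : EuclideanSpace ℝ (Fin d) → ℝ}
    (hρ : IsMollifier ρ) {f : S.Pt d → ℝ} (hf : MemLp f r volume) {δ : ℝ} (hδ : 0 < δ) :
    ∃ M : ℝ, 0 ≤ M ∧ ∀ (n : ℕ+) (h : IsBddMeas (kernelConv (scaledMollifier ρ n) f))
      (v : SobolevH1 S d),
      ‖h.mulL (H1ToLTwo S d v)‖ ≤ M * ‖H1ToLTwo S d v‖ + δ * ‖v‖ := by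
  obtain ⟨s, q, hs, hs', hsr, hsq, C, hC, hsob⟩ := exists_sobolev_exponents hd hr
  obtain ⟨C', hC', hemb⟩ := exists_sobolev_embedding S hC hsob
  -- The embedding costs a factor `C'`, so this size for the `Lˢ` norm of the small part leaves at
  -- most `δ`; the `+ 1` covers `C' = 0`. The splitting is made before `n` is chosen, which gives
  -- uniformity.
  have hε : 0 < δ / (C'.toReal + 1) := by positivity
  obtain ⟨M, g, h, hM, hgm, hgM, hh, hhε, hfgh⟩ := exists_bdd_add_small hs hsr hf hε
  refine ⟨M, hM, fun n hn v => ?_⟩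
  have hm := hρ.scaled n
  have hg : MemLp g ⊤ volume := memLp_top_of_bound hgm M (Eventually.of_forall hgM)
  have hgb := isBddMeas_kernelConv hm.smooth hm.compactSupport (by simp) hg
  have hhb := isBddMeas_kernelConv hm.smooth hm.compactSupport hs hh
  have hsplit : kernelConv (scaledMollifier ρ n) f
      = fun x => kernelConv (scaledMollifier ρ n) g x + kernelConv (scaledMollifier ρ n) h x := by
    rw [kernelConv_congr_ae _ hfgh]
    funext x
    exact kernelConv_add hm.smooth.continuous hm.compactSupport (by simp) hs hg hh x
  have hmul : hn.mulL (H1ToLTwo S d v)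
      = hgb.mulL (H1ToLTwo S d v) + hhb.mulL (H1ToLTwo S d v) := by
    rw [← IsBddMeas.mulL_add hgb hhb (hgb.add hhb)]
    simp only [IsBddMeas.mulL_apply, hsplit]
  have hsmall : ‖hhb.mulL (H1ToLTwo S d v)‖ ≤ δ * ‖v‖ := by
    -- For fixed `n` the multiplier is bounded, so both sides are continuous in `v`; for a test
    -- function Hölder with exponents `s`, `q` and the embedding apply.
    refine denseRange_toH1.induction_on
      (p := fun v => ‖hhb.mulL (H1ToLTwo S d v)‖ ≤ δ * ‖v‖) v ?_ ?_
    · exact isClosed_le ((hhb.mulL.continuous.comp (H1ToLTwo S d).continuous).norm)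
        (continuous_const.mul continuous_norm)
    · rintro ⟨φ, hφ⟩
      have h1 : eLpNorm (fun x => kernelConv (scaledMollifier ρ n) h x * φ x) 2 volume
          ≤ ENNReal.ofReal (δ / (C'.toReal + 1)) * (C' * ENNReal.ofReal ‖hφ.toH1‖) := by
        have h2 := eLpNorm_smul_le_mul_eLpNorm (p := s) (q := q) (r := 2)
          (f := φ) (φ := kernelConv (scaledMollifier ρ n) h) (μ := volume)
          hφ.continuous.aestronglyMeasurable hhb.1
        refine h2.trans (mul_le_mul' ?_ (hemb φ hφ))
        exact (hm.eLpNorm_kernelConv_le hs hs' hh.1).trans hhε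
      have h2 : hhb.mulL (H1ToLTwo S d hφ.toH1) = (hφ.memLp.bdd_mul' hhb.1 hhb.2.choose_spec).toLp
          (fun x => kernelConv (scaledMollifier ρ n) h x * φ x) := by
        rw [hhb.mulL_apply]
        refine MemLp.toLp_congr _ _ ?_
        filter_upwards [hφ.memLp.coeFn_toLp] with x hx
        rw [hφ.H1ToLTwo_toH1, hx]
      have h3 : δ / (C'.toReal + 1) * C'.toReal ≤ δ := by
        rw [div_mul_eq_mul_div, div_le_iff₀ (by positivity)]
        nlinarith [ENNReal.toReal_nonneg (a := C')]
      change ‖hhb.mulL (H1ToLTwo S d hφ.toH1)‖ ≤ δ * ‖hφ.toH1‖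
      rw [h2, Lp.norm_toLp]
      refine (ENNReal.toReal_mono (by finiteness) h1).trans ?_
      rw [ENNReal.toReal_mul, ENNReal.toReal_mul, ENNReal.toReal_ofReal hε.le,
        ENNReal.toReal_ofReal (norm_nonneg _), ← mul_assoc]
      exact mul_le_mul_of_nonneg_right h3 (norm_nonneg _)
  rw [hmul]
  exact (norm_add_le _ _).trans (add_le_add (hgb.norm_mulL_le _ (hm.abs_kernelConv_le hgM)) hsmall)

/-- Functions in `Lᵖ`, `p ≥ 2`, are locally square integrable. -/
lemma MeasureTheory.MemLp.indicator_two {p : ℝ≥0∞} (hp : 2 ≤ p) {f : S.Pt d → ℝ}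
    (hf : MemLp f p volume) {K : Set (S.Pt d)} (hK : IsCompact K) :
    MemLp (K.indicator f) 2 volume :=
  (hf.indicator hK.measurableSet).mono_exponent_of_measure_support_ne_top
    (fun _ hx => Set.indicator_of_notMem hx _) hK.measure_lt_top.ne hp

lemma IsTestFunction.memLp_mul_of_le {p : ℝ≥0∞} (hp : 2 ≤ p) {f φ : S.Pt d → ℝ}
    (hf : MemLp f p volume) (hφ : IsTestFunction φ) :
    MemLp (fun x => f x * φ x) 2 volume := by
  refine (hφ.memLp_mul (hf.indicator_two hp hφ.compactSupport.isCompact)).ae_eq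
    (Eventually.of_forall fun x => ?_)
  by_cases hx : x ∈ tsupport φ
  · simp only [Set.indicator_of_mem hx]
    ring
  · simp [image_eq_zero_of_notMem_tsupport hx]

/-- Mollified coefficients, multiplied by a test function, converge in `L²`. -/
lemma tendsto_mulL_kernelConv_test {p : ℝ≥0∞} (hp : 2 ≤ p) {f φ : S.Pt d → ℝ}
    (hf : MemLp f p volume) (hφ : IsTestFunction φ) {ρ : EuclideanSpace ℝ (Fin d) → ℝ}
    (hρ : IsMollifier ρ) (hb : ∀ n, IsBddMeas (kernelConv (scaledMollifier ρ n) f)) :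
    Tendsto (fun n => (hb n).mulL (hφ.memLp.toLp φ)) atTop
      (𝓝 ((hφ.memLp_mul_of_le hp hf).toLp _)) := by
  have hmem : ∀ n, MemLp (fun x => kernelConv (scaledMollifier ρ n) f x * φ x) 2 volume :=
    fun n => hφ.memLp.bdd_mul' (hb n).1 (hb n).2.choose_spec
  have heq : ∀ n, (hb n).mulL (hφ.memLp.toLp φ) = (hmem n).toLp _ := by
    intro n
    rw [(hb n).mulL_apply]
    refine MemLp.toLp_congr _ _ ?_
    filter_upwards [hφ.memLp.coeFn_toLp] with x hx
    rw [hx]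
  simp_rw [heq]
  refine (Lp.tendsto_Lp_iff_tendsto_eLpNorm'' _ hmem _ _).2 ?_
  obtain ⟨R, hR, hsupp⟩ := hρ.exists_radius
  obtain ⟨C, hC⟩ := hφ.exists_bound
  -- All rescaled mollifiers live in the ball of radius `R`, so on the support of `φ` the
  -- mollification of `f` only sees `f` on the compact set `K`, where `f` is square integrable;
  -- global convergence in `L²` applies to that restriction.
  set K : Set (S.Pt d) := (fun q : S.Pt d × EuclideanSpace ℝ (Fin d) => q.1 - S.proj q.2) ''
    (tsupport φ ×ˢ Metric.closedBall 0 R) with hK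
  have hKc : IsCompact K := (hφ.compactSupport.isCompact.prod (isCompact_closedBall _ _)).image
    (continuous_fst.sub (S.continuous_proj.comp continuous_snd))
  have hlim := hρ.tendsto_eLpNorm_kernelConv_sub (hf.indicator_two hp hKc)
  have hlim' := ENNReal.Tendsto.const_mul (a := ENNReal.ofReal C) hlim
    (Or.inr ENNReal.ofReal_ne_top)
  rw [mul_zero] at hlim'
  refine tendsto_of_tendsto_of_tendsto_of_le_of_le tendsto_const_nhds hlim'
    (fun _ => zero_le) fun n => ?_
  refine eLpNorm_le_mul_eLpNorm_of_ae_le_mul (Eventually.of_forall fun x => ?_) 2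
  rw [Pi.sub_apply, ← sub_mul, norm_mul, mul_comm]
  by_cases hx : x ∈ tsupport φ
  · have h1 : K.indicator f x = f x :=
      Set.indicator_of_mem (show x ∈ K from ⟨(x, 0), ⟨hx, Metric.mem_closedBall_self hR.le⟩, by
        simp [BaseSpace.proj_zero]⟩) _
    have h2 : kernelConv (scaledMollifier ρ n) (K.indicator f) x
        = kernelConv (scaledMollifier ρ n) f x := by
      unfold kernelConv
      congr 1
      funext z
      rcases eq_or_ne (scaledMollifier ρ n z) 0 with h0 | h0
      · rw [h0, zero_mul, zero_mul]
      · have hn1 : (1 : ℝ) ≤ n := by exact_mod_cast Nat.succ_le_of_lt n.pos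
        have hz : ‖z‖ ≤ R := (hsupp n z h0).trans (div_le_self hR.le hn1)
        rw [Set.indicator_of_mem (show x - S.proj z ∈ K from
          ⟨(x, z), ⟨hx, mem_closedBall_zero_iff.2 hz⟩, rfl⟩)]
    rw [h1, h2]
    exact mul_le_mul_of_nonneg_right (hC x) (norm_nonneg _)
  · rw [image_eq_zero_of_notMem_tsupport hx, norm_zero, zero_mul]
    exact mul_nonneg ((abs_nonneg _).trans (hC x)) (norm_nonneg _)

/-- Used with the weakly convergent gradients on one side and the strongly convergent products of
coefficients and test functions on the other. -/
lemma tendsto_inner_of_weak_of_strong {H : Type*} [NormedAddCommGroup H] [InnerProductSpace ℝ H]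
    {X Y : ℕ → H} {x y : H} {C : ℝ} (hX : ∀ z, Tendsto (fun m => inner ℝ (X m) z) atTop
      (𝓝 (inner ℝ x z))) (hC : ∀ m, ‖X m‖ ≤ C) (hY : Tendsto Y atTop (𝓝 y)) :
    Tendsto (fun m => inner ℝ (X m) (Y m)) atTop (𝓝 (inner ℝ x y)) := by
  have h1 : Tendsto (fun m => inner ℝ (X m) (Y m - y)) atTop (𝓝 0) := by
    have h2 : Tendsto (fun m => C * ‖Y m - y‖) atTop (𝓝 0) := by
      simpa using (tendsto_iff_norm_sub_tendsto_zero.1 hY).const_mul C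
    refine squeeze_zero_norm (fun m => ?_) h2
    exact (norm_inner_le_norm _ _).trans (mul_le_mul_of_nonneg_right (hC m) (norm_nonneg _))
  have h2 := h1.add (hX y)
  rw [zero_add] at h2
  refine h2.congr fun m => ?_
  rw [inner_sub_right]
  ring

/-! ### The operators `Δ + β · ∇` -/

lemma neg_add_sum_eq_of_sum_sum_eq {ι : Type*} [Fintype ι] {T Z : ι → ℝ} {X : ι → ι → ℝ} {W : ℝ}
    (hT : ∀ j, T j = (∑ i, X i j) + Z j) (hX : ∑ i, ∑ j, X i j = -W) (E : ℝ) :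
    -E + ∑ j, T j = -E - W + ∑ j, Z j := by
  simp only [hT]
  rw [Finset.sum_add_distrib, Finset.sum_comm, hX]
  ring

/-- For `βⱼ = ∑ᵢ ∂ᵢ aᵢⱼ + bⱼ` with antisymmetric `a`, the first part of the drift is in
divergence form. -/
lemma driftOp_eq {a : Fin d → Fin d → S.Pt d → ℝ} {b β : Fin d → S.Pt d → ℝ}
    (hsm : ∀ i j, ContDiff ℝ ∞ (a i j ∘ S.proj)) (ha : ∀ i j, IsBddMeas (a i j))
    (hda : ∀ i j, IsBddMeas (partialDeriv i (a i j))) (hanti : ∀ i j x, a i j x = -a j i x)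
    (hb : ∀ j, IsBddMeas (b j)) (hβ : ∀ j, IsBddMeas (β j))
    (heq : ∀ j x, β j x = (∑ i, partialDeriv i (a i j) x) + b j x) (u v : SobolevH1 S d) :
    driftOp hβ u v = -(∑ j, inner ℝ (u.partial j) (v.partial j))
      - (∑ i, ∑ j, inner ℝ ((ha i j).mulL (u.partial j)) (v.partial i))
      + ∑ j, inner ℝ ((hb j).mulL (u.partial j)) (H1ToLTwo S d v) := by
  have h1 : ∀ j, inner ℝ ((hβ j).mulL (u.partial j)) (H1ToLTwo S d v)
      = (∑ i, inner ℝ ((hda i j).mulL (u.partial j)) (H1ToLTwo S d v))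
        + inner ℝ ((hb j).mulL (u.partial j)) (H1ToLTwo S d v) := by
    intro j
    simp only [IsBddMeas.inner_mulL]
    rw [← integral_finsetSum _ fun i _ => (hda i j).integrable_mul _ _, ← integral_add
      (integrable_finsetSum _ fun i _ => (hda i j).integrable_mul _ _)
      ((hb j).integrable_mul _ _)]
    congr 1
    funext x
    rw [heq, add_mul, add_mul, Finset.sum_mul, Finset.sum_mul]
  exact (driftOp_apply hβ u v).trans (neg_add_sum_eq_of_sum_sum_eq h1
    (sum_inner_mulL_partialDeriv hsm ha hda hanti u v) _)

/-- Young's inequality in the form `(D + 1) G U ≤ G²/4 + (D + 1)² U²`; together with the explicit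
`G²/4` this uses half of the Dirichlet energy. -/
lemma min_mul_add_le_of_le {G U D s lam : ℝ} (hG : 0 ≤ G) (hU : 0 ≤ U)
    (hs : s ≤ D * (G * U) + 1 / 4 * (G * (U + G))) :
    min (1 / 2) (lam - (D + 1) ^ 2) * (U ^ 2 + G ^ 2) ≤ lam * U ^ 2 + G ^ 2 - s := by
  have h1 : min (1 / 2) (lam - (D + 1) ^ 2) * U ^ 2 ≤ (lam - (D + 1) ^ 2) * U ^ 2 :=
    mul_le_mul_of_nonneg_right (min_le_right _ _) (sq_nonneg _)
  have h2 : min (1 / 2) (lam - (D + 1) ^ 2) * G ^ 2 ≤ 1 / 2 * G ^ 2 :=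
    mul_le_mul_of_nonneg_right (min_le_left _ _) (sq_nonneg _)
  have h3 : D * (G * U) + 1 / 4 * (G * (U + G)) ≤ 1 / 2 * G ^ 2 + (D + 1) ^ 2 * U ^ 2 := by
    nlinarith [sq_nonneg (G / 2 - (D + 1) * U), mul_nonneg hG hU]
  linarith

/-- Coercivity of `lam - (Δ + β · ∇)` for large `lam`. -/
lemma driftOp_coercive {a : Fin d → Fin d → S.Pt d → ℝ} {b β : Fin d → S.Pt d → ℝ}
    (hsm : ∀ i j, ContDiff ℝ ∞ (a i j ∘ S.proj)) (ha : ∀ i j, IsBddMeas (a i j))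
    (hda : ∀ i j, IsBddMeas (partialDeriv i (a i j))) (hanti : ∀ i j x, a i j x = -a j i x)
    (hb : ∀ j, IsBddMeas (b j)) (hβ : ∀ j, IsBddMeas (β j))
    (heq : ∀ j x, β j x = (∑ i, partialDeriv i (a i j) x) + b j x)
    {M : ℝ} (hd : 0 < d)
    (hbM : ∀ j (v : SobolevH1 S d), ‖(hb j).mulL (H1ToLTwo S d v)‖
      ≤ M * ‖H1ToLTwo S d v‖ + 1 / (4 * d) * ‖v‖)
    (lam : ℝ) (u : SobolevH1 S d) :
    min (1 / 2) (lam - (d * M + 1) ^ 2) * ‖u‖ ^ 2 ≤ (lam • H1ToHm1 S d - driftOp hβ) u u := by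
  set G := Real.sqrt (∑ j, ‖u.partial j‖ ^ 2) with hG
  have hG0 : 0 ≤ G := Real.sqrt_nonneg _
  have hGsq : G ^ 2 = ∑ j, ‖u.partial j‖ ^ 2 :=
    Real.sq_sqrt (Finset.sum_nonneg fun j _ => by positivity)
  set U := ‖H1ToLTwo S d u‖ with hU
  have hU0 : 0 ≤ U := norm_nonneg _
  have hnorm : ‖u‖ ^ 2 = U ^ 2 + G ^ 2 := by rw [hGsq, SobolevH1.norm_sq_eq]
  have hnorm' : ‖u‖ ≤ U + G := 
    le_of_sq_le_sq (by rw [hnorm]; nlinarith [mul_nonneg hU0 hG0]) (add_nonneg hU0 hG0)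
  have hpG : ∀ j, ‖u.partial j‖ ≤ G := fun j => Real.le_sqrt_of_sq_le
    (Finset.single_le_sum (f := fun j => ‖u.partial j‖ ^ 2) (fun j _ => by positivity)
      (Finset.mem_univ j))
  have hd' : (0 : ℝ) < d := by exact_mod_cast hd
  -- The multiplier is moved from `∂ⱼu` onto `u`, where the form bound applies. The relative bound
  -- `1 / (4 * d)` is chosen so that the `d` terms add up to `1 / 4`.
  have hterm : ∀ j, inner ℝ ((hb j).mulL (u.partial j)) (H1ToLTwo S d u)
      ≤ G * (M * U + 1 / (4 * d) * (U + G)) := by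
    intro j
    rw [IsBddMeas.inner_mulL_comm]
    refine (real_inner_le_norm _ _).trans (mul_le_mul (hpG j) ?_ (norm_nonneg _) hG0)
    refine (hbM j u).trans (add_le_add le_rfl (mul_le_mul_of_nonneg_left hnorm' (by positivity)))
  have hsum : ∑ j, inner ℝ ((hb j).mulL (u.partial j)) (H1ToLTwo S d u)
      ≤ (d * M) * (G * U) + 1 / 4 * (G * (U + G)) := by
    refine (Finset.sum_le_sum fun j _ => hterm j).trans (le_of_eq ?_)
    rw [Finset.sum_const, Finset.card_univ, Fintype.card_fin, nsmul_eq_mul]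
    field_simp
  have hform : (lam • H1ToHm1 S d - driftOp hβ) u u
      = lam * U ^ 2 + G ^ 2 - ∑ j, inner ℝ ((hb j).mulL (u.partial j)) (H1ToLTwo S d u) := by
    have h1 : (lam • H1ToHm1 S d - driftOp hβ) u u = lam * H1ToHm1 S d u u - driftOp hβ u u := rfl
    rw [h1, H1ToHm1_apply, driftOp_eq hsm ha hda hanti hb hβ heq,
      sum_inner_mulL_antisymm ha hanti fun j => u.partial j, real_inner_self_eq_norm_sq, hGsq]
    simp only [real_inner_self_eq_norm_sq]
    ring
  rw [hform, hnorm]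
  exact min_mul_add_le_of_le hG0 hU0 hsum

lemma integral_coef_eq_inner {p : ℝ≥0∞} (hp : 2 ≤ p) {f φ : S.Pt d → ℝ}
    (hf : MemLp f p volume) (hφ : IsTestFunction φ) (u : LTwo S d) :
    (Integrable fun x => f x * u x * φ x) ∧
      ∫ x, f x * u x * φ x = inner ℝ u ((hφ.memLp_mul_of_le hp hf).toLp _) := by
  have h1 : (fun x => f x * u x * φ x) = fun x => u x * (f x * φ x) := by
    funext x
    ring
  rw [h1]
  exact ⟨integrable_Lp_mul u (hφ.memLp_mul_of_le hp hf), integral_mul_eq_inner _ _⟩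

/-- The limit operator in terms of inner products in `L²`. -/
lemma limitOperator_eq {p r : ℝ≥0∞} (hp : 2 ≤ p) (hr : 2 ≤ r)
    {A : S.Pt d → Matrix (Fin d) (Fin d) ℝ} {b₂ : S.Pt d → EuclideanSpace ℝ (Fin d)}
    (hA : ∀ i j, MemLp (fun x => A x i j) p volume) (hb : ∀ j, MemLp (fun x => b₂ x j) r volume)
    (u : SobolevH1 S d) {φ : S.Pt d → ℝ} (hφ : IsTestFunction φ) :
    limitOperator A b₂ u φ = -(∑ j, inner ℝ (u.partial j) (hφ.toH1.partial j))
      - (∑ i, ∑ j, inner ℝ (u.partial j) (((hφ.pderiv i).memLp_mul_of_le hp (hA i j)).toLp _))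
      + ∑ j, inner ℝ (u.partial j) ((hφ.memLp_mul_of_le hr (hb j)).toLp _) := by
  unfold limitOperator
  congr 1
  · congr 1
    · congr 1
      rw [integral_finsetSum _ fun i _ => integrable_Lp_mul _ (hφ.memLp_partialDeriv i)]
      refine Finset.sum_congr rfl fun i _ => ?_
      rw [integral_mul_eq_inner _ (hφ.memLp_partialDeriv i)]
      rfl
    · have h1 := fun i j => integral_coef_eq_inner hp (hA i j) (hφ.pderiv i) (u.partial j)
      simp only [Finset.sum_mul]
      rw [integral_finsetSum _ fun i _ => integrable_finsetSum _ fun j _ => (h1 i j).1]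
      refine Finset.sum_congr rfl fun i _ => ?_
      rw [integral_finsetSum _ fun j _ => (h1 i j).1]
      exact Finset.sum_congr rfl fun j _ => (h1 i j).2
  · have h1 := fun j => integral_coef_eq_inner hr (hb j) hφ (u.partial j)
    simp only [Finset.sum_mul]
    rw [integral_finsetSum _ fun j _ => (h1 j).1]
    exact Finset.sum_congr rfl fun j _ => (h1 j).2

/-! ### The mollified coefficients -/

section MollifiedCoefficients

variable {ρ : EuclideanSpace ℝ (Fin d) → ℝ} {A : S.Pt d → Matrix (Fin d) (Fin d) ℝ}
  {b₂ : S.Pt d → EuclideanSpace ℝ (Fin d)} {p r : ℝ≥0∞}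

/-- The mollified entries `ρⁿ ∗ Aᵢⱼ`. -/
def mollifiedMatrix (ρ : EuclideanSpace ℝ (Fin d) → ℝ) (A : S.Pt d → Matrix (Fin d) (Fin d) ℝ)
    (n : ℕ+) (i j : Fin d) : S.Pt d → ℝ :=
  kernelConv (scaledMollifier ρ n) fun x => A x i j

/-- The mollified components `ρⁿ ∗ b₂ʲ`. -/
def mollifiedField (ρ : EuclideanSpace ℝ (Fin d) → ℝ) (b₂ : S.Pt d → EuclideanSpace ℝ (Fin d))
    (n : ℕ+) (j : Fin d) : S.Pt d → ℝ :=
  kernelConv (scaledMollifier ρ n) fun x => b₂ x j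

lemma IsMollifier.partialDeriv_mollifiedMatrix (hρ : IsMollifier ρ) (hp : 1 ≤ p)
    (hA : ∀ i j, MemLp (fun x => A x i j) p volume) (n : ℕ+) (i j : Fin d) :
    partialDeriv i (mollifiedMatrix ρ A n i j) = kernelConv (fun z =>
      fderiv ℝ (scaledMollifier ρ n) z (EuclideanSpace.single i 1)) fun x => A x i j :=
  funext fun x =>
    partialDeriv_kernelConv (hρ.scaled n).smooth (hρ.scaled n).compactSupport hp (hA i j) i x

/-- The derivative placed on the mollifier is the derivative of the mollified matrix, which brings
the drift into the form required by `driftOp_eq`. -/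
lemma IsMollifier.mollifiedDrift_eq (hρ : IsMollifier ρ) (hp : 1 ≤ p)
    (hA : ∀ i j, MemLp (fun x => A x i j) p volume) (n : ℕ+) (j : Fin d) (x : S.Pt d) :
    mollifiedDrift ρ n A b₂ x j
      = (∑ i, partialDeriv i (mollifiedMatrix ρ A n i j) x) + mollifiedField ρ b₂ n j x := by
  simp only [hρ.partialDeriv_mollifiedMatrix hp hA]
  rfl

lemma IsMollifier.contDiff_mollifiedMatrix (hρ : IsMollifier ρ) (hp : 1 ≤ p)
    (hA : ∀ i j, MemLp (fun x => A x i j) p volume) (n : ℕ+) (i j : Fin d) :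
    ContDiff ℝ ∞ (mollifiedMatrix ρ A n i j ∘ S.proj) :=
  contDiff_kernelConv_comp_proj (hρ.scaled n).smooth (hρ.scaled n).compactSupport hp (hA i j)

lemma IsMollifier.isBddMeas_mollifiedMatrix (hρ : IsMollifier ρ) (hp : 1 ≤ p)
    (hA : ∀ i j, MemLp (fun x => A x i j) p volume) (n : ℕ+) (i j : Fin d) :
    IsBddMeas (mollifiedMatrix ρ A n i j) :=
  isBddMeas_kernelConv (hρ.scaled n).smooth (hρ.scaled n).compactSupport hp (hA i j)

lemma IsMollifier.isBddMeas_mollifiedField (hρ : IsMollifier ρ) (hr : 1 ≤ r)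
    (hb : ∀ j, MemLp (fun x => b₂ x j) r volume) (n : ℕ+) (j : Fin d) :
    IsBddMeas (mollifiedField ρ b₂ n j) :=
  isBddMeas_kernelConv (hρ.scaled n).smooth (hρ.scaled n).compactSupport hr (hb j)

lemma IsMollifier.isBddMeas_partialDeriv_mollifiedMatrix (hρ : IsMollifier ρ) (hp : 1 ≤ p)
    (hA : ∀ i j, MemLp (fun x => A x i j) p volume) (n : ℕ+) (i j : Fin d) :
    IsBddMeas (partialDeriv i (mollifiedMatrix ρ A n i j)) := by
  rw [hρ.partialDeriv_mollifiedMatrix hp hA]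
  refine isBddMeas_kernelConv ?_ ((hρ.scaled n).compactSupport.fderiv_apply ℝ _) hp (hA i j)
  exact ((hρ.scaled n).smooth.fderiv_right (m := ∞) (by simp)).clm_apply contDiff_const

lemma mollifiedMatrix_antisymm (hanti : ∀ᵐ x, (A x)ᵀ = -A x) (n : ℕ+) (i j : Fin d)
    (x : S.Pt d) : mollifiedMatrix ρ A n i j x = -mollifiedMatrix ρ A n j i x := by
  unfold mollifiedMatrix
  rw [← kernelConv_neg]
  refine congrFun (kernelConv_congr_ae _ ?_) x
  filter_upwards [hanti] with y hy
  exact congrFun (congrFun hy j) i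

lemma IsMollifier.isBddMeas_mollifiedDrift (hρ : IsMollifier ρ) (hp : 1 ≤ p) (hr : 1 ≤ r)
    (hA : ∀ i j, MemLp (fun x => A x i j) p volume)
    (hb : ∀ j, MemLp (fun x => b₂ x j) r volume) (n : ℕ+) (j : Fin d) :
    IsBddMeas fun x => mollifiedDrift ρ n A b₂ x j := by
  simp only [hρ.mollifiedDrift_eq hp hA]
  exact (IsBddMeas.sum fun i => hρ.isBddMeas_partialDeriv_mollifiedMatrix hp hA n i j).add
    (hρ.isBddMeas_mollifiedField hr hb n j)

/-- Weak limits of `H¹` functions may be taken in the mollified operators, in the sense of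
distributions. -/
lemma IsMollifier.tendsto_driftOp_toH1 (hρ : IsMollifier ρ) (hp : 2 ≤ p) (hr : 2 ≤ r)
    (hA : ∀ i j, MemLp (fun x => A x i j) p volume) (hanti : ∀ᵐ x, (A x)ᵀ = -A x)
    (hb : ∀ j, MemLp (fun x => b₂ x j) r volume)
    (hβ : ∀ n j, IsBddMeas fun x => mollifiedDrift ρ n A b₂ x j)
    {ν : ℕ → ℕ+} (hν : Tendsto ν atTop atTop) {U : ℕ → SobolevH1 S d} {V : SobolevH1 S d} {C : ℝ}
    (hC : ∀ m, ‖U m‖ ≤ C)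
    (hU : ∀ v : SobolevH1 S d →L[ℝ] ℝ, Tendsto (fun m => v (U m)) atTop (𝓝 (v V)))
    {φ : S.Pt d → ℝ} (hφ : IsTestFunction φ) :
    Tendsto (fun m => driftOp (hβ (ν m)) (U m) hφ.toH1) atTop (𝓝 (limitOperator A b₂ V φ)) := by
  have hp1 : 1 ≤ p := one_le_two.trans hp
  have hr1 : 1 ≤ r := one_le_two.trans hr
  have hweak : ∀ j (z : LTwo S d), Tendsto (fun m => inner ℝ ((U m).partial j) z) atTop
      (𝓝 (inner ℝ (V.partial j) z)) := by
    intro j z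
    have h1 := hU ((innerSL ℝ z).comp (SobolevH1.partialL j))
    have h2 : ∀ W : SobolevH1 S d, ((innerSL ℝ z).comp (SobolevH1.partialL j)) W
        = inner ℝ (W.partial j) z := fun W => real_inner_comm (W.partial j) z
    simpa only [h2] using h1
  have hbd : ∀ j m, ‖(U m).partial j‖ ≤ C := fun j m => ((U m).norm_partial_le j).trans (hC m)
  rw [limitOperator_eq hp hr hA hb V hφ]
  -- The divergence form leaves no derivative on the coefficients, and symmetry of multiplication
  -- moves these onto `φ`; each term then pairs a weakly with a strongly convergent sequence.
  simp only [driftOp_eq (hρ.contDiff_mollifiedMatrix hp1 hA _)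
    (hρ.isBddMeas_mollifiedMatrix hp1 hA _) (hρ.isBddMeas_partialDeriv_mollifiedMatrix hp1 hA _)
    (mollifiedMatrix_antisymm hanti _) (hρ.isBddMeas_mollifiedField hr1 hb _) (hβ _)
    (hρ.mollifiedDrift_eq hp1 hA _), IsBddMeas.inner_mulL_comm]
  refine ((tendsto_finsetSum _ fun j _ => hweak j _).neg.sub
    (tendsto_finsetSum _ fun i _ => tendsto_finsetSum _ fun j _ => ?_)).add
    (tendsto_finsetSum _ fun j _ => ?_)
  · exact tendsto_inner_of_weak_of_strong (hweak j) (hbd j)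
      ((tendsto_mulL_kernelConv_test hp (hA i j) (hφ.pderiv i) hρ
        fun n => hρ.isBddMeas_mollifiedMatrix hp1 hA n i j).comp hν)
  · exact tendsto_inner_of_weak_of_strong (hweak j) (hbd j)
      ((tendsto_mulL_kernelConv_test hr (hb j) hφ hρ
        fun n => hρ.isBddMeas_mollifiedField hr1 hb n j).comp hν)

lemma limitOperator_zero (φ : S.Pt d → ℝ) (hφ : IsTestFunction φ) (hp : 2 ≤ p) (hr : 2 ≤ r)
    (hA : ∀ i j, MemLp (fun x => A x i j) p volume)
    (hb : ∀ j, MemLp (fun x => b₂ x j) r volume) :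
    limitOperator A b₂ (0 : SobolevH1 S d) φ = 0 := by
  have h0 : ∀ j, (0 : SobolevH1 S d).partial j = 0 := fun j => rfl
  rw [limitOperator_eq hp hr hA hb 0 hφ]
  simp [h0]

/-- Uniform coercivity of `lam - (Δ + bⁿ · ∇)`. -/
lemma IsMollifier.exists_driftOp_coercive (hd : 2 ≤ d) (hρ : IsMollifier ρ) (hp : 1 ≤ p)
    (hr : 1 ≤ r) (hA : ∀ i j, MemLp (fun x => A x i j) p volume) (hanti : ∀ᵐ x, (A x)ᵀ = -A x)
    (hb : ∀ j, MemLp (fun x => b₂ x j) r volume) (hdr : (d : ℝ≥0∞) < r ∨ (3 ≤ d ∧ r = d))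
    (hβ : ∀ n j, IsBddMeas fun x => mollifiedDrift ρ n A b₂ x j) :
    ∃ lam₀ : ℝ, 0 < lam₀ ∧ ∀ (lam : ℝ) (n : ℕ+) (u : SobolevH1 S d),
      min (1 / 2) (lam - lam₀) * ‖u‖ ^ 2 ≤ (lam • H1ToHm1 S d - driftOp (hβ n)) u u := by
  have hd0 : 0 < d := by omega
  have hδ : (0 : ℝ) < 1 / (4 * d) := by
    have : (0 : ℝ) < d := by exact_mod_cast hd0
    positivity
  choose M hM0 hM using fun j => exists_norm_mulL_kernelConv_le hd hdr hρ (hb j) hδ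
  have hN : 0 ≤ ∑ j, M j := Finset.sum_nonneg fun j _ => hM0 j
  -- The sum of the `M j` serves as one constant valid for every component of `b₂`.
  refine ⟨(d * (∑ j, M j) + 1) ^ 2, by positivity, fun lam n u => ?_⟩
  refine driftOp_coercive (hρ.contDiff_mollifiedMatrix hp hA n)
    (hρ.isBddMeas_mollifiedMatrix hp hA n) (hρ.isBddMeas_partialDeriv_mollifiedMatrix hp hA n)
    (mollifiedMatrix_antisymm hanti n) (hρ.isBddMeas_mollifiedField hr hb n) (hβ n)
    (hρ.mollifiedDrift_eq hp hA n) hd0 (fun j v => ?_) lam u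
  refine (hM j n _ v).trans (add_le_add (mul_le_mul_of_nonneg_right ?_ (norm_nonneg _)) le_rfl)
  exact Finset.single_le_sum (fun j _ => hM0 j) (Finset.mem_univ j)

end MollifiedCoefficients

/-! ### Weak limits of the resolvents -/

instance : TopologicalSpace.SeparableSpace (SobolevHm1 S d) :=
  (InnerProductSpace.toDual ℝ (SobolevH1 S d)).surjective.denseRange.separableSpace
    (InnerProductSpace.toDual ℝ (SobolevH1 S d)).continuous

/-- Weak operator compactness, tested against the dual space. -/
lemma exists_subseq_tendsto_functional (T : ℕ → SobolevHm1 S d →L[ℝ] SobolevH1 S d) {C : ℝ}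
    (hT : ∀ m, ‖T m‖ ≤ C) :
    ∃ l : ℕ → ℕ, StrictMono l ∧ ∃ G : SobolevHm1 S d →L[ℝ] SobolevH1 S d,
      ∀ (F : SobolevHm1 S d) (v : SobolevH1 S d →L[ℝ] ℝ),
        Tendsto (fun m => v (T (l m) F)) atTop (𝓝 (v (G F))) := by
  obtain ⟨l, hl, G, hG⟩ := exists_subseq_tendsto_weak_operator T hT
  refine ⟨l, hl, G, fun F v => ?_⟩
  have h1 : ∀ W : SobolevH1 S d,
      inner ℝ W ((InnerProductSpace.toDual ℝ (SobolevH1 S d)).symm v) = v W := fun W => by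
    rw [real_inner_comm, InnerProductSpace.toDual_symm_apply]
  simpa only [h1] using hG F ((InnerProductSpace.toDual ℝ (SobolevH1 S d)).symm v)

lemma LTwoToHm1_apply (f : LTwo S d) (v : SobolevH1 S d) :
    LTwoToHm1 S d f v = inner ℝ f (H1ToLTwo S d v) := rfl

end

/-! ### The main theorem -/

theorem mainTheorem9 (d : ℕ) (hd : 2 ≤ d) :
    ∃ K : ℝ, 0 < K ∧
    ∀ (S : BaseSpace) (ρ : EuclideanSpace ℝ (Fin d) → ℝ), IsMollifier ρ →
    ∀ (p r : ℝ≥0∞) (A : S.Pt d → Matrix (Fin d) (Fin d) ℝ)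
      (b₂ : S.Pt d → EuclideanSpace ℝ (Fin d)),
    2 ≤ p → (∀ i j, MemLp (fun x => A x i j) p volume) → (∀ᵐ x, (A x)ᵀ = -A x) →
    MemLp b₂ r volume →
    ((d : ℝ≥0∞) < r ∨ (3 ≤ d ∧ r = d ∧ eLpNorm b₂ r volume ≤ ENNReal.ofReal K)) →
    ∃ L : ℕ+ → SobolevH1 S d →L[ℝ] SobolevHm1 S d,
      (∀ n, IsLaplacianPlusDrift (mollifiedDrift ρ n A b₂) (L n)) ∧
      ∃ lam₀ : ℝ, 0 < lam₀ ∧ ∀ lam : ℝ, lam₀ < lam →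
        ∃ R : ℕ+ → SobolevHm1 S d →L[ℝ] SobolevH1 S d,
          -- `R n` is the resolvent `(lam - Lⁿ)⁻¹`, bounded uniformly in `n`
          (∀ n, (lam • H1ToHm1 S d - L n).comp (R n) = ContinuousLinearMap.id ℝ (SobolevHm1 S d) ∧
            (R n).comp (lam • H1ToHm1 S d - L n) = ContinuousLinearMap.id ℝ (SobolevH1 S d)) ∧
          BddAbove (Set.range fun n => ‖R n‖) ∧
          ∀ k : ℕ → ℕ+, StrictMono k → ∃ l : ℕ → ℕ, StrictMono l ∧
            ∃ P : C0Semigroup (LTwo S d),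
              -- the generator has domain in `H¹` and is given by `Δu + ∇·(A·∇u) + b₂·∇u`
              (∀ u w : LTwo S d, P.GeneratorMaps u w →
                ∃ U : SobolevH1 S d, H1ToLTwo S d U = u ∧
                  ∀ φ : S.Pt d → ℝ, IsTestFunction φ →
                    ∫ x, w x * φ x = limitOperator A b₂ U φ) ∧
              -- its resolvent exists on `L²`, extends to `H⁻¹ → H¹`, and is the weak limit
              ∃ R₂ : LTwo S d →L[ℝ] LTwo S d, P.IsResolvent lam R₂ ∧
                ∃ G : SobolevHm1 S d →L[ℝ] SobolevH1 S d,
                  (∀ f : LTwo S d, H1ToLTwo S d (G (LTwoToHm1 S d f)) = R₂ f) ∧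
                  ∀ (F : SobolevHm1 S d) (v : SobolevH1 S d →L[ℝ] ℝ),
                    Tendsto (fun m => v (R (k (l m)) F)) atTop (𝓝 (v (G F))) := by
  -- The value `1` is a convenient choice: `lam₀` may depend on `b₂`, and the truncation level in
  -- the splitting of `b₂` is adapted to it.
  refine ⟨1, one_pos, fun S ρ hρ p r A b₂ hp hA hanti hb₂ hr => ?_⟩
  have hdr : (d : ℝ≥0∞) < r ∨ (3 ≤ d ∧ r = d) := hr.imp_right fun h => ⟨h.1, h.2.1⟩
  have hr2 : 2 ≤ r := by
    have h2 : (2 : ℝ≥0∞) ≤ d := by exact_mod_cast hd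
    rcases hdr with h | h
    · exact h2.trans h.le
    · exact h2.trans h.2.ge
  have hp1 : 1 ≤ p := one_le_two.trans hp
  have hr1 : 1 ≤ r := one_le_two.trans hr2
  have hb : ∀ j, MemLp (fun x => b₂ x j) r volume := fun j =>
    hb₂.of_le ((EuclideanSpace.proj (𝕜 := ℝ) j).continuous.comp_aestronglyMeasurable hb₂.1)
      (Eventually.of_forall fun x => PiLp.norm_apply_le _ _)
  have hβ := hρ.isBddMeas_mollifiedDrift hp1 hr1 hA hb
  refine ⟨fun n => driftOp (hβ n), fun n => isLaplacianPlusDrift_driftOp (hβ n), ?_⟩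
  obtain ⟨lam₀, hlam₀, hco⟩ := hρ.exists_driftOp_coercive hd hp1 hr1 hA hanti hb hdr hβ
  refine ⟨lam₀, hlam₀, fun lam hlam => ?_⟩
  have hc : 0 < min (1 / 2) (lam - lam₀) := lt_min one_half_pos (sub_pos.2 hlam)
  choose R hR1 hR2 hR3 using fun n =>
    exists_inverse_of_coercive (lam • H1ToHm1 S d - driftOp (hβ n)) hc (hco lam n)
  refine ⟨R, fun n => ⟨hR1 n, hR2 n⟩, ⟨_, Set.forall_mem_range.2 hR3⟩, fun k hk => ?_⟩
  obtain ⟨l, hl, G, hG⟩ := exists_subseq_tendsto_functional (fun m => R (k m)) fun m => hR3 (k m)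
  have hRF : ∀ n (F : SobolevHm1 S d), (lam • H1ToHm1 S d - driftOp (hβ n)) (R n F) = F :=
    fun n F => DFunLike.congr_fun (hR1 n) F
  have hRF' : ∀ n (F : SobolevHm1 S d) (v : SobolevH1 S d),
      lam * inner ℝ (H1ToLTwo S d (R n F)) (H1ToLTwo S d v) - driftOp (hβ n) (R n F) v = F v :=
    fun n F v => DFunLike.congr_fun (hRF n F) v
  -- The resolvent equations tested with `φ` pass to the limit term by term, giving the limit
  -- equation for `G F`.
  have hlim : ∀ (F : SobolevHm1 S d) (φ : S.Pt d → ℝ) (hφ : IsTestFunction φ),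
      lam * inner ℝ (H1ToLTwo S d (G F)) (hφ.memLp.toLp φ) - limitOperator A b₂ (G F) φ
        = F hφ.toH1 := by
    intro F φ hφ
    have hν : Tendsto (fun m => k (l m)) atTop atTop :=
      tendsto_atTop_atTop_of_monotone (hk.comp hl).monotone fun n => ⟨n, PNat.coe_le_coe _ _ |>.1
        (StrictMono.le_apply (f := fun m => (k (l m) : ℕ)) fun _ _ h => hk (hl h))⟩
    have h1 := hρ.tendsto_driftOp_toH1 hp hr2 hA hanti hb hβ hν (U := fun m => R (k (l m)) F)
      (fun m => ((R (k (l m))).le_opNorm F).trans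
        (mul_le_mul_of_nonneg_right (hR3 _) (norm_nonneg F))) (hG F) hφ
    have h2 := (hG F (H1ToHm1 S d hφ.toH1)).const_mul lam
    have h3 : ∀ W : SobolevH1 S d, H1ToHm1 S d hφ.toH1 W
        = inner ℝ (H1ToLTwo S d W) (hφ.memLp.toLp φ) := fun W =>
      real_inner_comm (H1ToLTwo S d W) (hφ.memLp.toLp φ)
    simp only [h3] at h2
    refine tendsto_nhds_unique (h2.sub h1) (tendsto_const_nhds.congr fun m => ?_)
    exact (hRF' (k (l m)) F hφ.toH1).symm
  set J : LTwo S d →L[ℝ] LTwo S d := (H1ToLTwo S d).comp (G.comp (LTwoToHm1 S d)) with hJ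
  have hJapp : ∀ f, J f = H1ToLTwo S d (G (LTwoToHm1 S d f)) := fun f => rfl
  -- With `F` the functional of `x`, `⟪J x, x⟫` is the limit of `F (R n F)`, the value of the
  -- coercive form on the diagonal at `R n F`.
  have hmono : ∀ x, 0 ≤ inner ℝ (J x) x := by
    intro x
    have h1 := hG (LTwoToHm1 S d x) (LTwoToHm1 S d x)
    rw [LTwoToHm1_apply x (G _), real_inner_comm] at h1
    refine ge_of_tendsto' h1 fun m => ?_
    have h2 := hco lam (k (l m)) (R (k (l m)) (LTwoToHm1 S d x))
    rw [hRF] at h2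
    exact (mul_nonneg hc.le (sq_nonneg _)).trans h2
  -- If `J x = 0`, then `G` vanishes at `x` already in `H¹`, and the limit equation shows that `x`
  -- annihilates every test function.
  have hinj : Function.Injective J := by
    refine (injective_iff_map_eq_zero J).2 fun x hx => ?_
    have h0 : G (LTwoToHm1 S d x) = 0 :=
      SobolevH1.ext_of_H1ToLTwo (by rw [← hJapp, hx, map_zero])
    refine eq_zero_of_forall_integral_test_eq_zero fun φ hφ => ?_
    have h1 := hlim (LTwoToHm1 S d x) φ hφ
    rw [h0, map_zero, inner_zero_left, limitOperator_zero φ hφ hp hr2 hA hb] at h1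
    rw [integral_mul_eq_inner x hφ.memLp]
    have h2 : LTwoToHm1 S d x hφ.toH1 = inner ℝ x (hφ.memLp.toLp φ) := rfl
    rw [← h2, ← h1]
    ring
  -- The semigroup is built from the limit `J` at this particular `lam`, so it may vary with `lam`
  -- as well as with the subsequence, as the order of quantifiers permits.
  obtain ⟨P, hP⟩ := exists_semigroup_generatorMaps_iff hmono hinj lam
  refine ⟨l, hl, P, fun u w huw => ?_, J, ⟨fun f => ?_, fun u w huw => ?_⟩, G, fun f => rfl, hG⟩
  -- An element of the domain is `u = J (lam • u - w)`, so it has the `H¹` representative `G (lam •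
  -- u - w)`, for which the limit equation identifies `w`.
  · refine ⟨G (LTwoToHm1 S d (lam • u - w)), ((hP u w).1 huw).symm, fun φ hφ => ?_⟩
    have h1 := hlim (LTwoToHm1 S d (lam • u - w)) φ hφ
    have h2 : LTwoToHm1 S d (lam • u - w) hφ.toH1
        = lam * inner ℝ u (hφ.memLp.toLp φ) - inner ℝ w (hφ.memLp.toLp φ) := by
      rw [← real_inner_smul_left, ← inner_sub_left]
      rfl
    rw [← hJapp, ← (hP u w).1 huw, h2] at h1
    rw [integral_mul_eq_inner w hφ.memLp]
    linarith
  · refine ⟨lam • J f - f, (hP _ _).2 ?_, sub_sub_cancel _ _⟩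
    rw [sub_sub_cancel]
  · exact ((hP u w).1 huw).symm
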